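/- Let $(\mathcal B_a,|\cdot|_a)_{a\in\mathbb R}$ be a monotone family of interpolation spaces: separable Banach spaces with compatible, dense, continuous embeddings $\mathcal B_b\hookrightarrow\mathcal B_a$ for $a\le b$ and $|x|_{a_2}^{a_3-a_1}\lesssim|x|_{a_1}^{a_3-a_2}|x|_{a_3}^{a_2-a_1}$ for $a_1\le a_2\le a_3$, $x\in\mathcal B_{a_3}$. Let $(S_t)_{t\ge0}$ be a semigroup that acts consistently and strongly continuously on all $\mathcal B_a$, with $|(S_t-\mathrm{Id})x|_a\lesssim t|x|_{a+1}$ and $|S_tx|_{a+1}\lesssim t^{-1}|x|_a$ for $t\in(0,1]$ and every $a\in\mathbb R$. Let $\alpha\in\mathbb R$, $\gamma\in(1/3,1/2]$, $\sigma\in[0,\gamma)$, $\delta\in[0,1)$. Let $F:\mathcal B_\alpha\to\mathcal B_{\alpha-\delta}$ be Lipschitz with $F(0)=0$, strictly Fréchet differentiable at $0$ with $DF(0)=0$ (e.g. $F$ is $C^1$ near $0$ and $DF(0)=0$). For $\theta\in\{0,\gamma,2\gamma\}$ let $G:\mathcal B_{\alpha-\theta}\to\mathcal B_{\alpha-\theta-\sigma}$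 (compatibly in $\theta$) be Lipschitz and three times Fréchet differentiable with bounded derivatives $D^kG$, $k=1,2,3$, and $G(0)=DG(0)=D^2G(0)=0$. A $\gamma$-Hölder rough path $\mathbf W=(W,\mathbb W)$ on $[0,1]$ is a real-valued $\gamma$-Hölder path $W$ together with $\mathbb W_{s,t}\in\mathbb R$, $0\le s\le t\le1$, with finite $2\gamma$-Hölder seminorm $|\mathbb W|_{2\gamma}=\sup_{s<t}|\mathbb W_{s,t}|/(t-s)^{2\gamma}$, such that $\mathbb W_{s,t}-\mathbb W_{s,u}-\mathbb W_{u,t}=W_{s,u}W_{u,t}$ for $s\le u\le t$, where $W_{s,t}=W_t-W_s$. Put $\rho_\gamma(\mathbf W)=|W|_\gamma+|\mathbb W|_{2\gamma}$ (Hölder seminorms). Let $\mathcal D=D^{2\gamma}_{W,\alpha}$ be the space of pairs $(U,U')\in C([0,1];\mathcal B_\alpha)\times C([0,1];\mathcal B_{\alpha-\gamma})$ with $U'\in C^\gamma([0,1];\mathcal B_{\alpha-2\gamma})$ whose remainder $R^U_{s,t}=U_t-U_s-U'_sW_{s,t}$ is $\gamma$-Hölder in $\mathcal B_{\alpha-\gamma}$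 and $2\gamma$-Hölder in $\mathcal B_{\alpha-2\gamma}$, with norm $$\|U,U'\|_{\mathcal D}=\|U\|_{\infty,\mathcal B_\alpha}+\|U'\|_{\infty,\mathcal B_{\alpha-\gamma}}+\|U'\|_{\gamma,\mathcal B_{\alpha-2\gamma}}+\|R^U\|_{2\gamma,\mathcal B_{\alpha-2\gamma}},$$ where $\|\cdot\|_{\gamma,\cdot}$, $\|\cdot\|_{2\gamma,\cdot}$ are Hölder seminorms. Let $f:[0,\infty)\to[0,1]$ be $C^3$ with $f=1$ on $[0,1/2]$ and $f=0$ on $[1,\infty)$. For $R>0$ set $\chi_R(U)=f(\|U,U'\|_{\mathcal D}/R)\,U$, $\chi_R(U)'=f(\|U,U'\|_{\mathcal D}/R)\,U'$, $F_R(U)(t)=F(\chi_R(U)_t)$, $G_R(U)(t)=G(\chi_R(U)_t)$ and $(G_R(U))'(t)=DG(\chi_R(U)_t)\chi_R(U)'_t$. **Theorem.** For every $M\ge0$ there is $R_0>0$ such that for every $\gamma$-Hölder rough path $\mathbf W$ on $[0,1]$ with $\rho_\gamma(\mathbf W)\le M$, every $R\in(0,R_0]$ and every $\xi\in\mathcal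 B_\alpha$ there is exactly one $(Y,Y')\in\mathcal D$ with $Y'=G_R(Y)$ such that for all $t\in[0,1]$ $$Y_t=S_t\xi+\int_0^tS_{t-r}F_R(Y)(r)\,dr+\int_0^tS_{t-r}G_R(Y)(r)\,d\mathbf W_r\quad\text{in }\mathcal B_\alpha.$$ Here the first integral is a Bochner integral in $\mathcal B_{\alpha-\delta}$ and the second one is the limit in $\mathcal B_{\alpha-2\gamma-\sigma}$, as $|\mathcal P|\to0$, of $\sum_{[u,v]\in\mathcal P}\big(S_{t-u}G_R(Y)(u)W_{u,v}+S_{t-u}(G_R(Y))'(u)\mathbb W_{u,v}\big)$ over partitions $\mathcal P$ of $[0,t]$; both integrals take values in $\mathcal B_\alpha$. -/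

import Mathlib

open Set
open scoped NNReal ENNReal

noncomputable section

namespace RoughPDE

/-- The time interval `[0,1]`. -/
abbrev I : Type := Set.Icc (0 : ℝ) 1

/-- A monotone family of interpolation spaces: a scale `(B a)`, `a : ℝ`, of normed spaces with dense
continuous inclusions `ι b a : B b → B a` for `a ≤ b` (compatible with each other) satisfying the
interpolation inequality. For `b < a` the map `ι b a` carries no information and is never used.
(Completeness and separability of the `B a` are type class arguments of the theorem.) -/
structure InterpolationScale (B : ℝ → Type*) [∀ a, NormedAddCommGroup (B a)]
    [∀ a, NormedSpace ℝ (B a)] where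
  ι : ∀ b a : ℝ, B b →L[ℝ] B a
  ι_self : ∀ (a : ℝ) (x : B a), ι a a x = x
  ι_comp : ∀ {a b c : ℝ}, a ≤ b → b ≤ c → ∀ x : B c, ι b a (ι c b x) = ι c a x
  ι_injective : ∀ {a b : ℝ}, a ≤ b → Function.Injective (ι b a)
  ι_dense : ∀ {a b : ℝ}, a ≤ b → DenseRange (ι b a)
  interpolation : ∀ {a₁ a₂ a₃ : ℝ}, a₁ ≤ a₂ → a₂ ≤ a₃ → ∃ C : ℝ, ∀ x : B a₃,
    ‖ι a₃ a₂ x‖ ^ (a₃ - a₁) ≤ C * (‖ι a₃ a₁ x‖ ^ (a₃ - a₂) * ‖x‖ ^ (a₂ - a₁))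

variable {B : ℝ → Type*} [∀ a, NormedAddCommGroup (B a)] [∀ a, NormedSpace ℝ (B a)]

/-- A strongly continuous semigroup acting consistently on the scale, with the parabolic bounds
`|(S_t - Id) x|_a ≲ t |x|_{a+1}` and `|S_t x|_{a+1} ≲ t⁻¹ |x|_a` for `t ∈ (0,1]`.
Only times `t ≥ 0` are meaningful. -/
structure ParabolicSemigroup (𝓑 : InterpolationScale B) where
  S : ∀ a : ℝ, ℝ → B a →L[ℝ] B a
  S_zero : ∀ (a : ℝ) (x : B a), S a 0 x = x
  S_add : ∀ (a : ℝ) {s t : ℝ}, 0 ≤ s → 0 ≤ t → ∀ x : B a, S a (s + t) x = S a s (S a t x)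
  S_continuous : ∀ (a : ℝ) (x : B a), ContinuousOn (fun t => S a t x) (Ici 0)
  S_ι : ∀ {a b : ℝ}, a ≤ b → ∀ {t : ℝ}, 0 ≤ t → ∀ x : B b, 𝓑.ι b a (S b t x) = S a t (𝓑.ι b a x)
  S_sub_id : ∀ a : ℝ, ∃ C : ℝ, ∀ t ∈ Ioc (0 : ℝ) 1, ∀ x : B (a + 1),
    ‖S a t (𝓑.ι (a + 1) a x) - 𝓑.ι (a + 1) a x‖ ≤ C * t * ‖x‖
  S_smoothing : ∀ a : ℝ, ∃ C : ℝ, ∀ t ∈ Ioc (0 : ℝ) 1, ∀ x : B a,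
    ∃ y : B (a + 1), 𝓑.ι (a + 1) a y = S a t x ∧ ‖y‖ ≤ C * t⁻¹ * ‖x‖

/-- The `θ`-Hölder seminorm `sup_{s < t} ‖Ξ_{s,t}‖ / |t - s|^θ` on `[0,1]` of a two-parameter
function, as an extended nonnegative number. -/
def holder {E : Type*} [NormedAddCommGroup E] (θ : ℝ) (Ξ : I → I → E) : ℝ≥0∞ :=
  ⨆ (s : I) (t : I) (_ : s < t), ENNReal.ofReal (‖Ξ s t‖ / ((t : ℝ) - s) ^ θ)

/-- A (one-dimensional) `γ`-Hölder rough path `(W, 𝕎)` on `[0,1]`; `𝕎 s t` matters for `s ≤ t`. -/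
structure RoughPath (γ : ℝ) where
  W : I → ℝ
  WW : I → I → ℝ
  chen : ∀ s u t : I, s ≤ u → u ≤ t → WW s t - WW s u - WW u t = (W u - W s) * (W t - W u)
  holder_W : holder γ (fun s t => W t - W s) < ∞
  holder_WW : holder (2 * γ) WW < ∞

/-- The size `ρ_γ(𝐖)` of a rough path. -/
def RoughPath.rho {γ : ℝ} (X : RoughPath γ) : ℝ≥0∞ :=
  holder γ (fun s t => X.W t - X.W s) + holder (2 * γ) X.WW

/-- Pairs `(U, U')` of continuous paths on `[0,1]` in `B_α` and `B_{α-γ}`. -/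
abbrev PathPair (B : ℝ → Type*) [∀ a, NormedAddCommGroup (B a)] (α γ : ℝ) : Type _ :=
  C(I, B α) × C(I, B (α - γ))

/-- The remainder `R^U_{s,t} = U_t - U_s - U'_s W_{s,t}`, viewed in `B_a` (with `a ≤ α - γ`). -/
def remainder (𝓑 : InterpolationScale B) (α : ℝ) {γ : ℝ} (X : RoughPath γ)
    (p : PathPair B α γ) (a : ℝ) (s t : I) : B a :=
  𝓑.ι α a (p.1 t) - 𝓑.ι α a (p.1 s) - (X.W t - X.W s) • 𝓑.ι (α - γ) a (p.2 s)

/-- Increments of the Gubinelli derivative, viewed in `B_{α-2γ}`. -/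
def derivIncrement (𝓑 : InterpolationScale B) (α γ : ℝ)
    (p : PathPair B α γ) (s t : I) : B (α - 2 * γ) :=
  𝓑.ι (α - γ) (α - 2 * γ) (p.2 t) - 𝓑.ι (α - γ) (α - 2 * γ) (p.2 s)

/-- The space `D^{2γ}_{W,α}([0,1])` of controlled rough paths. -/
def controlled (𝓑 : InterpolationScale B) (α : ℝ) {γ : ℝ} (X : RoughPath γ) :
    Set (PathPair B α γ) :=
  {p | holder γ (derivIncrement 𝓑 α γ p) < ∞ ∧
    holder γ (remainder 𝓑 α X p (α - γ)) < ∞ ∧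
    holder (2 * γ) (remainder 𝓑 α X p (α - 2 * γ)) < ∞}

/-- The norm `‖U‖_{∞,α} + ‖U'‖_{∞,α-γ} + ‖U'‖_{γ,α-2γ} + ‖R^U‖_{2γ,α-2γ}` of a controlled rough
path; all terms are finite on `controlled`. -/
def gubNorm (𝓑 : InterpolationScale B) (α : ℝ) {γ : ℝ} (X : RoughPath γ)
    (p : PathPair B α γ) : ℝ :=
  ‖p.1‖ + ‖p.2‖ + (holder γ (derivIncrement 𝓑 α γ p)).toReal
    + (holder (2 * γ) (remainder 𝓑 α X p (α - 2 * γ))).toReal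

/-- A `C³` cut-off function `f : [0,∞) → [0,1]` with `f = 1` on `[0,1/2]` and `f = 0` on `[1,∞)`
(its derivatives are then bounded). -/
structure IsCutoff (f : ℝ → ℝ) : Prop where
  smooth : ContDiffOn ℝ 3 f (Ici 0)
  range : ∀ x, 0 ≤ x → f x ∈ Icc (0 : ℝ) 1
  eq_one : ∀ x ∈ Icc (0 : ℝ) (1 / 2), f x = 1
  eq_zero : ∀ x, 1 ≤ x → f x = 0

/-- The path-dependent truncation `χ_R(U) = U f(‖U,U'‖/R)`, `χ_R(U)' = U' f(‖U,U'‖/R)`. -/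
def truncate (𝓑 : InterpolationScale B) (α : ℝ) {γ : ℝ} (X : RoughPath γ) (f : ℝ → ℝ) (R : ℝ)
    (p : PathPair B α γ) : PathPair B α γ :=
  f (gubNorm 𝓑 α X p / R) • p

/-- The drift: `F : B_α → B_{α-δ}` is Lipschitz, `F(0) = 0`, and `F` is strictly differentiable at
`0` with `DF(0) = 0` (as is the case if `F` is `C¹` near `0` with `DF(0) = 0`). -/
structure IsDrift (α δ : ℝ) (F : B α → B (α - δ)) : Prop where
  lipschitz : ∃ K : ℝ≥0, LipschitzWith K F
  zero : F 0 = 0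
  deriv_zero : HasStrictFDerivAt F (0 : B α →L[ℝ] B (α - δ)) 0

/-- The diffusion coefficient: on each of the levels `a = α, α-γ, α-2γ` a map
`G : B_a → B_{a-σ}` (these maps being restrictions of one another) which is Lipschitz, three times
Fréchet differentiable with bounded derivatives, and `G(0) = DG(0) = D²G(0) = 0`.
Other values of `a` are irrelevant. -/
structure IsDiffusion (𝓑 : InterpolationScale B) (α γ σ : ℝ) (G : ∀ a : ℝ, B a → B (a - σ)) :
    Prop where
  compat : ∀ a ∈ ({α, α - γ, α - 2 * γ} : Set ℝ), ∀ b ∈ ({α, α - γ, α - 2 * γ} : Set ℝ), a ≤ b →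
    ∀ x : B b, 𝓑.ι (b - σ) (a - σ) (G b x) = G a (𝓑.ι b a x)
  lipschitz : ∀ a ∈ ({α, α - γ, α - 2 * γ} : Set ℝ), ∃ K : ℝ≥0, LipschitzWith K (G a)
  differentiable : ∀ a ∈ ({α, α - γ, α - 2 * γ} : Set ℝ), ∀ k < 3,
    Differentiable ℝ (iteratedFDeriv ℝ k (G a))
  bounded : ∀ a ∈ ({α, α - γ, α - 2 * γ} : Set ℝ), ∀ k ∈ Icc 1 3,
    ∃ C : ℝ, ∀ x : B a, ‖iteratedFDeriv ℝ k (G a) x‖ ≤ C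
  zero : ∀ a ∈ ({α, α - γ, α - 2 * γ} : Set ℝ), G a 0 = 0
  deriv_zero : ∀ a ∈ ({α, α - γ, α - 2 * γ} : Set ℝ), ∀ k ∈ Icc 1 2,
    iteratedFDeriv ℝ k (G a) 0 = 0

/-- `Z` is the rough convolution `∫_s^t S_{t-r} U_r d𝐖_r` in `B_a`: the limit, as the mesh of the
partition `s = π 0 ≤ ⋯ ≤ π n = t` tends to zero, of the compensated Riemann sums
`∑ S_{t-u} U_u W_{u,v} + S_{t-u} U'_u 𝕎_{u,v}`. -/
def HasRoughIntegral {𝓑 : InterpolationScale B} (𝓢 : ParabolicSemigroup 𝓑) {γ : ℝ}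
    (X : RoughPath γ) (a : ℝ) (U U' : I → B a) (s t : I) (Z : B a) : Prop :=
  ∀ ε > 0, ∃ η > 0, ∀ (n : ℕ) (π : ℕ → I), Monotone π → π 0 = s → π n = t →
    (∀ i < n, (π (i + 1) : ℝ) - π i < η) →
    ‖(∑ i ∈ Finset.range n,
        ((X.W (π (i + 1)) - X.W (π i)) • 𝓢.S a ((t : ℝ) - π i) (U (π i))
          + X.WW (π i) (π (i + 1)) • 𝓢.S a ((t : ℝ) - π i) (U' (π i)))) - Z‖ < ε

/-- `(Y, Y')` is a mild solution, in the space of controlled rough paths on `[0,1]`, of the rough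
PDE with truncated coefficients `F_R = F ∘ χ_R`, `G_R = G ∘ χ_R` and initial datum `ξ`.
The drift integral is a Bochner integral in `B_{α-δ}` (where the integrand is continuous). The pair
`(G_R(Y), G_R(Y)')`, with `G_R(Y)'_r = DG(χ_R(Y)_r) χ_R(Y)'_r`, is controlled at the level `α - σ`,
so that its compensated Riemann sums converge in `B_{α-2γ-σ}`.
Both integrals are required to lie in `B_α`, where the equation is stated. -/
structure IsTruncatedMildSolution {𝓑 : InterpolationScale B} (𝓢 : ParabolicSemigroup 𝓑)
    {α γ σ δ : ℝ} (X : RoughPath γ) (F : B α → B (α - δ)) (G : ∀ a : ℝ, B a → B (a - σ))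
    (f : ℝ → ℝ) (R : ℝ) (ξ : B α) (p : PathPair B α γ) : Prop where
  mem : p ∈ controlled 𝓑 α X
  deriv_eq : ∀ t : I, p.2 t = 𝓑.ι (α - σ) (α - γ) (G α ((truncate 𝓑 α X f R p).1 t))
  mild : ∀ t : I, ∃ J K : B α,
    𝓑.ι α (α - δ) J = (∫ r in (0 : ℝ)..t, 𝓢.S (α - δ) ((t : ℝ) - r)
        (F ((truncate 𝓑 α X f R p).1 (projIcc 0 1 zero_le_one r)))) ∧
    HasRoughIntegral 𝓢 X (α - 2 * γ - σ)
      (fun r => 𝓑.ι (α - σ) (α - 2 * γ - σ) (G α ((truncate 𝓑 α X f R p).1 r)))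
      (fun r => 𝓑.ι (α - γ - σ) (α - 2 * γ - σ)
        (fderiv ℝ (G (α - γ)) (𝓑.ι α (α - γ) ((truncate 𝓑 α X f R p).1 r))
          ((truncate 𝓑 α X f R p).2 r)))
      0 t (𝓑.ι α (α - 2 * γ - σ) K) ∧
    p.1 t = 𝓢.S α t ξ + J + K

end RoughPDE

end

/-! The equation is solved by Picard iteration for the mild solution map on controlled paths, on all
of `[0,1]` at once. The contraction comes from the truncation and not from a short time interval.
The map `χ_R` sends everything into the ball of radius `R` and is Lipschitz with a constant
independent of `R` (`gubNorm_truncate_sub_le`). On that ball `F` and `G` have small Lipschitz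
constants, because their derivatives vanish at the origin: for `F` this is strict differentiability,
for `G` it is `IsDiffusion.exists_composition`, which bounds `G(U) - G(V)` as a controlled path by a
constant times `R` times the size of `U - V`. The datum `ξ` cancels in differences and the rough
path enters only through the bound `M`, so `R₀` depends on neither.

The analytic core is that convolution with the semigroup leads back to the space of controlled
paths. By Chen's relation the germ `S_{w-u}(v_u W_{u,w} + v'_u 𝕎_{u,w})` has a defect of order `3γ >
1`, and this defect has the form `S_{w-m} x`. With the terminal time fixed, the sewing lemma applies
in the lowest space `B_{α-2γ-σ}` (`exists_mild_sewing`). The lost spatial regularity is then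
regained: the error is telescoped along times approaching `t` geometrically, and each piece is
smoothed, so that time exponents are traded for levels one to one (`exists_lift`). Since `σ < γ`, a
surplus `κ > 0` remains; it puts the integral into `B_{α+κ}` and pays for time continuity in `B_α`
(`exists_path`). The results are `exists_rough_convolution` and `exists_drift_convolution`.

The predicate `IsCRP`, meaning that all four controlled norms are at most `N`, is closed under
uniform convergence. The fixed point argument therefore runs in the complete space of pairs of
continuous paths, with `IsCRP` as an extended gauge (`existsUnique_fixedPoint_of_gauge`). -/

noncomputable section

namespace RoughPDE

open Filter Topology

/-! ### Semigroup estimates between fractional levels. -/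

section

variable {B : ℝ → Type*} [∀ a, NormedAddCommGroup (B a)] [∀ a, NormedSpace ℝ (B a)]
  {𝓑 : InterpolationScale B}

theorem InterpolationScale.norm_ι_le (𝓑 : InterpolationScale B) (b a : ℝ) :
    ∃ C : ℝ, 0 ≤ C ∧ ∀ x : B b, ‖𝓑.ι b a x‖ ≤ C * ‖x‖ :=
  ⟨‖𝓑.ι b a‖, norm_nonneg _, fun x => (𝓑.ι b a).le_opNorm x⟩

section Complete

variable [∀ a, CompleteSpace (B a)]

/-- Uniform boundedness principle: strong continuity makes each orbit bounded on the compact time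
interval. -/
theorem ParabolicSemigroup.exists_bound (𝓢 : ParabolicSemigroup 𝓑) (a : ℝ) :
    ∃ C : ℝ, 0 ≤ C ∧ ∀ t ∈ Icc (0 : ℝ) 1, ∀ x : B a, ‖𝓢.S a t x‖ ≤ C * ‖x‖ := by
  obtain ⟨C, hC⟩ := banach_steinhaus (g := fun t : Icc (0 : ℝ) 1 => 𝓢.S a t) (by
    intro x
    have h := isCompact_Icc.exists_bound_of_continuousOn
      ((𝓢.S_continuous a x).mono (fun t (ht : t ∈ Icc (0 : ℝ) 1) => ht.1))
    obtain ⟨C, hC⟩ := h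
    exact ⟨C, fun t => hC t t.2⟩)
  refine ⟨C, (norm_nonneg _).trans (hC ⟨0, by simp⟩), fun t ht x => ?_⟩
  exact ((𝓢.S a t).le_opNorm x).trans
    (mul_le_mul_of_nonneg_right (hC ⟨t, ht⟩) (norm_nonneg _))

/-- Interpolation of the level `b` between boundedness on `B a` and smoothing into `B (a + 1)`. The
outer levels differ by one, so no root has to be taken. -/
theorem ParabolicSemigroup.smoothing_le_one (𝓢 : ParabolicSemigroup 𝓑) {a b : ℝ} (hab : a ≤ b)
    (hb : b ≤ a + 1) :
    ∃ C : ℝ, 0 ≤ C ∧ ∀ t ∈ Ioc (0 : ℝ) 1, ∀ x : B a, ∃ y : B b,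
      𝓑.ι b a y = 𝓢.S a t x ∧ ‖y‖ ≤ C * t ^ (-(b - a)) * ‖x‖ := by
  obtain ⟨C₀, hC₀, h₀⟩ := 𝓢.exists_bound a
  obtain ⟨C₁, h₁⟩ := 𝓢.S_smoothing a
  obtain ⟨C₂, h₂⟩ := 𝓑.interpolation hab hb
  refine ⟨|C₂| * (C₀ ^ (a + 1 - b) * |C₁| ^ (b - a)), by positivity, fun t ht x => ?_⟩
  obtain ⟨y, hy, hyn⟩ := h₁ t ht x
  refine ⟨𝓑.ι (a + 1) b y, by rw [𝓑.ι_comp hab hb, hy], ?_⟩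
  have h := h₂ y
  have ht0 := ht.1
  rw [add_sub_cancel_left, Real.rpow_one, hy] at h
  have e1 : ‖𝓢.S a t x‖ ^ (a + 1 - b) ≤ (C₀ * ‖x‖) ^ (a + 1 - b) :=
    Real.rpow_le_rpow (norm_nonneg _) (h₀ t ⟨ht.1.le, ht.2⟩ x) (by linarith)
  have e2 : ‖y‖ ^ (b - a) ≤ (|C₁| * t⁻¹ * ‖x‖) ^ (b - a) := by
    refine Real.rpow_le_rpow (norm_nonneg _) (hyn.trans ?_) (by linarith)
    gcongr
    exact le_abs_self _
  have e3 : ‖x‖ ^ (a + 1 - b) * ‖x‖ ^ (b - a) = ‖x‖ := by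
    rw [← Real.rpow_add_of_nonneg (norm_nonneg _) (by linarith) (by linarith)]
    rw [show a + 1 - b + (b - a) = 1 by ring, Real.rpow_one]
  calc ‖𝓑.ι (a + 1) b y‖ ≤ |C₂| * (‖𝓢.S a t x‖ ^ (a + 1 - b) * ‖y‖ ^ (b - a)) := by
        refine h.trans ?_
        gcongr
        exact le_abs_self _
    _ ≤ |C₂| * ((C₀ * ‖x‖) ^ (a + 1 - b) * (|C₁| * t⁻¹ * ‖x‖) ^ (b - a)) := by gcongr
    _ = |C₂| * (C₀ ^ (a + 1 - b) * |C₁| ^ (b - a)) * t ^ (-(b - a)) *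
          (‖x‖ ^ (a + 1 - b) * ‖x‖ ^ (b - a)) := by
        rw [Real.mul_rpow hC₀ (norm_nonneg _), Real.mul_rpow (by positivity) (norm_nonneg _),
          Real.mul_rpow (abs_nonneg _) (by positivity), Real.inv_rpow ht0.le, Real.rpow_neg ht0.le]
        ring
    _ = _ := by rw [e3]

/-- Smoothing `S_t : B a → B b` of order `t ^ (a - b)`. -/
theorem ParabolicSemigroup.smoothing (𝓢 : ParabolicSemigroup 𝓑) {a b : ℝ} (hab : a ≤ b)
    (hb : b ≤ a + 2) :
    ∃ C : ℝ, 0 ≤ C ∧ ∀ t ∈ Ioc (0 : ℝ) 1, ∀ x : B a, ∃ y : B b,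
      𝓑.ι b a y = 𝓢.S a t x ∧ ‖y‖ ≤ C * t ^ (-(b - a)) * ‖x‖ := by
  -- `S_t = S_{t/2} S_{t/2}` through the middle level, each factor climbing at most one level. The
  -- rough integral has to climb from `α - 2γ - σ` to slightly above `α`, which can exceed one
  -- level.
  set c := (a + b) / 2 with hc
  have hac : a ≤ c := by rw [hc]; linarith
  have hcb : c ≤ b := by rw [hc]; linarith
  obtain ⟨C₁, hC₁, h₁⟩ := 𝓢.smoothing_le_one hac (by rw [hc]; linarith)
  obtain ⟨C₂, hC₂, h₂⟩ := 𝓢.smoothing_le_one hcb (by rw [hc]; linarith)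
  refine ⟨C₂ * C₁ * 2 ^ (b - a), by positivity, fun t ht x => ?_⟩
  have ht2 : t / 2 ∈ Ioc (0 : ℝ) 1 := ⟨by linarith [ht.1], by linarith [ht.2, ht.1]⟩
  obtain ⟨y, hy, hyn⟩ := h₁ _ ht2 x
  obtain ⟨z, hz, hzn⟩ := h₂ _ ht2 y
  refine ⟨z, ?_, ?_⟩
  · rw [← 𝓑.ι_comp hac hcb, hz, 𝓢.S_ι hac ht2.1.le, hy, ← 𝓢.S_add a ht2.1.le ht2.1.le,
      add_halves]
  · have ht0 := ht.1
    have e : (t / 2) ^ (-(b - c)) * (t / 2) ^ (-(c - a)) = 2 ^ (b - a) * t ^ (-(b - a)) := by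
      rw [← Real.rpow_add ht2.1, show -(b - c) + -(c - a) = -(b - a) by ring,
        Real.div_rpow ht0.le (by norm_num), Real.rpow_neg (by norm_num : (0 : ℝ) ≤ 2), div_inv_eq_mul,
        mul_comm]
    calc ‖z‖ ≤ C₂ * (t / 2) ^ (-(b - c)) * ‖y‖ := hzn
      _ ≤ C₂ * (t / 2) ^ (-(b - c)) * (C₁ * (t / 2) ^ (-(c - a)) * ‖x‖) := by
          gcongr
      _ = C₂ * C₁ * ((t / 2) ^ (-(b - c)) * (t / 2) ^ (-(c - a))) * ‖x‖ := by ring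
      _ = _ := by rw [e]; ring

theorem ParabolicSemigroup.norm_le_of_ι (𝓢 : ParabolicSemigroup 𝓑) {a b : ℝ} (hab : a ≤ b)
    (hb : b ≤ a + 2) :
    ∃ C : ℝ, 0 ≤ C ∧ ∀ t ∈ Ioc (0 : ℝ) 1, ∀ x : B b,
      ‖𝓢.S b t x‖ ≤ C * t ^ (-(b - a)) * ‖𝓑.ι b a x‖ := by
  obtain ⟨C, hC, h⟩ := 𝓢.smoothing hab hb
  refine ⟨C, hC, fun t ht x => ?_⟩
  obtain ⟨y, hy, hyn⟩ := h t ht (𝓑.ι b a x)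
  rw [← 𝓢.S_ι hab ht.1.le] at hy
  rwa [← 𝓑.ι_injective hab hy]

/-- Telescoping along the times `t 2^{-k}`. In `S_{2h} x - S_h x = (S_h - Id) S_h x` the smoothing
into `B (a + 1)` costs `h^{-(a+1-b)}` and `S_h - Id` gains `h`; the resulting `h^{b-a}` is summable
when `a < b`. For `a = b` boundedness is enough. -/
theorem ParabolicSemigroup.sub_id (𝓢 : ParabolicSemigroup 𝓑) {a b : ℝ} (hab : a ≤ b)
    (hb : b ≤ a + 1) :
    ∃ C : ℝ, 0 ≤ C ∧ ∀ t ∈ Icc (0 : ℝ) 1, ∀ x : B b,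
      ‖𝓢.S a t (𝓑.ι b a x) - 𝓑.ι b a x‖ ≤ C * t ^ (b - a) * ‖x‖ := by
  rcases hab.eq_or_lt with rfl | hlt
  · obtain ⟨C, hC, h⟩ := 𝓢.exists_bound a
    refine ⟨C + 1, by positivity, fun t ht x => ?_⟩
    rw [sub_self, Real.rpow_zero, 𝓑.ι_self, mul_one, add_mul, one_mul]
    exact (norm_sub_le _ _).trans (add_le_add_left (h t ht x) _)
  obtain ⟨C₁, hC₁, h₁⟩ := 𝓢.smoothing_le_one (a := b) (b := a + 1) hb (by linarith)
  obtain ⟨C₂, h₂⟩ := 𝓢.S_sub_id a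
  set θ := b - a with hθ
  have hθ0 : 0 < θ := by rw [hθ]; linarith
  have key : ∀ h ∈ Ioc (0 : ℝ) 1, ∀ x : B b,
      ‖𝓢.S a (h + h) (𝓑.ι b a x) - 𝓢.S a h (𝓑.ι b a x)‖ ≤ |C₂| * C₁ * h ^ θ * ‖x‖ := by
    intro h hh x
    obtain ⟨y, hy, hyn⟩ := h₁ h hh x
    have e : 𝓑.ι (a + 1) a y = 𝓢.S a h (𝓑.ι b a x) := by
      rw [← 𝓑.ι_comp hab hb, hy, 𝓢.S_ι hab hh.1.le]
    have h0 := hh.1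
    rw [𝓢.S_add a hh.1.le hh.1.le, ← e]
    calc _ ≤ C₂ * h * ‖y‖ := h₂ h hh y
      _ ≤ |C₂| * h * (C₁ * h ^ (-(a + 1 - b)) * ‖x‖) := by gcongr; exact le_abs_self _
      _ = |C₂| * C₁ * (h ^ (1 : ℝ) * h ^ (-(a + 1 - b))) * ‖x‖ := by rw [Real.rpow_one]; ring
      _ = _ := by rw [← Real.rpow_add h0]; congr 3; rw [hθ]; ring
  set q : ℝ := (1 / 2 : ℝ) ^ θ with hq
  have hq0 : 0 ≤ q := by positivity
  have hq1 : q < 1 := Real.rpow_lt_one (by norm_num) (by norm_num) hθ0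
  have h1q : 0 < 1 - q := by linarith
  refine ⟨|C₂| * C₁ * (1 - q)⁻¹, by positivity, fun t ht x => ?_⟩
  rcases ht.1.eq_or_lt with rfl | ht0
  · rw [𝓢.S_zero, sub_self, norm_zero]; positivity
  set u : ℕ → B a := fun k => 𝓢.S a (t * (1 / 2) ^ k) (𝓑.ι b a x) with hu
  have hstep : ∀ k, dist (u k) (u (k + 1)) ≤ (|C₂| * C₁ * t ^ θ * ‖x‖) * q ^ k := by
    intro k
    have hp : (1 / 2 : ℝ) ^ (k + 1) ≤ 1 := pow_le_one₀ (by norm_num) (by norm_num)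
    have hh : t * (1 / 2) ^ (k + 1) ∈ Ioc (0 : ℝ) 1 :=
      ⟨by positivity, by nlinarith [ht.2, pow_pos (by norm_num : (0 : ℝ) < 1 / 2) (k + 1)]⟩
    have h := key _ hh x
    rw [dist_eq_norm, hu]
    dsimp only
    rw [show t * (1 / 2) ^ k = t * (1 / 2) ^ (k + 1) + t * (1 / 2) ^ (k + 1) by ring]
    refine h.trans ?_
    rw [Real.mul_rpow ht0.le (by positivity), ← Real.rpow_natCast, ← Real.rpow_mul (by norm_num),
      mul_comm _ θ, Real.rpow_mul (by norm_num), ← hq, Real.rpow_natCast]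
    have : q ^ (k + 1) ≤ q ^ k := pow_le_pow_of_le_one hq0 hq1.le (Nat.le_succ k)
    calc |C₂| * C₁ * (t ^ θ * q ^ (k + 1)) * ‖x‖ ≤ |C₂| * C₁ * (t ^ θ * q ^ k) * ‖x‖ := by gcongr
      _ = _ := by ring
  have hlim : Tendsto u atTop (𝓝 (𝓑.ι b a x)) := by
    have h0 : Tendsto (fun k : ℕ => t * (1 / 2 : ℝ) ^ k) atTop (𝓝[Ici 0] 0) := by
      refine tendsto_nhdsWithin_iff.2 ⟨?_, Eventually.of_forall fun k => ?_⟩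
      · have := (tendsto_pow_atTop_nhds_zero_of_lt_one (by norm_num : (0 : ℝ) ≤ 1 / 2)
          (by norm_num)).const_mul t
        rwa [mul_zero] at this
      · rw [mem_Ici]; positivity
    have h1 := (𝓢.S_continuous a (𝓑.ι b a x) 0 (by simp)).tendsto
    rw [𝓢.S_zero] at h1
    exact h1.comp h0
  have := dist_le_of_le_geometric_of_tendsto₀ q _ hq1 hstep hlim
  rw [dist_eq_norm, hu] at this
  simp only [pow_zero, mul_one] at this
  refine this.trans (le_of_eq ?_)
  rw [div_eq_mul_inv]; ring

end Complete

end

/-! ### The sewing lemma along clamped dyadic grids. -/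

section

theorem sum_rpow_sub_le {p h : ℝ} (hp : 1 < p) {x : ℕ → I} (hx : Monotone x) (n : ℕ)
    (hn : ∀ i < n, (x (i + 1) : ℝ) - x i ≤ h) :
    ∑ i ∈ Finset.range n, ((x (i + 1) : ℝ) - x i) ^ p ≤ h ^ (p - 1) * ((x n : ℝ) - x 0) := by
  rw [← Finset.sum_range_sub (fun i => (x i : ℝ)) n, Finset.mul_sum]
  refine Finset.sum_le_sum fun i hi => ?_
  have h0 : (0 : ℝ) ≤ x (i + 1) - x i := sub_nonneg.2 (hx (Nat.le_succ i))
  calc ((x (i + 1) : ℝ) - x i) ^ p = ((x (i + 1) : ℝ) - x i) ^ (p - 1) * (x (i + 1) - x i) := by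
        rw [← Real.rpow_add_one' h0 (by rw [sub_add_cancel]; exact (zero_lt_one.trans hp).ne'),
          sub_add_cancel]
    _ ≤ _ := mul_le_mul_of_nonneg_right
        (Real.rpow_le_rpow h0 (hn i (Finset.mem_range.1 hi)) (by linarith)) h0

section Germ

variable {E : Type*} [NormedAddCommGroup E] {p N : ℝ} {A : I → I → E} {T : I}

/-- `A` is almost additive of order `p` on intervals contained in `[0,T]`. -/
def AlmostAdditive (p N : ℝ) (T : I) (A : I → I → E) : Prop :=
  ∀ u m v : I, u ≤ m → m ≤ v → v ≤ T → ‖A u v - A u m - A m v‖ ≤ N * ((v : ℝ) - u) ^ p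

/-- Degenerate cells contribute nothing, so partitions may repeat points, as clamped grids do. -/
theorem AlmostAdditive.self (hA : AlmostAdditive p N T A) (hp : 1 < p) {u : I} (hu : u ≤ T) :
    A u u = 0 := by
  have h := hA u u u le_rfl le_rfl hu
  rw [sub_self, zero_sub, norm_neg, sub_self, Real.zero_rpow (by linarith), mul_zero] at h
  exact norm_le_zero_iff.1 h

/-- The constant in the sewing estimate. -/
def sewConst (p : ℝ) : ℝ := 2 / (1 - 2 ^ (1 - p))

theorem two_rpow_lt_one (hp : 1 < p) : (2 : ℝ) ^ (1 - p) < 1 :=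
  Real.rpow_lt_one_of_one_lt_of_neg (by norm_num) (by linarith)

theorem sewConst_pos (hp : 1 < p) : 0 < sewConst p :=
  div_pos two_pos (sub_pos.2 (two_rpow_lt_one hp))

/-- Cutting a partition near its midpoint leaves two pieces of at most half the length and two
defects of size at most `N L^p`; this constant is the one that such a step reproduces. -/
theorem sewConst_eq (hp : 1 < p) : 2 * (sewConst p * (1 / 2) ^ p) + 2 = sewConst p := by
  have h := sub_pos.2 (two_rpow_lt_one hp)
  have e : (2 : ℝ) * (1 / 2) ^ p = 2 ^ (1 - p) := by
    rw [Real.rpow_sub two_pos, Real.rpow_one, one_div, Real.inv_rpow two_pos.le, div_eq_mul_inv]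
  rw [show 2 * (sewConst p * (1 / 2) ^ p) = sewConst p * (2 * (1 / 2) ^ p) by ring, e, sewConst]
  field_simp
  ring

/-- Riemann sums over arbitrary partitions stay close to the germ. -/
theorem AlmostAdditive.norm_sum_sub_le (hA : AlmostAdditive p N T A) (hp : 1 < p) (hN : 0 ≤ N)
    {x : ℕ → I} (hx : Monotone x) (n : ℕ) :
    ∀ a b : ℕ, a ≤ b → b - a ≤ n → x b ≤ T →
      ‖∑ i ∈ Finset.Ico a b, A (x i) (x (i + 1)) - A (x a) (x b)‖
        ≤ sewConst p * N * ((x b : ℝ) - x a) ^ p := by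
  have hK := sewConst_pos hp
  induction n with
  | zero =>
    intro a b hab hn hb
    obtain rfl : a = b := by omega
    simp only [Finset.Ico_self, Finset.sum_empty, hA.self hp hb, sub_self, norm_zero]
    rw [Real.zero_rpow (by linarith)]
    simp
  | succ n ih =>
    intro a b hab hn hb
    rcases hab.eq_or_lt with rfl | hlt
    · simp only [Finset.Ico_self, Finset.sum_empty, hA.self hp hb, sub_self, norm_zero]
      rw [Real.zero_rpow (by linarith)]
      simp
    set L : ℝ := (x b : ℝ) - x a with hL
    have hL0 : 0 ≤ L := sub_nonneg.2 (hx hab)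
    -- The cell from `x j` to `x (j + 1)` is the one around the midpoint: `j` is the last index
    -- before `b` whose point lies in the left half. Both sides of the cell have fewer cells and at
    -- most half the length, so the induction hypothesis applies to each.
    obtain ⟨j, haj, hjb, hj1, hj2⟩ : ∃ j, a ≤ j ∧ j < b ∧ (x j : ℝ) - x a ≤ L / 2 ∧
        (x b : ℝ) - x (j + 1) ≤ L / 2 := by
      classical
      let P : ℕ → Prop := fun j => a ≤ j ∧ j < b ∧ (x j : ℝ) - x a ≤ L / 2
      have hPa : P a := ⟨le_rfl, hlt, by rw [sub_self]; positivity⟩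
      set j := Nat.findGreatest P b with hj
      have hPj : P j := Nat.findGreatest_spec hab hPa
      refine ⟨j, hPj.1, hPj.2.1, hPj.2.2, ?_⟩
      by_cases hjb : j + 1 = b
      · rw [hjb, sub_self]; positivity
      · have hnP : ¬ P (j + 1) :=
          Nat.findGreatest_is_greatest (Nat.lt_succ_self j) (by have := hPj.2.1; omega)
        have : ¬ (x (j + 1) : ℝ) - x a ≤ L / 2 := fun h =>
          hnP ⟨hPj.1.trans (Nat.le_succ j), by have := hPj.2.1; omega, h⟩
        linarith
    have hjT : x (j + 1) ≤ T := (hx hjb).trans hb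
    have i1 := ih a j haj (by omega) ((hx hjb.le).trans hb)
    have i2 := ih (j + 1) b hjb (by omega) hb
    have d1 := hA (x a) (x j) (x b) (hx haj) (hx hjb.le) hb
    have d2 := hA (x j) (x (j + 1)) (x b) (hx (Nat.le_succ j)) (hx hjb) hb
    have hm1 : (x a : ℝ) ≤ x j := hx haj
    have hm2 : (x j : ℝ) ≤ x (j + 1) := hx (Nat.le_succ j)
    have hm3 : (x (j + 1) : ℝ) ≤ x b := hx hjb
    have hp0 : 0 ≤ p := by linarith
    have r1 : ((x j : ℝ) - x a) ^ p ≤ (1 / 2) ^ p * L ^ p := by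
      rw [← Real.mul_rpow (by norm_num) hL0]
      exact Real.rpow_le_rpow (by linarith) (by linarith) hp0
    have r2 : ((x b : ℝ) - x (j + 1)) ^ p ≤ (1 / 2) ^ p * L ^ p := by
      rw [← Real.mul_rpow (by norm_num) hL0]
      exact Real.rpow_le_rpow (by linarith) (by linarith) hp0
    have r3 : ((x b : ℝ) - x j) ^ p ≤ L ^ p := Real.rpow_le_rpow (by linarith) (by linarith) hp0
    rw [← Finset.sum_Ico_consecutive _ haj hjb.le,
      Finset.sum_eq_sum_Ico_succ_bot hjb (fun i => A (x i) (x (i + 1)))]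
    have e : ∑ i ∈ Finset.Ico a j, A (x i) (x (i + 1)) + (A (x j) (x (j + 1)) +
          ∑ i ∈ Finset.Ico (j + 1) b, A (x i) (x (i + 1))) - A (x a) (x b)
        = (∑ i ∈ Finset.Ico a j, A (x i) (x (i + 1)) - A (x a) (x j))
          + (∑ i ∈ Finset.Ico (j + 1) b, A (x i) (x (i + 1)) - A (x (j + 1)) (x b))
          - (A (x a) (x b) - A (x a) (x j) - A (x j) (x b))
          - (A (x j) (x b) - A (x j) (x (j + 1)) - A (x (j + 1)) (x b)) := by abel
    rw [e]
    calc _ ≤ sewConst p * N * ((x j : ℝ) - x a) ^ p + sewConst p * N * ((x b : ℝ) - x (j + 1)) ^ p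
          + N * L ^ p + N * ((x b : ℝ) - x j) ^ p :=
          (norm_sub_le _ _).trans (add_le_add ((norm_sub_le _ _).trans
            (add_le_add ((norm_add_le _ _).trans (add_le_add i1 i2)) d1)) d2)
      _ ≤ sewConst p * N * ((1 / 2) ^ p * L ^ p) + sewConst p * N * ((1 / 2) ^ p * L ^ p)
          + N * L ^ p + N * L ^ p := by gcongr
      _ = (2 * (sewConst p * (1 / 2) ^ p) + 2) * N * L ^ p := by ring
      _ = _ := by rw [sewConst_eq hp]

/-- The dyadic grid of `[0,1]`, clamped to `[s,t]`. -/
def grid (n : ℕ) (s t : I) (k : ℕ) : I :=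
  max s (min (projIcc 0 1 zero_le_one ((k : ℝ) / 2 ^ n)) t)

theorem grid_mono (n : ℕ) (s t : I) : Monotone (grid n s t) := by
  intro k l hkl
  refine max_le_max le_rfl (min_le_min (monotone_projIcc _ ?_) le_rfl)
  gcongr

theorem grid_zero (n : ℕ) (s t : I) : grid n s t 0 = s := by
  have : projIcc (0 : ℝ) 1 zero_le_one (((0 : ℕ) : ℝ) / 2 ^ n) = 0 :=
    projIcc_of_le_left _ (by simp)
  rw [grid, this, min_eq_left (show (0 : I) ≤ t from t.2.1), max_eq_left (show (0 : I) ≤ s from s.2.1)]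

theorem grid_last (n : ℕ) {s t : I} (h : s ≤ t) : grid n s t (2 ^ n) = t := by
  have : projIcc (0 : ℝ) 1 zero_le_one (((2 ^ n : ℕ) : ℝ) / 2 ^ n) = 1 :=
    projIcc_of_right_le _ (by simp)
  rw [grid, this, min_eq_right (show t ≤ (1 : I) from t.2.2), max_eq_right h]

theorem grid_even (n : ℕ) (s t : I) (k : ℕ) : grid (n + 1) s t (2 * k) = grid n s t k := by
  rw [grid, grid]
  congr 3
  push_cast
  rw [pow_succ]
  field_simp

theorem grid_le (n : ℕ) {s t : I} (h : s ≤ t) (k : ℕ) : grid n s t k ≤ t :=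
  max_le h (min_le_right _ _)

theorem grid_step (n : ℕ) (s t : I) (k : ℕ) :
    (grid n s t (k + 1) : ℝ) - grid n s t k ≤ (1 / 2) ^ n := by
  have key : ∀ x y : ℝ, x ≤ y →
      (max s (min (projIcc 0 1 zero_le_one y) t) : ℝ) - (max s (min (projIcc 0 1 zero_le_one x) t) : ℝ)
        ≤ y - x := by
    intro x y hxy
    simp only [coe_projIcc]
    have h1 : max (0 : ℝ) (min 1 y) ≤ max 0 (min 1 x) + (y - x) := by
      refine max_le (by linarith [le_max_left 0 (min 1 x)]) ?_
      rcases le_total 1 x with h | h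
      · rw [min_eq_left h]; linarith [le_max_right (0 : ℝ) 1, min_le_left 1 y]
      · rw [min_eq_right h]; linarith [le_max_right (0 : ℝ) x, min_le_right 1 y]
    have h2 : min (max (0 : ℝ) (min 1 y)) t ≤ min (max 0 (min 1 x)) t + (y - x) := by
      rw [← min_add_add_right]
      exact min_le_min h1 (by linarith)
    have h3 : max (s : ℝ) (min (max (0 : ℝ) (min 1 y)) t)
        ≤ max (s : ℝ) (min (max 0 (min 1 x)) t) + (y - x) := by
      rw [← max_add_add_right]
      exact max_le_max (by linarith) h2
    linarith
  have h := key ((k : ℝ) / 2 ^ n) (((k + 1 : ℕ) : ℝ) / 2 ^ n) (by gcongr; simp)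
  have e : ((k + 1 : ℕ) : ℝ) / 2 ^ n - (k : ℝ) / 2 ^ n = (1 / 2) ^ n := by
    push_cast
    rw [one_div, inv_pow]
    field_simp
    ring
  rw [e] at h
  refine le_trans (le_of_eq ?_) h
  rw [grid, grid]
  rfl

/-- Riemann sums along the clamped dyadic grids. -/
def dyadicSum (A : I → I → E) (s t : I) (n : ℕ) : E :=
  ∑ k ∈ Finset.range (2 ^ n), A (grid n s t k) (grid n s t (k + 1))

theorem AlmostAdditive.norm_dyadicSum_sub_le (hA : AlmostAdditive p N T A) (hp : 1 < p)
    (hN : 0 ≤ N) {s t : I} (hst : s ≤ t) (ht : t ≤ T) (n : ℕ) :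
    ‖dyadicSum A s t n - A s t‖ ≤ sewConst p * N * ((t : ℝ) - s) ^ p := by
  have h := hA.norm_sum_sub_le hp hN (grid_mono n s t) (2 ^ n) 0 (2 ^ n) (Nat.zero_le _) (by simp)
    ((grid_le n hst _).trans ht)
  rwa [grid_zero n s t, grid_last n hst, ← Finset.range_eq_Ico] at h

theorem sum_range_two_mul {M : Type*} [AddCommMonoid M] (g : ℕ → M) (n : ℕ) :
    ∑ k ∈ Finset.range (2 * n), g k = ∑ k ∈ Finset.range n, (g (2 * k) + g (2 * k + 1)) := by
  induction n with
  | zero => simp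
  | succ n ih => rw [mul_add, mul_one, Finset.sum_range_succ, Finset.sum_range_succ, ih,
      Finset.sum_range_succ, add_assoc]

theorem half_pow_rpow (p : ℝ) (n : ℕ) :
    (((1 : ℝ) / 2) ^ n) ^ (p - 1) = ((2 : ℝ) ^ (1 - p)) ^ n := by
  rw [← Real.rpow_natCast, ← Real.rpow_mul (by norm_num), mul_comm, Real.rpow_mul (by norm_num),
    Real.rpow_natCast, one_div, Real.inv_rpow two_pos.le, ← Real.rpow_neg two_pos.le, neg_sub]

theorem sum_grid_rpow_le (hp : 1 < p) {s t : I} (hst : s ≤ t) (n : ℕ) :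
    ∑ k ∈ Finset.range (2 ^ n), ((grid n s t (k + 1) : ℝ) - grid n s t k) ^ p
      ≤ ((2 : ℝ) ^ (1 - p)) ^ n := by
  have h := sum_rpow_sub_le hp (grid_mono n s t) (2 ^ n)
    (fun i _ => grid_step n s t i)
  rw [half_pow_rpow, grid_zero n s t, grid_last n hst] at h
  refine h.trans (mul_le_of_le_one_right (by positivity) ?_)
  linarith [t.2.2, s.2.1]

/-- A refinement inserts one point into every cell, at a cost of `N` times the cell length to the
power `p`. Mesh `2^{-n}` and total length at most one turn this into a geometric rate. -/
theorem AlmostAdditive.dist_dyadicSum_succ (hA : AlmostAdditive p N T A) (hp : 1 < p) (hN : 0 ≤ N)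
    {s t : I} (hst : s ≤ t) (ht : t ≤ T) (n : ℕ) :
    dist (dyadicSum A s t n) (dyadicSum A s t (n + 1)) ≤ N * ((2 : ℝ) ^ (1 - p)) ^ n := by
  rw [dist_eq_norm, dyadicSum, dyadicSum, pow_succ', sum_range_two_mul, ← Finset.sum_sub_distrib]
  refine (norm_sum_le _ _).trans ?_
  refine le_trans ?_ (mul_le_mul_of_nonneg_left (sum_grid_rpow_le hp hst n) hN)
  rw [Finset.mul_sum]
  refine Finset.sum_le_sum fun k _ => ?_
  rw [grid_even, show 2 * k + 1 + 1 = 2 * (k + 1) by ring, grid_even, ← sub_sub]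
  refine hA _ _ _ ?_ ?_ ((grid_le n hst _).trans ht)
  · rw [← grid_even n s t k]; exact grid_mono _ _ _ (Nat.le_succ _)
  · rw [← grid_even n s t (k + 1)]; exact grid_mono _ _ _ (by omega)

/-- The reason for clamping one fixed grid instead of subdividing each interval anew: grids on
adjacent intervals are cut out of the grid on their union. -/
theorem grid_left {n : ℕ} {s u t : I} (hsu : s ≤ u) (hut : u ≤ t) (k : ℕ) :
    grid n s u k = min (grid n s t k) u := by
  rw [grid, grid, min_max_distrib_right, min_assoc, min_eq_right hut, min_eq_left hsu]

theorem grid_right {n : ℕ} {s u t : I} (hsu : s ≤ u) (k : ℕ) :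
    grid n u t k = max (grid n s t k) u := by
  rw [grid, grid, max_comm s, max_assoc, max_eq_right hsu, max_comm]

/-- Only the cell straddling `u` leaves a defect; any other cell lies on one side of `u` and is
degenerate for the sum on the other side. As the bound tends to zero, the limit is exactly additive.
-/
theorem AlmostAdditive.norm_dyadicSum_add (hA : AlmostAdditive p N T A) (hp : 1 < p) (hN : 0 ≤ N)
    {s u t : I} (hsu : s ≤ u) (hut : u ≤ t) (ht : t ≤ T) (n : ℕ) :
    ‖dyadicSum A s t n - dyadicSum A s u n - dyadicSum A u t n‖ ≤ N * ((2 : ℝ) ^ (1 - p)) ^ n := by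
  have hst := hsu.trans hut
  rw [dyadicSum, dyadicSum, dyadicSum, ← Finset.sum_sub_distrib, ← Finset.sum_sub_distrib]
  refine (norm_sum_le _ _).trans ?_
  refine le_trans ?_ (mul_le_mul_of_nonneg_left (sum_grid_rpow_le hp hst n) hN)
  rw [Finset.mul_sum]
  refine Finset.sum_le_sum fun k _ => ?_
  rw [grid_left hsu hut, grid_left hsu hut, grid_right hsu, grid_right hsu]
  have hxy := grid_mono n s t (Nat.le_succ k)
  have hy := (grid_le n hst (k + 1)).trans ht
  simp only [Nat.succ_eq_add_one] at hxy
  generalize grid n s t k = x at *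
  generalize grid n s t (k + 1) = y at *
  have h0 : (0 : ℝ) ≤ (y : ℝ) - x := sub_nonneg.2 hxy
  rcases le_total u x with h | h
  · rw [min_eq_right h, min_eq_right (h.trans hxy), max_eq_left h, max_eq_left (h.trans hxy),
      hA.self hp (hut.trans ht), sub_zero, sub_self, norm_zero]
    positivity
  rcases le_total y u with h' | h'
  · rw [min_eq_left h, min_eq_left h', max_eq_right h, max_eq_right h',
      hA.self hp (hut.trans ht), sub_zero, sub_self, norm_zero]
    positivity
  rw [min_eq_left h, min_eq_right h', max_eq_right h, max_eq_left h']
  exact hA _ _ _ h h' hy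

variable [CompleteSpace E]

/-- The sewing of an almost additive germ. -/
def sew (A : I → I → E) (s t : I) : E := limUnder atTop (dyadicSum A s t)

theorem AlmostAdditive.tendsto_sew (hA : AlmostAdditive p N T A) (hp : 1 < p) (hN : 0 ≤ N)
    {s t : I} (hst : s ≤ t) (ht : t ≤ T) : Tendsto (dyadicSum A s t) atTop (𝓝 (sew A s t)) :=
  (cauchySeq_of_le_geometric _ N (two_rpow_lt_one hp)
    (hA.dist_dyadicSum_succ hp hN hst ht)).tendsto_limUnder

theorem AlmostAdditive.norm_sew_sub_le (hA : AlmostAdditive p N T A) (hp : 1 < p) (hN : 0 ≤ N)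
    {s t : I} (hst : s ≤ t) (ht : t ≤ T) :
    ‖sew A s t - A s t‖ ≤ sewConst p * N * ((t : ℝ) - s) ^ p :=
  le_of_tendsto ((hA.tendsto_sew hp hN hst ht).sub_const _).norm
    (Eventually.of_forall fun n => hA.norm_dyadicSum_sub_le hp hN hst ht n)

theorem AlmostAdditive.sew_add (hA : AlmostAdditive p N T A) (hp : 1 < p) (hN : 0 ≤ N)
    {s u t : I} (hsu : s ≤ u) (hut : u ≤ t) (ht : t ≤ T) :
    sew A s t = sew A s u + sew A u t := by
  have h1 := ((hA.tendsto_sew hp hN (hsu.trans hut) ht).sub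
    (hA.tendsto_sew hp hN hsu (hut.trans ht))).sub (hA.tendsto_sew hp hN hut ht)
  have h2 := (tendsto_pow_atTop_nhds_zero_of_lt_one (by positivity)
    (two_rpow_lt_one hp)).const_mul N
  rw [mul_zero] at h2
  have h3 := squeeze_zero_norm (hA.norm_dyadicSum_add hp hN hsu hut ht) h2
  have := tendsto_nhds_unique h1 h3
  rw [sub_sub, sub_eq_zero] at this
  exact this

/-- Riemann sums along arbitrary partitions converge to the sewing. -/
theorem AlmostAdditive.norm_sum_sub_sew_le (hA : AlmostAdditive p N T A) (hp : 1 < p) (hN : 0 ≤ N)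
    {x : ℕ → I} (hx : Monotone x) {n : ℕ} {h : ℝ} (hh : 0 ≤ h) (hn : x n ≤ T)
    (hstep : ∀ i < n, (x (i + 1) : ℝ) - x i ≤ h) :
    ‖∑ i ∈ Finset.range n, A (x i) (x (i + 1)) - sew A (x 0) (x n)‖
      ≤ sewConst p * N * h ^ (p - 1) := by
  -- Additivity splits the sewing along the given partition, so the global error is the sum of the
  -- local errors.
  have e : ∀ m ≤ n, sew A (x 0) (x m) = ∑ i ∈ Finset.range m, sew A (x i) (x (i + 1)) := by
    intro m
    induction m with
    | zero =>
      intro _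
      have h := hA.sew_add hp hN (le_refl (x 0)) le_rfl ((hx (Nat.zero_le n)).trans hn)
      rw [Finset.range_zero, Finset.sum_empty]
      simpa using h
    | succ m ih =>
      intro hm
      rw [Finset.sum_range_succ, ← ih (by omega)]
      exact hA.sew_add hp hN (hx (Nat.zero_le m)) (hx (Nat.le_succ m)) ((hx hm).trans hn)
  have hK := sewConst_pos hp
  rw [e n le_rfl, ← Finset.sum_sub_distrib]
  calc _ ≤ ∑ i ∈ Finset.range n, sewConst p * N * ((x (i + 1) : ℝ) - x i) ^ p := by
        refine (norm_sum_le _ _).trans (Finset.sum_le_sum fun i hi => ?_)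
        rw [norm_sub_rev]
        exact hA.norm_sew_sub_le hp hN (hx (Nat.le_succ i))
          ((hx (Finset.mem_range.1 hi)).trans hn)
    _ ≤ sewConst p * N * (h ^ (p - 1) * ((x n : ℝ) - x 0)) := by
        rw [← Finset.mul_sum]
        gcongr
        exact sum_rpow_sub_le hp hx n hstep
    _ ≤ sewConst p * N * (h ^ (p - 1) * 1) := by
        gcongr
        linarith [(x n).2.2, (x 0).2.1]
    _ = _ := by rw [mul_one]

end Germ

end

/-! ### Regaining spatial regularity from the semigroup. -/

section

variable {B : ℝ → Type*} [∀ a, NormedAddCommGroup (B a)] [∀ a, NormedSpace ℝ (B a)]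
  {𝓑 : InterpolationScale B}

theorem sub_mem_Icc {s t : I} (h : s ≤ t) : (t : ℝ) - s ∈ Icc (0 : ℝ) 1 :=
  ⟨sub_nonneg.2 h, by linarith [t.2.2, s.2.1]⟩

theorem continuous_of_rpow_bound {E : Type*} [NormedAddCommGroup E] {g : I → E} {C κ : ℝ}
    (hκ : 0 < κ) (h : ∀ s t : I, s ≤ t → ‖g t - g s‖ ≤ C * ((t : ℝ) - s) ^ κ) : Continuous g := by
  refine continuous_iff_continuousAt.2 fun s => tendsto_iff_norm_sub_tendsto_zero.2 ?_
  have hc : Continuous fun t : I => C * |(t : ℝ) - s| ^ κ :=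
    continuous_const.mul (Continuous.rpow_const (by fun_prop) fun _ => Or.inr hκ.le)
  have h0 := hc.tendsto s
  rw [sub_self, abs_zero, Real.zero_rpow hκ.ne', mul_zero] at h0
  refine squeeze_zero (fun _ => norm_nonneg _) (fun t => ?_) h0
  rcases le_total s t with hst | hst
  · rw [abs_of_nonneg (sub_mem_Icc hst).1]; exact h s t hst
  · rw [norm_sub_rev, abs_sub_comm, abs_of_nonneg (sub_mem_Icc hst).1]; exact h t s hst

section Complete

variable [∀ a, CompleteSpace (B a)]

/-- A two-parameter family whose increments in the left endpoint are smoothed by the semigroup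
takes values in better spaces. -/
theorem ParabolicSemigroup.exists_lift (𝓢 : ParabolicSemigroup 𝓑) {b c p : ℝ} (hbc : b ≤ c)
    (hc : c ≤ b + 2) (hp : c - b < p) :
    ∃ C : ℝ, 0 ≤ C ∧ ∀ (D : I → I → B b) (N : ℝ), 0 ≤ N →
      (∀ s t : I, s ≤ t → ‖D s t‖ ≤ N * ((t : ℝ) - s) ^ p) →
      (∀ s m t : I, s ≤ m → m ≤ t → ∃ x : B b, D s t - D m t = 𝓢.S b ((t : ℝ) - m) x ∧
        ‖x‖ ≤ N * ((t : ℝ) - s) ^ p) →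
      ∀ s t : I, s ≤ t → ∃ y : B c, 𝓑.ι c b y = D s t ∧
        ‖y‖ ≤ C * N * ((t : ℝ) - s) ^ (p - (c - b)) := by
  obtain ⟨C₀, hC₀, h₀⟩ := 𝓢.smoothing hbc hc
  set θ := c - b with hθ
  set q : ℝ := (1 / 2 : ℝ) ^ (p - θ) with hq
  have hq0 : 0 ≤ q := by positivity
  have hq1 : q < 1 := Real.rpow_lt_one (by norm_num) (by norm_num) (by linarith)
  have hp0 : 0 < p := by linarith
  have h1q : 0 < 1 - q := by linarith
  refine ⟨C₀ * 2 ^ θ * (1 - q)⁻¹, by positivity, fun D N hN hD hδ s t hst => ?_⟩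
  rcases hst.eq_or_lt with rfl | hlt
  · refine ⟨0, ?_, ?_⟩
    · have := hD s s le_rfl
      rw [sub_self, Real.zero_rpow hp0.ne', mul_zero] at this
      rw [map_zero, norm_le_zero_iff.1 this]
    · rw [norm_zero, sub_self]; positivity
  set L : ℝ := (t : ℝ) - s with hL
  have hL0 : 0 < L := sub_pos.2 hlt
  have hL1 : L ≤ 1 := (sub_mem_Icc hst).2
  have hpow : ∀ k : ℕ, 0 < (1 / 2 : ℝ) ^ k ∧ (1 / 2 : ℝ) ^ k ≤ 1 := fun k =>
    ⟨by positivity, pow_le_one₀ (by norm_num) (by norm_num)⟩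
  -- These times start at `s` and halve the distance to `t` in each step. With `ℓ` the distance from
  -- `u k` to `t`, the increment of `D` from `u k` to `u (k + 1)` is of size `ℓ^p` and smoothed for
  -- time `ℓ / 2`, hence of size `ℓ^{p-θ}` in `B c`. This is summable because `p > θ`.
  let u : ℕ → I := fun k => ⟨t - L * (1 / 2) ^ k, by nlinarith [(hpow k).2, s.2.1],
    by nlinarith [(hpow k).1, t.2.2]⟩
  have hu : ∀ k, (t : ℝ) - u k = L * (1 / 2) ^ k := fun k => by
    change (t : ℝ) - (t - L * (1 / 2) ^ k) = _
    ring
  have hut : ∀ k, u k ≤ t := fun k => by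
    have := hpow k
    rw [← Subtype.coe_le_coe, ← sub_nonneg, hu]; positivity
  have huu : ∀ k, u k ≤ u (k + 1) := fun k => by
    have h1 := hu k
    have h2 := hu (k + 1)
    rw [pow_succ] at h2
    rw [← Subtype.coe_le_coe]
    nlinarith [(hpow k).1]
  have hu0 : u 0 = s := Subtype.ext (by
    change (t : ℝ) - L * (1 / 2) ^ 0 = s
    rw [hL]; ring)
  have hstep : ∀ k, ∃ y : B c, 𝓑.ι c b y = D (u k) t - D (u (k + 1)) t ∧
      ‖y‖ ≤ C₀ * 2 ^ θ * N * L ^ (p - θ) * q ^ k := by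
    intro k
    obtain ⟨x, hx, hxn⟩ := hδ (u k) (u (k + 1)) t (huu k) (hut _)
    have hk := hpow k
    set ℓ : ℝ := L * (1 / 2) ^ k with hℓ
    have hℓ0 : 0 < ℓ := by positivity
    have h1 : (t : ℝ) - u (k + 1) = ℓ / 2 := by rw [hu, hℓ, pow_succ]; ring
    have hmem : ℓ / 2 ∈ Ioc (0 : ℝ) 1 := ⟨by positivity, by nlinarith⟩
    rw [h1] at hx
    rw [hu] at hxn
    obtain ⟨y, hy, hyn⟩ := h₀ _ hmem x
    refine ⟨y, by rw [hy, hx], ?_⟩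
    calc ‖y‖ ≤ C₀ * (ℓ / 2) ^ (-θ) * (N * ℓ ^ p) := by
          refine hyn.trans ?_
          gcongr
      _ = C₀ * 2 ^ θ * N * (ℓ ^ (-θ) * ℓ ^ p) := by
          rw [Real.div_rpow hℓ0.le two_pos.le, Real.rpow_neg two_pos.le, div_inv_eq_mul]
          ring
      _ = C₀ * 2 ^ θ * N * L ^ (p - θ) * q ^ k := by
          rw [← Real.rpow_add hℓ0, neg_add_eq_sub, hℓ, Real.mul_rpow hL0.le (by positivity),
            ← Real.rpow_natCast, ← Real.rpow_mul (by norm_num), mul_comm (k : ℝ),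
            Real.rpow_mul (by norm_num), ← hq, Real.rpow_natCast]
          ring
  choose y hy hyn using hstep
  have hgeo := (hasSum_geometric_of_lt_one hq0 hq1).mul_left (C₀ * 2 ^ θ * N * L ^ (p - θ))
  have hsum : Summable y := Summable.of_norm_bounded hgeo.summable hyn
  refine ⟨∑' k, y k, ?_, ?_⟩
  · have h1 := ((𝓑.ι c b).hasSum hsum.hasSum).tendsto_sum_nat
    simp only [hy] at h1
    simp only [Finset.sum_range_sub', hu0] at h1
    have h2 : Tendsto (fun n => D (u n) t) atTop (𝓝 0) := by
      have h3 : Tendsto (fun n : ℕ => N * (L * (1 / 2 : ℝ) ^ n) ^ p) atTop (𝓝 0) := by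
        have h4 := (tendsto_pow_atTop_nhds_zero_of_lt_one (by norm_num : (0 : ℝ) ≤ 1 / 2)
          (by norm_num)).const_mul L
        have h5 := (h4.rpow_const (p := p) (Or.inr hp0.le)).const_mul N
        rwa [mul_zero, Real.zero_rpow hp0.ne', mul_zero] at h5
      refine squeeze_zero_norm (fun n => ?_) h3
      rw [← hu]
      exact hD _ _ (hut n)
    have h6 := tendsto_const_nhds (x := D s t) |>.sub h2
    rw [sub_zero] at h6
    exact tendsto_nhds_unique h1 h6
  · refine (tsum_of_norm_bounded hgeo hyn).trans (le_of_eq ?_)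
    ring

/-- A mild-additive family with values in `B (α + κ)` comes from a continuous path in `B α`. -/
theorem ParabolicSemigroup.exists_path (𝓢 : ParabolicSemigroup 𝓑) {b α κ : ℝ} (hb : b ≤ α)
    (hκ : 0 < κ) (hκ1 : κ ≤ 1) :
    ∃ C : ℝ, 0 ≤ C ∧ ∀ (Z : I → I → B b) (N : ℝ), 0 ≤ N →
      (∀ s m t : I, s ≤ m → m ≤ t → Z s t = 𝓢.S b ((t : ℝ) - m) (Z s m) + Z m t) →
      (∀ s t : I, s ≤ t → ∃ y : B (α + κ), 𝓑.ι (α + κ) b y = Z s t ∧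
        ‖y‖ ≤ N * ((t : ℝ) - s) ^ κ) →
      ∃ K : C(I, B α), (∀ t, 𝓑.ι α b (K t) = Z 0 t) ∧ (∀ t, ‖K t‖ ≤ C * N) ∧
        ∀ s t : I, s ≤ t → ∃ y : B α, 𝓑.ι α b y = Z s t ∧ K t = 𝓢.S α ((t : ℝ) - s) (K s) + y := by
  obtain ⟨C₁, hC₁, h₁⟩ := 𝓑.norm_ι_le (α + κ) α
  have hακ : α ≤ α + κ := by linarith
  obtain ⟨C₂, hC₂, h₂⟩ := 𝓢.sub_id hακ (by linarith)
  rw [add_sub_cancel_left] at h₂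
  refine ⟨C₁, hC₁, fun Z N hN hZ hlift => ?_⟩
  choose y hy hyn using hlift
  have h0 : ∀ t : I, 0 ≤ t := fun t => t.2.1
  let Y : I → B (α + κ) := fun t => y 0 t (h0 t)
  have hYn : ∀ t, ‖Y t‖ ≤ N := fun t => (hyn 0 t (h0 t)).trans
    (mul_le_of_le_one_right hN (Real.rpow_le_one (sub_mem_Icc (h0 t)).1 (sub_mem_Icc (h0 t)).2 hκ.le))
  have hadd : ∀ s t (h : s ≤ t), 𝓑.ι (α + κ) α (Y t)
      = 𝓢.S α ((t : ℝ) - s) (𝓑.ι (α + κ) α (Y s)) + 𝓑.ι (α + κ) α (y s t h) := by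
    intro s t h
    apply 𝓑.ι_injective hb
    rw [map_add, 𝓢.S_ι hb (sub_mem_Icc h).1, 𝓑.ι_comp hb hακ, 𝓑.ι_comp hb hακ, 𝓑.ι_comp hb hακ,
      hy, hy, hy]
    exact hZ 0 s t (h0 s) h
  -- The increment is `(S_{t-s} - Id) Y_s` plus the lift of `Z s t`. The surplus `κ` of spatial
  -- regularity makes the first term of order `(t - s)^κ` in `B α`.
  have hcont : Continuous fun t => 𝓑.ι (α + κ) α (Y t) := by
    refine continuous_of_rpow_bound (C := C₂ * N + C₁ * N) hκ fun s t h => ?_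
    rw [hadd s t h, add_sub_right_comm]
    have hp : 0 ≤ ((t : ℝ) - s) ^ κ := Real.rpow_nonneg (sub_mem_Icc h).1 _
    calc _ ≤ C₂ * ((t : ℝ) - s) ^ κ * ‖Y s‖ + C₁ * ‖y s t h‖ :=
          (norm_add_le _ _).trans (add_le_add (h₂ _ (sub_mem_Icc h) _) (h₁ _))
      _ ≤ C₂ * ((t : ℝ) - s) ^ κ * N + C₁ * (N * ((t : ℝ) - s) ^ κ) := by
          gcongr
          exacts [hYn s, hyn s t h]
      _ = _ := by ring
  refine ⟨⟨_, hcont⟩, fun t => ?_, fun t => ?_, fun s t h => ⟨𝓑.ι (α + κ) α (y s t h), ?_, ?_⟩⟩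
  · exact (𝓑.ι_comp hb hακ _).trans (hy _ _ _)
  · exact (h₁ _).trans (mul_le_mul_of_nonneg_left (hYn t) hC₁)
  · rw [𝓑.ι_comp hb hακ, hy]
  · exact hadd s t h

end Complete

end

/-! ### The mild germ of a rough integral and its sewing. -/

section

variable {B : ℝ → Type*} [∀ a, NormedAddCommGroup (B a)] [∀ a, NormedSpace ℝ (B a)]
  {𝓑 : InterpolationScale B}

theorem norm_le_of_holder_lt_top {E : Type*} [NormedAddCommGroup E] {θ : ℝ} {Ξ : I → I → E}
    (h : holder θ Ξ < ∞) {s t : I} (hst : s < t) :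
    ‖Ξ s t‖ ≤ (holder θ Ξ).toReal * ((t : ℝ) - s) ^ θ := by
  have h0 : (0 : ℝ) < (t : ℝ) - s := sub_pos.2 hst
  have hp : 0 < ((t : ℝ) - s) ^ θ := Real.rpow_pos_of_pos h0 _
  have h1 : ENNReal.ofReal (‖Ξ s t‖ / ((t : ℝ) - s) ^ θ) ≤ holder θ Ξ :=
    le_iSup_of_le s (le_iSup_of_le t (le_iSup_of_le hst le_rfl))
  rw [← div_le_iff₀ hp]
  exact (ENNReal.ofReal_le_iff_le_toReal h.ne).1 h1

theorem holder_le_of_norm_le {E : Type*} [NormedAddCommGroup E] {θ c : ℝ} {Ξ : I → I → E}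
    (h : ∀ s t : I, s < t → ‖Ξ s t‖ ≤ c * ((t : ℝ) - s) ^ θ) :
    holder θ Ξ ≤ ENNReal.ofReal c := by
  refine iSup_le fun s => iSup_le fun t => iSup_le fun hst => ENNReal.ofReal_le_ofReal ?_
  have h0 : (0 : ℝ) < (t : ℝ) - s := sub_pos.2 hst
  rw [div_le_iff₀ (Real.rpow_pos_of_pos h0 _)]
  exact h s t hst

/-- Pointwise bounds on a rough path. -/
structure RoughPath.IsBounded {γ : ℝ} (X : RoughPath γ) (M : ℝ) : Prop where
  nonneg : 0 ≤ M
  W_le : ∀ s t : I, s ≤ t → |X.W t - X.W s| ≤ M * ((t : ℝ) - s) ^ γ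
  WW_le : ∀ s t : I, s ≤ t → |X.WW s t| ≤ M * ((t : ℝ) - s) ^ (2 * γ)

theorem RoughPath.WW_self {γ : ℝ} (X : RoughPath γ) (s : I) : X.WW s s = 0 := by
  have := X.chen s s s le_rfl le_rfl
  simpa using this

theorem RoughPath.isBounded {γ : ℝ} (X : RoughPath γ) {M : ℝ≥0} (h : X.rho ≤ M) :
    X.IsBounded M := by
  have key : ∀ {θ : ℝ} {Ξ : I → I → ℝ}, holder θ Ξ ≤ M → ∀ s t : I, s < t →
      |Ξ s t| ≤ M * ((t : ℝ) - s) ^ θ := by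
    intro θ Ξ hΞ s t hst
    refine (norm_le_of_holder_lt_top (hΞ.trans_lt ENNReal.coe_lt_top) hst).trans ?_
    refine mul_le_mul_of_nonneg_right ?_ (Real.rpow_nonneg (sub_mem_Icc hst.le).1 _)
    exact ENNReal.toReal_le_of_le_ofReal M.2 (by simpa using hΞ)
  refine ⟨M.2, fun s t hst => ?_, fun s t hst => ?_⟩
  · rcases hst.eq_or_lt with rfl | hlt
    · rw [sub_self, abs_zero, sub_self]; positivity
    · exact key (le_self_add.trans h) s t hlt
  · rcases hst.eq_or_lt with rfl | hlt
    · rw [X.WW_self, abs_zero, sub_self]; positivity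
    · exact key (le_add_self.trans h) s t hlt

variable {γ : ℝ}

/-- The mild germ `S_{w-u} (v_u W_{u,w} + v'_u 𝕎_{u,w})`. -/
def germ (𝓢 : ParabolicSemigroup 𝓑) (X : RoughPath γ) (b : ℝ) (v v' : I → B b) (u w : I) : B b :=
  𝓢.S b ((w : ℝ) - u) ((X.W w - X.W u) • v u + X.WW u w • v' u)

/-- `(v, v')` is a controlled path in `B b`, on which the semigroup acts with a gain of `2γ` resp.
`γ`. -/
structure IsGermData (𝓢 : ParabolicSemigroup 𝓑) (X : RoughPath γ) (b : ℝ) (v v' : I → B b)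
    (N : ℝ) : Prop where
  sub_id : ∀ (u : I), ∀ h ∈ Icc (0 : ℝ) 1, ‖𝓢.S b h (v u) - v u‖ ≤ N * h ^ (2 * γ)
  sub_id' : ∀ (u : I), ∀ h ∈ Icc (0 : ℝ) 1, ‖𝓢.S b h (v' u) - v' u‖ ≤ N * h ^ γ
  rem : ∀ u m : I, u ≤ m → ‖v m - v u - (X.W m - X.W u) • v' u‖ ≤ N * ((m : ℝ) - u) ^ (2 * γ)
  incr : ∀ u m : I, u ≤ m → ‖v' m - v' u‖ ≤ N * ((m : ℝ) - u) ^ γ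

/-- Chen's relation removes the terms of low order. What remains is four products of a rough path
increment with a quantity controlled by `N`, and one term with two increments of `W`, whence `4 * M
+ M ^ 2`. That the whole defect lies behind `S_{w-m}` is what later allows smoothing. -/
theorem IsGermData.exists_delta {𝓢 : ParabolicSemigroup 𝓑} {X : RoughPath γ} {b : ℝ}
    {v v' : I → B b} {N M : ℝ} (hd : IsGermData 𝓢 X b v v' N) (hN : 0 ≤ N) (hγ : 0 < γ)
    (hX : X.IsBounded M) {u m w : I} (hum : u ≤ m) (hmw : m ≤ w) :
    ∃ x : B b, germ 𝓢 X b v v' u w - 𝓢.S b ((w : ℝ) - m) (germ 𝓢 X b v v' u m)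
        - germ 𝓢 X b v v' m w = 𝓢.S b ((w : ℝ) - m) x ∧
      ‖x‖ ≤ (4 * M + M ^ 2) * N * ((w : ℝ) - u) ^ (3 * γ) := by
  have hM := hX.nonneg
  set Sv := 𝓢.S b ((m : ℝ) - u) (v u) with hSv
  set Sv' := 𝓢.S b ((m : ℝ) - u) (v' u) with hSv'
  refine ⟨(X.W w - X.W m) • (Sv - v u) + ((X.W m - X.W u) * (X.W w - X.W m)) • (Sv' - v' u)
    - (X.W w - X.W m) • (v m - v u - (X.W m - X.W u) • v' u) + X.WW m w • (Sv' - v' u)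
    - X.WW m w • (v' m - v' u), ?_, ?_⟩
  · have hc : X.WW u w = X.WW u m + X.WW m w + (X.W m - X.W u) * (X.W w - X.W m) := by
      have := X.chen u m w hum hmw
      linarith
    have e : germ 𝓢 X b v v' u w = 𝓢.S b ((w : ℝ) - m) (𝓢.S b ((m : ℝ) - u)
        ((X.W w - X.W u) • v u + X.WW u w • v' u)) := by
      rw [germ, ← 𝓢.S_add b (sub_mem_Icc hmw).1 (sub_mem_Icc hum).1, sub_add_sub_cancel]
    rw [e, germ, germ, ← map_sub, ← map_sub]
    congr 1
    simp only [map_add, map_smul, hc, ← hSv, ← hSv']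
    module
  · set L : ℝ := (w : ℝ) - u with hL
    have hLm : L ∈ Icc (0 : ℝ) 1 := sub_mem_Icc (hum.trans hmw)
    have hL0 := hLm.1
    have h1 : (m : ℝ) - u ≤ L := by
      have : (m : ℝ) ≤ w := hmw
      linarith
    have h2 : (w : ℝ) - m ≤ L := by
      have : (u : ℝ) ≤ m := hum
      linarith
    have hm1 := sub_mem_Icc hum
    have hm2 := sub_mem_Icc hmw
    have p1 : ((m : ℝ) - u) ^ γ ≤ L ^ γ := Real.rpow_le_rpow hm1.1 h1 hγ.le
    have p2 : ((m : ℝ) - u) ^ (2 * γ) ≤ L ^ (2 * γ) := Real.rpow_le_rpow hm1.1 h1 (by linarith)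
    have p3 : ((w : ℝ) - m) ^ γ ≤ L ^ γ := Real.rpow_le_rpow hm2.1 h2 hγ.le
    have p4 : ((w : ℝ) - m) ^ (2 * γ) ≤ L ^ (2 * γ) := Real.rpow_le_rpow hm2.1 h2 (by linarith)
    have a0 : 0 ≤ L ^ γ := by positivity
    have e2 : L ^ (2 * γ) = L ^ γ * L ^ γ := by
      rw [← Real.rpow_add_of_nonneg hL0 hγ.le hγ.le, two_mul]
    have e3 : L ^ (3 * γ) = L ^ γ * (L ^ γ * L ^ γ) := by
      rw [← e2, ← Real.rpow_add_of_nonneg hL0 hγ.le (by linarith)]; ring_nf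
    rw [e2] at p2 p4
    set a := L ^ γ with ha
    have w1 : |X.W m - X.W u| ≤ M * a := (hX.W_le u m hum).trans (by gcongr)
    have w2 : |X.W w - X.W m| ≤ M * a := (hX.W_le m w hmw).trans (by gcongr)
    have w3 : |X.WW m w| ≤ M * (a * a) := (hX.WW_le m w hmw).trans (by gcongr)
    have n1 : ‖Sv - v u‖ ≤ N * (a * a) := (hd.sub_id u _ hm1).trans (by gcongr)
    have n2 : ‖Sv' - v' u‖ ≤ N * a := (hd.sub_id' u _ hm1).trans (by gcongr)
    have n3 : ‖v m - v u - (X.W m - X.W u) • v' u‖ ≤ N * (a * a) :=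
      (hd.rem u m hum).trans (by gcongr)
    have n4 : ‖v' m - v' u‖ ≤ N * a := (hd.incr u m hum).trans (by gcongr)
    refine (norm_sub_le _ _).trans (le_trans (add_le_add ((norm_add_le _ _).trans (add_le_add
      ((norm_sub_le _ _).trans (add_le_add (norm_add_le _ _) le_rfl)) le_rfl)) le_rfl) ?_)
    simp only [norm_smul, Real.norm_eq_abs, abs_mul]
    rw [e3]
    calc _ ≤ M * a * (N * (a * a)) + M * a * (M * a) * (N * a) + M * a * (N * (a * a))
          + M * (a * a) * (N * a) + M * (a * a) * (N * a) := by gcongr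
      _ = _ := by ring

section Complete

variable [∀ a, CompleteSpace (B a)]

/-- Sewing of the mild germ. -/
theorem ParabolicSemigroup.exists_mild_sewing (𝓢 : ParabolicSemigroup 𝓑) (b : ℝ) {M : ℝ}
    (hM : 0 ≤ M) (hγ : 1 / 3 < γ) :
    ∃ C : ℝ, 0 ≤ C ∧ ∀ X : RoughPath γ, X.IsBounded M → ∀ (v v' : I → B b) (N : ℝ), 0 ≤ N →
      IsGermData 𝓢 X b v v' N → ∃ Z : I → I → B b,
        (∀ s m t : I, s ≤ m → m ≤ t → Z s t = 𝓢.S b ((t : ℝ) - m) (Z s m) + Z m t) ∧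
        (∀ s t : I, s ≤ t →
          ‖germ 𝓢 X b v v' s t - Z s t‖ ≤ C * N * ((t : ℝ) - s) ^ (3 * γ)) ∧
        (∀ s m t : I, s ≤ m → m ≤ t → ∃ x : B b,
          germ 𝓢 X b v v' s t - Z s t - (germ 𝓢 X b v v' m t - Z m t) = 𝓢.S b ((t : ℝ) - m) x ∧
            ‖x‖ ≤ C * N * ((t : ℝ) - s) ^ (3 * γ)) ∧
        ∀ t : I, HasRoughIntegral 𝓢 X b v v' 0 t (Z 0 t) := by
  obtain ⟨C₀, hC₀, h₀⟩ := 𝓢.exists_bound b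
  have hp : 1 < 3 * γ := by linarith
  have hγ0 : 0 < γ := by linarith
  have hK := sewConst_pos hp
  set C₁ := C₀ * (4 * M + M ^ 2) with hC₁
  have hC₁0 : 0 ≤ C₁ := by positivity
  refine ⟨sewConst (3 * γ) * C₁ + (4 * M + M ^ 2), by positivity,
    fun X hX v v' N hN hd => ?_⟩
  set g := germ 𝓢 X b v v' with hg
  -- Propagating the germ to a fixed terminal time `T` turns mild additivity into ordinary
  -- additivity, so that the sewing lemma applies.
  let A : I → I → I → B b := fun T u w => 𝓢.S b ((T : ℝ) - w) (g u w)
  have hA : ∀ T, AlmostAdditive (3 * γ) (C₁ * N) T (A T) := by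
    intro T u m w hum hmw hwT
    obtain ⟨x, hx, hxn⟩ := hd.exists_delta hN hγ0 hX hum hmw
    have e : A T u w - A T u m - A T m w = 𝓢.S b ((T : ℝ) - m) x := by
      have h1 : 𝓢.S b ((T : ℝ) - m) (g u m) = 𝓢.S b ((T : ℝ) - w) (𝓢.S b ((w : ℝ) - m) (g u m)) := by
        rw [← 𝓢.S_add b (sub_mem_Icc hwT).1 (sub_mem_Icc hmw).1, sub_add_sub_cancel]
      change 𝓢.S b ((T : ℝ) - w) (g u w) - 𝓢.S b ((T : ℝ) - m) (g u m)
        - 𝓢.S b ((T : ℝ) - w) (g m w) = _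
      rw [h1, ← map_sub, ← map_sub, hx, ← 𝓢.S_add b (sub_mem_Icc hwT).1 (sub_mem_Icc hmw).1,
        sub_add_sub_cancel]
    rw [e]
    calc _ ≤ C₀ * ‖x‖ := h₀ _ (sub_mem_Icc (hmw.trans hwT)) x
      _ ≤ C₀ * ((4 * M + M ^ 2) * N * ((w : ℝ) - u) ^ (3 * γ)) := by gcongr
      _ = _ := by rw [hC₁]; ring
  have hCN : 0 ≤ C₁ * N := by positivity
  let Z : I → I → B b := fun s t => sew (A t) s t
  have hZ : ∀ s m t : I, s ≤ m → m ≤ t → Z s t = 𝓢.S b ((t : ℝ) - m) (Z s m) + Z m t := by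
    intro s m t hsm hmt
    have h1 := (hA t).sew_add hp hCN hsm hmt le_rfl
    have h2 := (hA t).tendsto_sew hp hCN hsm hmt
    have h3 := ((𝓢.S b ((t : ℝ) - m)).continuous.tendsto _).comp
      ((hA m).tendsto_sew hp hCN hsm le_rfl)
    have h4 : dyadicSum (A t) s m = 𝓢.S b ((t : ℝ) - m) ∘ dyadicSum (A m) s m := by
      funext n
      simp only [dyadicSum, Function.comp_apply, map_sum]
      refine Finset.sum_congr rfl fun k _ => ?_
      change 𝓢.S b _ _ = 𝓢.S b _ (𝓢.S b _ _)
      rw [← 𝓢.S_add b (sub_mem_Icc hmt).1 (sub_mem_Icc (grid_le n hsm _)).1, sub_add_sub_cancel]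
    rw [h4] at h2
    change sew (A t) s t = 𝓢.S b ((t : ℝ) - m) (sew (A m) s m) + sew (A t) m t
    rw [h1, tendsto_nhds_unique h2 h3]
  have hAself : ∀ s t : I, A t s t = g s t := fun s t => by
    change 𝓢.S b ((t : ℝ) - t) (g s t) = _
    rw [sub_self, 𝓢.S_zero]
  have hbd : ∀ s t : I, s ≤ t →
      ‖g s t - Z s t‖ ≤ sewConst (3 * γ) * C₁ * N * ((t : ℝ) - s) ^ (3 * γ) := by
    intro s t hst
    have := (hA t).norm_sew_sub_le hp hCN hst le_rfl
    rw [hAself, norm_sub_rev] at this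
    rwa [mul_assoc (sewConst _)]
  refine ⟨Z, hZ, fun s t hst => (hbd s t hst).trans ?_, fun s m t hsm hmt => ?_, fun t => ?_⟩
  · have : 0 ≤ ((t : ℝ) - s) ^ (3 * γ) := Real.rpow_nonneg (sub_mem_Icc hst).1 _
    gcongr
    have : 0 ≤ 4 * M + M ^ 2 := by positivity
    linarith
  · obtain ⟨x, hx, hxn⟩ := hd.exists_delta hN hγ0 hX hsm hmt
    -- Since `Z` is mildly additive, `g - Z` has the same mild defect `S_{t-m} x` as `g`; the other
    -- summand is `g - Z` on `[s,m]`, propagated by `S_{t-m}`.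
    refine ⟨x + (g s m - Z s m), ?_, ?_⟩
    · rw [map_add, ← hx, map_sub, hZ s m t hsm hmt]
      abel
    · have h1 : ((m : ℝ) - s) ^ (3 * γ) ≤ ((t : ℝ) - s) ^ (3 * γ) := by
        refine Real.rpow_le_rpow (sub_mem_Icc hsm).1 ?_ (by linarith)
        have : (m : ℝ) ≤ t := hmt
        linarith
      calc _ ≤ (4 * M + M ^ 2) * N * ((t : ℝ) - s) ^ (3 * γ)
            + sewConst (3 * γ) * C₁ * N * ((m : ℝ) - s) ^ (3 * γ) :=
            (norm_add_le _ _).trans (add_le_add hxn (hbd s m hsm))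
        _ ≤ (4 * M + M ^ 2) * N * ((t : ℝ) - s) ^ (3 * γ)
            + sewConst (3 * γ) * C₁ * N * ((t : ℝ) - s) ^ (3 * γ) := by gcongr
        _ = _ := by ring
  · intro ε hε
    set K := sewConst (3 * γ) * (C₁ * N) with hKdef
    have hK0 : 0 ≤ K := by positivity
    have hq : 0 < 3 * γ - 1 := by linarith
    -- For a mesh below this value the sewing error is at most `K * (ε / (K + 1))`, which is less
    -- than `ε`.
    refine ⟨(ε / (K + 1)) ^ (3 * γ - 1)⁻¹, by positivity, fun n π hπ h0 hn hstep => ?_⟩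
    have h := (hA t).norm_sum_sub_sew_le hp hCN hπ (h := (ε / (K + 1)) ^ (3 * γ - 1)⁻¹)
      (by positivity) hn.le (fun i hi => (hstep i hi).le)
    rw [← Real.rpow_mul (by positivity), inv_mul_cancel₀ hq.ne', Real.rpow_one, h0, hn,
      ← hKdef] at h
    have e : ∑ i ∈ Finset.range n, A t (π i) (π (i + 1))
        = ∑ i ∈ Finset.range n, ((X.W (π (i + 1)) - X.W (π i)) • 𝓢.S b ((t : ℝ) - π i) (v (π i))
          + X.WW (π i) (π (i + 1)) • 𝓢.S b ((t : ℝ) - π i) (v' (π i))) := by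
      refine Finset.sum_congr rfl fun i hi => ?_
      have hi1 : π (i + 1) ≤ t := (hπ (Finset.mem_range.1 hi)).trans hn.le
      change 𝓢.S b _ (𝓢.S b _ _) = _
      rw [← 𝓢.S_add b (sub_mem_Icc hi1).1 (sub_mem_Icc (hπ (Nat.le_succ i))).1,
        sub_add_sub_cancel, map_add, map_smul, map_smul]
    rw [e] at h
    refine h.trans_lt ?_
    rw [← mul_div_assoc, div_lt_iff₀ (by positivity)]
    nlinarith

end Complete

/-- Rough integrals are unique. -/
theorem HasRoughIntegral.unique {𝓢 : ParabolicSemigroup 𝓑} {X : RoughPath γ} {b : ℝ}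
    {v v' : I → B b} {t : I} {Z Z' : B b} (h : HasRoughIntegral 𝓢 X b v v' 0 t Z)
    (h' : HasRoughIntegral 𝓢 X b v v' 0 t Z') : Z = Z' := by
  by_contra hne
  have hpos : 0 < ‖Z - Z'‖ / 2 := half_pos (norm_pos_iff.2 (sub_ne_zero.2 hne))
  obtain ⟨η, hη, h1⟩ := h _ hpos
  obtain ⟨η', hη', h1'⟩ := h' _ hpos
  obtain ⟨n, hn⟩ := exists_pow_lt_of_lt_one (lt_min hη hη') (by norm_num : (1 / 2 : ℝ) < 1)
  have ht : (0 : I) ≤ t := t.2.1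
  have hs : ∀ i, (grid n 0 t (i + 1) : ℝ) - grid n 0 t i < min η η' := fun i =>
    (grid_step n 0 t i).trans_lt hn
  have h2 := h1 (2 ^ n) (grid n 0 t) (grid_mono n 0 t) (grid_zero n 0 t) (grid_last n ht)
    (fun i _ => (hs i).trans_le (min_le_left _ _))
  have h2' := h1' (2 ^ n) (grid n 0 t) (grid_mono n 0 t) (grid_zero n 0 t) (grid_last n ht)
    (fun i _ => (hs i).trans_le (min_le_right _ _))
  rw [norm_sub_rev] at h2
  have h3 := (norm_add_le _ _).trans_lt (add_lt_add h2 h2')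
  rw [sub_add_sub_cancel, add_halves] at h3
  exact lt_irrefl _ h3

theorem HasRoughIntegral.sub {𝓢 : ParabolicSemigroup 𝓑} {X : RoughPath γ} {b : ℝ}
    {u u' v v' : I → B b} {s t : I} {Z Z' : B b} (h : HasRoughIntegral 𝓢 X b u u' s t Z)
    (h' : HasRoughIntegral 𝓢 X b v v' s t Z') :
    HasRoughIntegral 𝓢 X b (fun r => u r - v r) (fun r => u' r - v' r) s t (Z - Z') := by
  intro ε hε
  obtain ⟨η, hη, h1⟩ := h _ (half_pos hε)
  obtain ⟨η', hη', h1'⟩ := h' _ (half_pos hε)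
  refine ⟨min η η', lt_min hη hη', fun n π hπ h0 hn hs => ?_⟩
  have h2 := h1 n π hπ h0 hn (fun i hi => (hs i hi).trans_le (min_le_left _ _))
  have h2' := h1' n π hπ h0 hn (fun i hi => (hs i hi).trans_le (min_le_right _ _))
  have h3 := (norm_sub_le _ _).trans_lt (add_lt_add h2 h2')
  rw [add_halves] at h3
  refine lt_of_eq_of_lt ?_ h3
  congr 1
  rw [sub_sub_sub_comm, ← Finset.sum_sub_distrib]
  congr 1
  refine Finset.sum_congr rfl fun i _ => ?_
  simp only [map_sub, smul_sub]
  abel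

end

/-! ### Controlled paths and the rough convolution. -/

section

variable {B : ℝ → Type*} [∀ a, NormedAddCommGroup (B a)] [∀ a, NormedSpace ℝ (B a)]
  {𝓑 : InterpolationScale B} {γ : ℝ}

/-- `(V, V')` is a path controlled by `X` on the levels `b₀, b₁, b₂`, with all norms at most `N`. -/
structure IsCRP (𝓑 : InterpolationScale B) (X : RoughPath γ) (b₀ b₁ b₂ : ℝ) (V : I → B b₀)
    (V' : I → B b₁) (N : ℝ) : Prop where
  bound : ∀ t, ‖V t‖ ≤ N
  bound' : ∀ t, ‖V' t‖ ≤ N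
  incr : ∀ s t : I, s ≤ t → ‖𝓑.ι b₁ b₂ (V' t) - 𝓑.ι b₁ b₂ (V' s)‖ ≤ N * ((t : ℝ) - s) ^ γ
  rem : ∀ s t : I, s ≤ t →
    ‖𝓑.ι b₀ b₂ (V t) - 𝓑.ι b₀ b₂ (V s) - (X.W t - X.W s) • 𝓑.ι b₁ b₂ (V' s)‖
      ≤ N * ((t : ℝ) - s) ^ (2 * γ)

theorem IsCRP.nonneg {X : RoughPath γ} {b₀ b₁ b₂ : ℝ} {V : I → B b₀} {V' : I → B b₁} {N : ℝ}
    (h : IsCRP 𝓑 X b₀ b₁ b₂ V V' N) : 0 ≤ N :=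
  (norm_nonneg _).trans (h.bound 0)

theorem rpow_anti {x a b : ℝ} (hx : x ∈ Icc (0 : ℝ) 1) (ha : 0 ≤ a) (hab : a ≤ b) :
    x ^ b ≤ x ^ a :=
  Real.rpow_le_rpow_of_exponent_ge' hx.1 hx.2 ha hab

section Complete

variable [∀ a, CompleteSpace (B a)]

/-- The remainder of a controlled path is automatically `γ`-Hölder on intermediate levels. -/
theorem ParabolicSemigroup.exists_rem_intermediate (𝓢 : ParabolicSemigroup 𝓑)
    {b₀ b₁ b₂ c M : ℝ} (hM : 0 ≤ M) (hγ : 0 < γ) (hγ1 : γ ≤ 1) (h2 : b₂ ≤ c) (h1 : c ≤ b₁)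
    (hc : c ≤ b₀) (hc1 : b₀ ≤ c + 1) (hb₁ : b₁ ≤ c + 1) (hγ2 : c - b₂ ≤ γ) (hγ0 : γ ≤ b₀ - c) :
    ∃ C : ℝ, 0 ≤ C ∧ ∀ X : RoughPath γ, X.IsBounded M → ∀ (V : I → B b₀) (V' : I → B b₁) (N : ℝ),
      IsCRP 𝓑 X b₀ b₁ b₂ V V' N → ∀ s t : I, s ≤ t →
        ‖𝓑.ι b₀ c (V t) - 𝓑.ι b₀ c (V s) - (X.W t - X.W s) • 𝓑.ι b₁ c (V' s)‖
          ≤ C * N * ((t : ℝ) - s) ^ γ := by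
  obtain ⟨C₁, hC₁, k₁⟩ := 𝓢.norm_le_of_ι h2 (by linarith)
  obtain ⟨C₂, hC₂, k₂⟩ := 𝓢.sub_id hc hc1
  obtain ⟨C₃, hC₃, k₃⟩ := 𝓢.sub_id h1 hb₁
  refine ⟨C₁ + 2 * C₂ + M * C₃, by positivity, fun X hX V V' N h s t hst => ?_⟩
  have hN := h.nonneg
  rcases hst.eq_or_lt with rfl | hlt
  · simp only [sub_self, zero_smul, norm_zero]
    rw [Real.zero_rpow hγ.ne', mul_zero]
  have hh := sub_mem_Icc hst
  have hh0 : (0 : ℝ) < (t : ℝ) - s := sub_pos.2 hlt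
  have hW := hX.W_le s t hst
  have hrem := h.rem s t hst
  set ℓ : ℝ := (t : ℝ) - s with hℓ
  set w := X.W t - X.W s with hw
  set x := 𝓑.ι b₀ c (V t) - 𝓑.ι b₀ c (V s) - w • 𝓑.ι b₁ c (V' s) with hx
  have n1 : ‖𝓢.S c ℓ x‖ ≤ C₁ * N * ℓ ^ γ := by
    have e : 𝓑.ι c b₂ x = 𝓑.ι b₀ b₂ (V t) - 𝓑.ι b₀ b₂ (V s) - w • 𝓑.ι b₁ b₂ (V' s) := by
      rw [hx, map_sub, map_sub, map_smul, 𝓑.ι_comp h2 hc, 𝓑.ι_comp h2 hc, 𝓑.ι_comp h2 h1]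
    rw [← e] at hrem
    calc _ ≤ C₁ * ℓ ^ (-(c - b₂)) * (N * ℓ ^ (2 * γ)) := by
          refine (k₁ ℓ ⟨hh0, hh.2⟩ x).trans ?_
          gcongr
      _ = C₁ * N * ℓ ^ (2 * γ - (c - b₂)) := by
          rw [show 2 * γ - (c - b₂) = -(c - b₂) + 2 * γ by ring, Real.rpow_add hh0]; ring
      _ ≤ C₁ * N * ℓ ^ γ := by
          have := rpow_anti hh hγ.le (show γ ≤ 2 * γ - (c - b₂) by linarith)
          gcongr
  have n2 : ‖𝓢.S c ℓ (𝓑.ι b₀ c (V t - V s)) - 𝓑.ι b₀ c (V t - V s)‖ ≤ 2 * C₂ * N * ℓ ^ γ := by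
    have hV : ‖V t - V s‖ ≤ N + N := norm_sub_le_of_le (h.bound t) (h.bound s)
    calc _ ≤ C₂ * ℓ ^ (b₀ - c) * ‖V t - V s‖ := k₂ ℓ hh _
      _ ≤ C₂ * ℓ ^ γ * (N + N) := by
          have := rpow_anti hh hγ.le hγ0
          gcongr
      _ = _ := by ring
  have n3 : ‖w • (𝓢.S c ℓ (𝓑.ι b₁ c (V' s)) - 𝓑.ι b₁ c (V' s))‖ ≤ M * C₃ * N * ℓ ^ γ := by
    rw [norm_smul]
    have h5 : ℓ ^ (b₁ - c) ≤ 1 := Real.rpow_le_one hh.1 hh.2 (by linarith)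
    calc _ ≤ (M * ℓ ^ γ) * (C₃ * ℓ ^ (b₁ - c) * ‖V' s‖) :=
          mul_le_mul hW (k₃ ℓ hh _) (norm_nonneg _) (by positivity)
      _ ≤ (M * ℓ ^ γ) * (C₃ * 1 * N) := by
          gcongr
          exact h.bound' s
      _ = _ := by ring
  -- Smoothing at the time scale `ℓ = t - s` itself: `S_ℓ x` is bounded through the `2γ`-estimate on
  -- the lowest level, and `x - S_ℓ x` through the spatial regularity of `V` and the factor `W` in
  -- front of `V'`.
  have e : x = 𝓢.S c ℓ x - (𝓢.S c ℓ (𝓑.ι b₀ c (V t - V s)) - 𝓑.ι b₀ c (V t - V s))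
      + w • (𝓢.S c ℓ (𝓑.ι b₁ c (V' s)) - 𝓑.ι b₁ c (V' s)) := by
    rw [hx]
    simp only [map_sub, map_smul]
    module
  rw [e]
  calc _ ≤ C₁ * N * ℓ ^ γ + 2 * C₂ * N * ℓ ^ γ + M * C₃ * N * ℓ ^ γ :=
        (norm_add_le _ _).trans (add_le_add ((norm_sub_le _ _).trans (add_le_add n1 n2)) n3)
    _ = _ := by ring

set_option maxHeartbeats 1000000 in
/-- The rough convolution maps controlled paths at level `α - σ` to controlled paths at level `α`. -/
theorem ParabolicSemigroup.exists_rough_convolution (𝓢 : ParabolicSemigroup 𝓑) (α : ℝ) {σ M : ℝ}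
    (hM : 0 ≤ M) (hγ : γ ∈ Ioc (1 / 3 : ℝ) (1 / 2)) (hσ : σ ∈ Ico 0 γ) :
    ∃ C : ℝ, 0 ≤ C ∧ ∀ X : RoughPath γ, X.IsBounded M →
      ∀ (V : I → B (α - σ)) (V' : I → B (α - γ - σ)) (N : ℝ),
      IsCRP 𝓑 X (α - σ) (α - γ - σ) (α - 2 * γ - σ) V V' N →
      ∃ K : C(I, B α),
        (∀ t, HasRoughIntegral 𝓢 X (α - 2 * γ - σ) (fun r => 𝓑.ι (α - σ) (α - 2 * γ - σ) (V r))
          (fun r => 𝓑.ι (α - γ - σ) (α - 2 * γ - σ) (V' r)) 0 t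
          (𝓑.ι α (α - 2 * γ - σ) (K t))) ∧
        IsCRP 𝓑 X α (α - γ) (α - 2 * γ) K (fun t => 𝓑.ι (α - σ) (α - γ) (V t)) (C * N) := by
  obtain ⟨hγ0, hγ1⟩ := hγ
  obtain ⟨hσ0, hσ1⟩ := hσ
  set b₂ := α - 2 * γ - σ with hb₂
  set b₁ := α - γ - σ with hb₁
  set b₀ := α - σ with hb₀
  set c := α - 2 * γ with hc
  -- Half of the available surplus. Lifted to level `α + κ`, both terms of the germ and the sewing
  -- error have the time exponent `γ - σ - κ = κ`.
  set κ := (γ - σ) / 2 with hκ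
  have hκ0 : 0 < κ := by rw [hκ]; linarith
  have e02 : b₀ - b₂ = 2 * γ := by rw [hb₀, hb₂]; ring
  have e12 : b₁ - b₂ = γ := by rw [hb₁, hb₂]; ring
  have l02 : b₂ ≤ b₀ := by linarith
  have l12 : b₂ ≤ b₁ := by linarith
  have lc2 : b₂ ≤ c := by rw [hc, hb₂]; linarith
  have lc1 : c ≤ b₁ := by rw [hc, hb₁]; linarith
  have lc0 : c ≤ b₀ := by rw [hc, hb₀]; linarith
  have lcα : c ≤ α := by rw [hc]; linarith
  have l0α : b₀ ≤ α := by rw [hb₀]; linarith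
  have l0 : b₀ ≤ α + κ := by linarith
  have l1 : b₁ ≤ α + κ := by rw [hb₁]; linarith
  have l2α : b₂ ≤ α := by linarith
  have l2 : b₂ ≤ α + κ := by linarith
  obtain ⟨Ca, hCa, ka⟩ := 𝓢.sub_id l02 (by linarith)
  obtain ⟨Cb, hCb, kb⟩ := 𝓢.sub_id l12 (by linarith)
  obtain ⟨Cs, hCs, ks⟩ := 𝓢.exists_mild_sewing b₂ hM hγ0
  obtain ⟨Cl, hCl, kl⟩ := 𝓢.exists_lift (p := 3 * γ) l2 (by linarith) (by linarith)
  obtain ⟨Cc, hCc, kc⟩ := 𝓢.exists_lift (p := 3 * γ) lc2 (by linarith) (by linarith)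
  obtain ⟨C₀, hC₀, k₀⟩ := 𝓢.smoothing l0 (by linarith)
  obtain ⟨C₁, hC₁, k₁⟩ := 𝓢.smoothing l1 (by linarith)
  obtain ⟨Cp, hCp, kp⟩ := 𝓢.exists_path l2α hκ0 (by linarith)
  obtain ⟨Cr, hCr, kr⟩ := 𝓢.exists_rem_intermediate (γ := γ) hM (by linarith) (by linarith) lc2 lc1
    lc0 (by linarith) (by linarith) (by linarith) (by linarith)
  obtain ⟨Cα, hCα, kα⟩ := 𝓢.sub_id lcα (by linarith)
  obtain ⟨Cd, hCd, kd⟩ := 𝓢.sub_id lc0 (by linarith)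
  obtain ⟨Cu, hCu, ku⟩ := 𝓢.exists_bound c
  obtain ⟨D₀, hD₀, j₀⟩ := 𝓑.norm_ι_le b₀ (α - γ)
  obtain ⟨D₁, hD₁, j₁⟩ := 𝓑.norm_ι_le b₁ c
  set A := Cs * (Ca + Cb + 1) with hA
  have hA0 : 0 ≤ A := by positivity
  set P := Cp * (M * C₀ + M * C₁ + Cl * A) with hP
  have hP0 : 0 ≤ P := by positivity
  refine ⟨P + D₀ + (Cr + M * D₁) + (Cα * P + M * Cd + M * (Cu * D₁) + Cc * A), by positivity,
    fun X hX V V' N h => ?_⟩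
  have hN := h.nonneg
  have hN₁ : 0 ≤ (Ca + Cb + 1) * N := by positivity
  have hd : IsGermData 𝓢 X b₂ (fun r => 𝓑.ι b₀ b₂ (V r)) (fun r => 𝓑.ι b₁ b₂ (V' r))
      ((Ca + Cb + 1) * N) := by
    constructor
    · intro u ℓ hℓ
      have := hℓ.1
      calc _ ≤ Ca * ℓ ^ (b₀ - b₂) * ‖V u‖ := ka ℓ hℓ (V u)
        _ ≤ Ca * ℓ ^ (2 * γ) * N := by rw [e02]; gcongr; exact h.bound u
        _ = Ca * N * ℓ ^ (2 * γ) := by ring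
        _ ≤ _ := by gcongr; linarith
    · intro u ℓ hℓ
      have := hℓ.1
      calc _ ≤ Cb * ℓ ^ (b₁ - b₂) * ‖V' u‖ := kb ℓ hℓ (V' u)
        _ ≤ Cb * ℓ ^ γ * N := by rw [e12]; gcongr; exact h.bound' u
        _ = Cb * N * ℓ ^ γ := by ring
        _ ≤ _ := by gcongr; linarith
    · intro u m hum
      have := (sub_mem_Icc hum).1
      refine (h.rem u m hum).trans ?_
      gcongr
      exact le_mul_of_one_le_left hN (by linarith)
    · intro u m hum
      have := (sub_mem_Icc hum).1
      refine (h.incr u m hum).trans ?_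
      gcongr
      exact le_mul_of_one_le_left hN (by linarith)
  obtain ⟨Z, hZ, hZg, hZδ, hZI⟩ := ks X hX _ _ _ hN₁ hd
  have eA : Cs * ((Ca + Cb + 1) * N) = A * N := by rw [hA]; ring
  rw [eA] at hZg hZδ
  have hAN : 0 ≤ A * N := by positivity
  have gl : ∀ s t : I, s ≤ t → ∃ y : B (α + κ), 𝓑.ι (α + κ) b₂ y
      = germ 𝓢 X b₂ (fun r => 𝓑.ι b₀ b₂ (V r)) (fun r => 𝓑.ι b₁ b₂ (V' r)) s t ∧
      ‖y‖ ≤ (M * C₀ + M * C₁) * N * ((t : ℝ) - s) ^ κ := by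
    intro s t hst
    rcases hst.eq_or_lt with rfl | hlt
    · refine ⟨0, ?_, ?_⟩
      · simp [germ, X.WW_self]
      · rw [norm_zero, sub_self]; positivity
    have hh := sub_mem_Icc hst
    have hh0 : (0 : ℝ) < (t : ℝ) - s := sub_pos.2 hlt
    have hW := hX.W_le s t hst
    have hWW := hX.WW_le s t hst
    rw [germ]
    set ℓ : ℝ := (t : ℝ) - s with hℓ
    obtain ⟨y₀, hy₀, n₀⟩ := k₀ ℓ ⟨hh0, hh.2⟩ (V s)
    obtain ⟨y₁, hy₁, n₁⟩ := k₁ ℓ ⟨hh0, hh.2⟩ (V' s)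
    refine ⟨(X.W t - X.W s) • y₀ + X.WW s t • y₁, ?_, ?_⟩
    · rw [map_add, map_smul, map_smul, map_add, map_smul, map_smul, ← 𝓑.ι_comp l02 l0, hy₀,
        ← 𝓑.ι_comp l12 l1, hy₁, 𝓢.S_ι l02 hh.1, 𝓢.S_ι l12 hh.1]
    · refine (norm_add_le _ _).trans ?_
      rw [norm_smul, norm_smul]
      have b0 := h.bound s
      have b1 := h.bound' s
      calc _ ≤ M * ℓ ^ γ * (C₀ * ℓ ^ (-(α + κ - b₀)) * N)
            + M * ℓ ^ (2 * γ) * (C₁ * ℓ ^ (-(α + κ - b₁)) * N) := by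
            refine add_le_add (mul_le_mul hW (n₀.trans ?_) (norm_nonneg _) (by positivity))
              (mul_le_mul hWW (n₁.trans ?_) (norm_nonneg _) (by positivity)) <;> gcongr
        _ = M * C₀ * N * (ℓ ^ γ * ℓ ^ (-(α + κ - b₀)))
            + M * C₁ * N * (ℓ ^ (2 * γ) * ℓ ^ (-(α + κ - b₁))) := by ring
        _ = _ := by
            rw [← Real.rpow_add hh0, ← Real.rpow_add hh0,
              show γ + -(α + κ - b₀) = κ by rw [hb₀, hκ]; ring,
              show 2 * γ + -(α + κ - b₁) = κ by rw [hb₁, hκ]; ring]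
            ring
  have Zl : ∀ s t : I, s ≤ t → ∃ y : B (α + κ), 𝓑.ι (α + κ) b₂ y = Z s t ∧
      ‖y‖ ≤ (M * C₀ + M * C₁ + Cl * A) * N * ((t : ℝ) - s) ^ κ := by
    intro s t hst
    obtain ⟨y, hy, hyn⟩ := gl s t hst
    obtain ⟨z, hz, hzn⟩ := kl _ _ hAN hZg hZδ s t hst
    rw [show 3 * γ - (α + κ - b₂) = κ by rw [hb₂, hκ]; ring] at hzn
    refine ⟨y - z, by rw [map_sub, hy, hz, sub_sub_cancel], (norm_sub_le _ _).trans ?_⟩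
    linarith
  obtain ⟨K, hK, hKn, hKa⟩ := kp Z _ (by positivity) hZ Zl
  have hKP : ∀ t, ‖K t‖ ≤ P * N := fun t => (hKn t).trans (le_of_eq (by rw [hP]; ring))
  refine ⟨K, fun t => by rw [hK]; exact hZI t, ?_, ?_, ?_, ?_⟩
  · intro t
    refine (hKP t).trans (mul_le_mul_of_nonneg_right ?_ hN)
    have : 0 ≤ D₀ + (Cr + M * D₁) + (Cα * P + M * Cd + M * (Cu * D₁) + Cc * A) := by positivity
    linarith
  · intro t
    refine ((j₀ _).trans (mul_le_mul_of_nonneg_left (h.bound t) hD₀)).trans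
      (mul_le_mul_of_nonneg_right ?_ hN)
    have : 0 ≤ P + (Cr + M * D₁) + (Cα * P + M * Cd + M * (Cu * D₁) + Cc * A) := by positivity
    linarith
  · intro s t hst
    have hh := sub_mem_Icc hst
    have hp : 0 ≤ ((t : ℝ) - s) ^ γ := Real.rpow_nonneg hh.1 _
    rw [𝓑.ι_comp (by rw [hc]; linarith) (by rw [hb₀]; linarith),
      𝓑.ι_comp (by rw [hc]; linarith) (by rw [hb₀]; linarith)]
    -- The new Gubinelli derivative is `V`, which must be `γ`-Hölder on the level `α - 2γ`. The
    -- given remainder bound lives `σ` lower, hence the detour through the intermediate level.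
    have n1 := kr X hX V V' N h s t hst
    have n2 : ‖(X.W t - X.W s) • 𝓑.ι b₁ c (V' s)‖ ≤ M * D₁ * N * ((t : ℝ) - s) ^ γ := by
      rw [norm_smul]
      calc _ ≤ (M * ((t : ℝ) - s) ^ γ) * (D₁ * N) :=
            mul_le_mul (hX.W_le s t hst)
              ((j₁ _).trans (mul_le_mul_of_nonneg_left (h.bound' s) hD₁)) (norm_nonneg _)
              (by positivity)
        _ = _ := by ring
    have n3 := norm_add_le_of_le n1 n2
    rw [sub_add_cancel] at n3
    refine n3.trans ?_
    have : 0 ≤ P + D₀ + (Cα * P + M * Cd + M * (Cu * D₁) + Cc * A) := by positivity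
    calc _ = (Cr + M * D₁) * N * ((t : ℝ) - s) ^ γ := by ring
      _ ≤ _ := mul_le_mul_of_nonneg_right (mul_le_mul_of_nonneg_right (by linarith) hN) hp
  · intro s t hst
    have hh := sub_mem_Icc hst
    have hW := hX.W_le s t hst
    have hWW := hX.WW_le s t hst
    obtain ⟨y, hy, hyK⟩ := hKa s t hst
    obtain ⟨z, hz, hzn⟩ := kc _ _ hAN hZg hZδ s t hst
    rw [germ] at hz
    set ℓ : ℝ := (t : ℝ) - s with hℓ
    have hℓ0 := hh.1
    set w := X.W t - X.W s with hw
    have ey : 𝓑.ι α c y = w • 𝓢.S c ℓ (𝓑.ι b₀ c (V s)) + X.WW s t • 𝓢.S c ℓ (𝓑.ι b₁ c (V' s))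
        - z := by
      apply 𝓑.ι_injective lc2
      rw [𝓑.ι_comp lc2 lcα, hy, map_sub, hz, map_add, map_smul, map_smul, 𝓢.S_ι lc2 hh.1,
        𝓢.S_ι lc2 hh.1, 𝓑.ι_comp lc2 lc0, 𝓑.ι_comp lc2 lc1, map_add, map_smul, map_smul]
      abel
    rw [𝓑.ι_comp (by rw [hc]; linarith) (by rw [hb₀]; linarith), hyK, map_add, 𝓢.S_ι lcα hh.1, ey]
    -- From `K_t = S_ℓ K_s + germ - z`. On the level `α - 2γ` the four terms have the exponents
    -- `2γ`, `γ + (2γ - σ)`, `2γ` and `3γ - σ`, all at least `2γ`.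
    have e : 𝓢.S c ℓ (𝓑.ι α c (K s)) + (w • 𝓢.S c ℓ (𝓑.ι b₀ c (V s))
          + X.WW s t • 𝓢.S c ℓ (𝓑.ι b₁ c (V' s)) - z) - 𝓑.ι α c (K s) - w • 𝓑.ι b₀ c (V s)
        = (𝓢.S c ℓ (𝓑.ι α c (K s)) - 𝓑.ι α c (K s))
          + w • (𝓢.S c ℓ (𝓑.ι b₀ c (V s)) - 𝓑.ι b₀ c (V s))
          + X.WW s t • 𝓢.S c ℓ (𝓑.ι b₁ c (V' s)) - z := by module
    rw [e]
    have n1 : ‖𝓢.S c ℓ (𝓑.ι α c (K s)) - 𝓑.ι α c (K s)‖ ≤ Cα * P * N * ℓ ^ (2 * γ) := by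
      calc _ ≤ Cα * ℓ ^ (α - c) * ‖K s‖ := kα ℓ hh _
        _ ≤ Cα * ℓ ^ (α - c) * (P * N) := by gcongr; exact hKP s
        _ = _ := by rw [show α - c = 2 * γ by rw [hc]; ring]; ring
    have n2 : ‖w • (𝓢.S c ℓ (𝓑.ι b₀ c (V s)) - 𝓑.ι b₀ c (V s))‖ ≤ M * Cd * N * ℓ ^ (2 * γ) := by
      rw [norm_smul]
      have hp := rpow_anti hh (show 0 ≤ 2 * γ by linarith)
        (show 2 * γ ≤ γ + (b₀ - c) by rw [hb₀, hc]; linarith)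
      calc _ ≤ M * ℓ ^ γ * (Cd * ℓ ^ (b₀ - c) * N) :=
            mul_le_mul hW ((kd ℓ hh _).trans (mul_le_mul_of_nonneg_left (h.bound s)
              (by positivity))) (norm_nonneg _) (by positivity)
        _ = M * Cd * N * (ℓ ^ γ * ℓ ^ (b₀ - c)) := by ring
        _ = M * Cd * N * ℓ ^ (γ + (b₀ - c)) := by
            rw [Real.rpow_add_of_nonneg hℓ0 (by linarith) (by linarith)]
        _ ≤ _ := by gcongr
    have n3 : ‖X.WW s t • 𝓢.S c ℓ (𝓑.ι b₁ c (V' s))‖ ≤ M * (Cu * D₁) * N * ℓ ^ (2 * γ) := by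
      rw [norm_smul]
      calc _ ≤ M * ℓ ^ (2 * γ) * (Cu * (D₁ * N)) :=
            mul_le_mul hWW ((ku ℓ hh _).trans (mul_le_mul_of_nonneg_left ((j₁ _).trans
              (mul_le_mul_of_nonneg_left (h.bound' s) hD₁)) hCu)) (norm_nonneg _) (by positivity)
        _ = _ := by ring
    have n4 : ‖z‖ ≤ Cc * A * N * ℓ ^ (2 * γ) := by
      have hp := rpow_anti hh (show 0 ≤ 2 * γ by linarith)
        (show 2 * γ ≤ 3 * γ - (c - b₂) by rw [hb₂, hc]; linarith)
      calc _ ≤ Cc * (A * N) * ℓ ^ (3 * γ - (c - b₂)) := hzn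
        _ ≤ Cc * (A * N) * ℓ ^ (2 * γ) := by gcongr
        _ = _ := by ring
    have : 0 ≤ P + D₀ + (Cr + M * D₁) := by positivity
    calc _ ≤ Cα * P * N * ℓ ^ (2 * γ) + M * Cd * N * ℓ ^ (2 * γ)
          + M * (Cu * D₁) * N * ℓ ^ (2 * γ) + Cc * A * N * ℓ ^ (2 * γ) :=
          (norm_sub_le _ _).trans (add_le_add ((norm_add_le _ _).trans (add_le_add
            ((norm_add_le _ _).trans (add_le_add n1 n2)) n3)) n4)
      _ = (Cα * P + M * Cd + M * (Cu * D₁) + Cc * A) * N * ℓ ^ (2 * γ) := by ring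
      _ ≤ _ := mul_le_mul_of_nonneg_right (mul_le_mul_of_nonneg_right (by linarith) hN)
          (by positivity)

end Complete

end

/-! ### The drift convolution and the orbit of the initial datum. -/

section

variable {B : ℝ → Type*} [∀ a, NormedAddCommGroup (B a)] [∀ a, NormedSpace ℝ (B a)]
  {𝓑 : InterpolationScale B} {γ : ℝ}

section Complete

variable [∀ a, CompleteSpace (B a)]

/-- Strong continuity handles the moving time with `φ r₀` frozen; the uniform operator bound handles
the change of `φ`. -/
theorem ParabolicSemigroup.continuousOn_convolution (𝓢 : ParabolicSemigroup 𝓑) (b : ℝ)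
    {φ : ℝ → B b} (hφ : Continuous φ) (t : I) :
    ContinuousOn (fun r => 𝓢.S b ((t : ℝ) - r) (φ r)) (Icc 0 t) := by
  obtain ⟨C, hC, h⟩ := 𝓢.exists_bound b
  intro r₀ hr₀
  refine tendsto_iff_norm_sub_tendsto_zero.2 ?_
  have h1 : Tendsto (fun r => C * ‖φ r - φ r₀‖) (𝓝[Icc 0 (t : ℝ)] r₀) (𝓝 0) := by
    have : Continuous fun r => C * ‖φ r - φ r₀‖ := by fun_prop
    have := this.tendsto r₀
    rw [sub_self, norm_zero, mul_zero] at this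
    exact this.mono_left nhdsWithin_le_nhds
  have h2 : Tendsto (fun r => ‖𝓢.S b ((t : ℝ) - r) (φ r₀) - 𝓢.S b ((t : ℝ) - r₀) (φ r₀)‖)
      (𝓝[Icc 0 (t : ℝ)] r₀) (𝓝 0) := by
    refine tendsto_iff_norm_sub_tendsto_zero.1 ?_
    exact ((𝓢.S_continuous b (φ r₀)).comp (f := fun r : ℝ => (t : ℝ) - r)
      (continuous_const.sub continuous_id).continuousOn
      (fun r (hr : r ∈ Icc 0 (t : ℝ)) => sub_nonneg.2 hr.2)) r₀ hr₀
  have h3 := h1.add h2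
  rw [add_zero] at h3
  refine squeeze_zero' (Eventually.of_forall fun _ => norm_nonneg _) ?_ h3
  filter_upwards [self_mem_nhdsWithin] with r hr
  have e : 𝓢.S b ((t : ℝ) - r) (φ r) - 𝓢.S b ((t : ℝ) - r₀) (φ r₀)
      = 𝓢.S b ((t : ℝ) - r) (φ r - φ r₀)
        + (𝓢.S b ((t : ℝ) - r) (φ r₀) - 𝓢.S b ((t : ℝ) - r₀) (φ r₀)) := by
    rw [map_sub]; abel
  rw [e]
  exact (norm_add_le _ _).trans (add_le_add
    (h _ ⟨sub_nonneg.2 hr.2, by linarith [hr.1, t.2.2]⟩ _) le_rfl)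

theorem ParabolicSemigroup.intervalIntegrable_convolution (𝓢 : ParabolicSemigroup 𝓑) (b : ℝ)
    {φ : ℝ → B b} (hφ : Continuous φ) {s m t : I} (hsm : s ≤ m) (hmt : m ≤ t) :
    IntervalIntegrable (fun r => 𝓢.S b ((t : ℝ) - r) (φ r)) MeasureTheory.volume s m := by
  refine ContinuousOn.intervalIntegrable ((𝓢.continuousOn_convolution b hφ t).mono ?_)
  rw [uIcc_of_le (show (s : ℝ) ≤ m from hsm)]
  exact Icc_subset_Icc s.2.1 hmt

/-- Convolution of a continuous path in `B (α - δ)` with the semigroup is a controlled path with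
vanishing Gubinelli derivative. -/
theorem ParabolicSemigroup.exists_drift_convolution (𝓢 : ParabolicSemigroup 𝓑) (α : ℝ) {δ : ℝ}
    (hγ0 : 0 < γ) (hγ1 : γ ≤ 1 / 2) (hδ : δ ∈ Ico (0 : ℝ) 1) :
    ∃ C : ℝ, 0 ≤ C ∧ ∀ (X : RoughPath γ) (φ : ℝ → B (α - δ)) (N : ℝ), Continuous φ →
      (∀ r, ‖φ r‖ ≤ N) → ∃ J : C(I, B α),
        (∀ t : I, 𝓑.ι α (α - δ) (J t) = ∫ r in (0 : ℝ)..t, 𝓢.S (α - δ) ((t : ℝ) - r) (φ r)) ∧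
        IsCRP 𝓑 X α (α - γ) (α - 2 * γ) J (fun _ => 0) (C * N) := by
  obtain ⟨hδ0, hδ1⟩ := hδ
  set b := α - δ with hb
  set c := α - 2 * γ with hc
  set κ := (1 - δ) / 2 with hκ
  have hκ0 : 0 < κ := by rw [hκ]; linarith
  have lb : b ≤ α := by linarith
  have lbκ : b ≤ α + κ := by linarith
  have lc : c ≤ α := by linarith
  obtain ⟨C₀, hC₀, k₀⟩ := 𝓢.exists_bound b
  obtain ⟨Cl, hCl, kl⟩ := 𝓢.exists_lift (p := 1) lbκ (by linarith) (by linarith)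
  obtain ⟨Cp, hCp, kp⟩ := 𝓢.exists_path lb hκ0 (by linarith)
  obtain ⟨Cα, hCα, kα⟩ := 𝓢.sub_id lc (by linarith)
  -- The level `α - δ` may lie below or above `α - 2γ`. In the first case the increment is lifted,
  -- with exponent `1 - (c - b) ≥ 2γ`; in the second an inclusion suffices because `2γ ≤ 1`.
  have hinc : ∃ C : ℝ, 0 ≤ C ∧ ∀ (D : I → I → B b) (N : ℝ), 0 ≤ N →
      (∀ s t : I, s ≤ t → ‖D s t‖ ≤ N * ((t : ℝ) - s) ^ (1 : ℝ)) →
      (∀ s m t : I, s ≤ m → m ≤ t → ∃ x : B b, D s t - D m t = 𝓢.S b ((t : ℝ) - m) x ∧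
        ‖x‖ ≤ N * ((t : ℝ) - s) ^ (1 : ℝ)) →
      ∀ s t : I, s ≤ t → ∀ y : B α, 𝓑.ι α b y = D s t →
        ‖𝓑.ι α c y‖ ≤ C * N * ((t : ℝ) - s) ^ (2 * γ) := by
    rcases le_total b c with h | h
    · obtain ⟨C, hC, k⟩ := 𝓢.exists_lift (p := 1) h (by linarith) (by linarith)
      refine ⟨C, hC, fun D N hN h1 h2 s t hst y hy => ?_⟩
      obtain ⟨z, hz, hzn⟩ := k D N hN h1 h2 s t hst
      have e : 𝓑.ι α c y = z := 𝓑.ι_injective h (by rw [𝓑.ι_comp h lc, hy, hz])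
      rw [e]
      have := rpow_anti (sub_mem_Icc hst) (show 0 ≤ 2 * γ by linarith)
        (show 2 * γ ≤ 1 - (c - b) by rw [hc, hb]; linarith)
      exact hzn.trans (by gcongr)
    · obtain ⟨C, hC, k⟩ := 𝓑.norm_ι_le b c
      refine ⟨C, hC, fun D N hN h1 h2 s t hst y hy => ?_⟩
      rw [← 𝓑.ι_comp h lb, hy]
      have := rpow_anti (sub_mem_Icc hst) (show 0 ≤ 2 * γ by linarith)
        (show 2 * γ ≤ 1 by linarith)
      calc _ ≤ C * ‖D s t‖ := k _
        _ ≤ C * (N * ((t : ℝ) - s) ^ (1 : ℝ)) := by gcongr; exact h1 s t hst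
        _ ≤ C * (N * ((t : ℝ) - s) ^ (2 * γ)) := by gcongr
        _ = _ := by ring
  obtain ⟨Ci, hCi, ki⟩ := hinc
  set P := Cp * (Cl * C₀) with hP
  have hP0 : 0 ≤ P := by positivity
  refine ⟨P + Cα * P + Ci * C₀, by positivity, fun X φ N hφ hN' => ?_⟩
  have hN : 0 ≤ N := (norm_nonneg _).trans (hN' 0)
  let Z : I → I → B b := fun s t => ∫ r in (s : ℝ)..t, 𝓢.S b ((t : ℝ) - r) (φ r)
  have hZn : ∀ s t : I, s ≤ t → ‖Z s t‖ ≤ C₀ * N * ((t : ℝ) - s) ^ (1 : ℝ) := by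
    intro s t hst
    have := intervalIntegral.norm_integral_le_of_norm_le_const (a := (s : ℝ)) (b := t)
      (f := fun r => 𝓢.S b ((t : ℝ) - r) (φ r)) (C := C₀ * N) (fun r hr => by
        rw [uIoc_of_le (show (s : ℝ) ≤ t from hst)] at hr
        exact (k₀ _ ⟨sub_nonneg.2 hr.2, by linarith [hr.1, s.2.1, t.2.2]⟩ _).trans
          (mul_le_mul_of_nonneg_left (hN' r) hC₀))
    rwa [abs_of_nonneg (sub_mem_Icc hst).1, ← Real.rpow_one ((t : ℝ) - s)] at this
  have hZ : ∀ s m t : I, s ≤ m → m ≤ t → Z s t = 𝓢.S b ((t : ℝ) - m) (Z s m) + Z m t := by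
    intro s m t hsm hmt
    change ∫ r in (s : ℝ)..t, _ = 𝓢.S b ((t : ℝ) - m) (∫ r in (s : ℝ)..m, _) + ∫ r in (m : ℝ)..t, _
    rw [← ContinuousLinearMap.intervalIntegral_comp_comm _
        (𝓢.intervalIntegrable_convolution b hφ hsm le_rfl),
      ← intervalIntegral.integral_add_adjacent_intervals
        (𝓢.intervalIntegrable_convolution b hφ hsm hmt)
        (𝓢.intervalIntegrable_convolution b hφ hmt le_rfl)]
    congr 1
    refine intervalIntegral.integral_congr fun r hr => ?_
    rw [uIcc_of_le (show (s : ℝ) ≤ m from hsm)] at hr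
    rw [← 𝓢.S_add b (sub_mem_Icc hmt).1 (sub_nonneg.2 hr.2), sub_add_sub_cancel]
  -- No germ has to be subtracted: the integral is itself of order `1`, and moving its left endpoint
  -- changes it by `S_{t-m}` applied to the integral over `[s,m]`.
  have hZδ : ∀ s m t : I, s ≤ m → m ≤ t → ∃ x : B b, Z s t - Z m t = 𝓢.S b ((t : ℝ) - m) x ∧
      ‖x‖ ≤ C₀ * N * ((t : ℝ) - s) ^ (1 : ℝ) := by
    intro s m t hsm hmt
    refine ⟨Z s m, by rw [hZ s m t hsm hmt, add_sub_cancel_right], (hZn s m hsm).trans ?_⟩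
    rw [Real.rpow_one, Real.rpow_one]
    have : (m : ℝ) ≤ t := hmt
    gcongr
  have hCN : 0 ≤ C₀ * N := by positivity
  have Zl : ∀ s t : I, s ≤ t → ∃ y : B (α + κ), 𝓑.ι (α + κ) b y = Z s t ∧
      ‖y‖ ≤ Cl * (C₀ * N) * ((t : ℝ) - s) ^ κ := by
    intro s t hst
    obtain ⟨y, hy, hyn⟩ := kl Z _ hCN hZn hZδ s t hst
    rw [show 1 - (α + κ - b) = κ by rw [hb, hκ]; ring] at hyn
    exact ⟨y, hy, hyn⟩
  obtain ⟨J, hJ, hJn, hJa⟩ := kp Z _ (by positivity) hZ Zl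
  have hJP : ∀ t, ‖J t‖ ≤ P * N := fun t => (hJn t).trans (le_of_eq (by rw [hP]; ring))
  refine ⟨J, hJ, ?_, ?_, ?_, ?_⟩
  · intro t
    refine (hJP t).trans (mul_le_mul_of_nonneg_right ?_ hN)
    have : 0 ≤ Cα * P + Ci * C₀ := by positivity
    linarith
  · intro t
    rw [norm_zero]
    positivity
  · intro s t hst
    have hh := (sub_mem_Icc hst).1
    rw [sub_self, norm_zero]
    positivity
  · intro s t hst
    have hh := sub_mem_Icc hst
    obtain ⟨y, hy, hyJ⟩ := hJa s t hst
    have n1 := ki Z _ hCN hZn hZδ s t hst y hy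
    have n2 : ‖𝓢.S c ((t : ℝ) - s) (𝓑.ι α c (J s)) - 𝓑.ι α c (J s)‖
        ≤ Cα * P * N * ((t : ℝ) - s) ^ (2 * γ) := by
      have hp : 0 ≤ ((t : ℝ) - s) ^ (α - c) := Real.rpow_nonneg hh.1 _
      calc _ ≤ Cα * ((t : ℝ) - s) ^ (α - c) * ‖J s‖ := kα _ hh _
        _ ≤ Cα * ((t : ℝ) - s) ^ (α - c) * (P * N) := by gcongr; exact hJP s
        _ = _ := by rw [show α - c = 2 * γ by rw [hc]; ring]; ring
    rw [map_zero, smul_zero, sub_zero, hyJ, map_add, 𝓢.S_ι lc hh.1, add_sub_right_comm]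
    refine (norm_add_le_of_le n2 n1).trans ?_
    calc _ = (Cα * P + Ci * C₀) * N * ((t : ℝ) - s) ^ (2 * γ) := by ring
      _ ≤ _ := mul_le_mul_of_nonneg_right (mul_le_mul_of_nonneg_right (by linarith) hN)
          (Real.rpow_nonneg hh.1 _)

end Complete

/-- The orbit of the semigroup is a controlled path with vanishing Gubinelli derivative. -/
theorem ParabolicSemigroup.exists_orbit [∀ a, CompleteSpace (B a)] (𝓢 : ParabolicSemigroup 𝓑)
    (α : ℝ) (hγ0 : 0 < γ) (hγ1 : γ ≤ 1 / 2) (X : RoughPath γ) (ξ : B α) :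
    ∃ (K : C(I, B α)) (N : ℝ), (∀ t : I, K t = 𝓢.S α t ξ) ∧
      IsCRP 𝓑 X α (α - γ) (α - 2 * γ) K (fun _ => 0) N := by
  set c := α - 2 * γ with hc
  have lc : c ≤ α := by linarith
  obtain ⟨C₀, hC₀, k₀⟩ := 𝓢.exists_bound α
  obtain ⟨Cα, hCα, kα⟩ := 𝓢.sub_id lc (by linarith)
  have hcont : Continuous fun t : I => 𝓢.S α t ξ :=
    (𝓢.S_continuous α ξ).comp_continuous continuous_subtype_val fun t => t.2.1
  have hb : ∀ t : I, ‖𝓢.S α t ξ‖ ≤ C₀ * ‖ξ‖ := fun t => k₀ t t.2 ξ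
  refine ⟨⟨_, hcont⟩, C₀ * ‖ξ‖ + Cα * (C₀ * ‖ξ‖), fun t => rfl, ?_, ?_, ?_, ?_⟩
  · intro t
    have : 0 ≤ Cα * (C₀ * ‖ξ‖) := by positivity
    exact (hb t).trans (by linarith)
  · intro t
    rw [norm_zero]
    positivity
  · intro s t hst
    have hh := (sub_mem_Icc hst).1
    rw [sub_self, norm_zero]
    positivity
  · intro s t hst
    have hh := sub_mem_Icc hst
    have e : 𝓢.S α t ξ = 𝓢.S α ((t : ℝ) - s) (𝓢.S α s ξ) := by
      rw [← 𝓢.S_add α hh.1 s.2.1, sub_add_cancel]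
    rw [map_zero, smul_zero, sub_zero]
    change ‖𝓑.ι α c (𝓢.S α t ξ) - 𝓑.ι α c (𝓢.S α s ξ)‖ ≤ _
    rw [e, 𝓢.S_ι lc hh.1]
    have hp : 0 ≤ ((t : ℝ) - s) ^ (2 * γ) := Real.rpow_nonneg hh.1 _
    have h2 := kα _ hh (𝓢.S α s ξ)
    rw [show α - c = 2 * γ by rw [hc]; ring] at h2
    calc _ ≤ Cα * ((t : ℝ) - s) ^ (2 * γ) * ‖𝓢.S α s ξ‖ := h2
      _ ≤ Cα * ((t : ℝ) - s) ^ (2 * γ) * (C₀ * ‖ξ‖) := by gcongr; exact hb s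
      _ = Cα * (C₀ * ‖ξ‖) * ((t : ℝ) - s) ^ (2 * γ) := by ring
      _ ≤ _ := by
        gcongr
        have : 0 ≤ C₀ * ‖ξ‖ := by positivity
        linarith

end

/-! ### Taylor estimates and composition of controlled paths with `G`. -/

section

section Calculus

variable {E E' : Type*} [NormedAddCommGroup E] [NormedSpace ℝ E] [NormedAddCommGroup E']
  [NormedSpace ℝ E']

/-- `g` is twice differentiable with bounded Lipschitz second derivative and `Dg(0) = 0`. -/
structure HasLipschitzSecondDeriv (K : ℝ) (g : E → E') : Prop where
  nonneg : 0 ≤ K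
  diff : Differentiable ℝ g
  diff' : Differentiable ℝ (fderiv ℝ g)
  bound : ∀ x, ‖fderiv ℝ (fderiv ℝ g) x‖ ≤ K
  lip : ∀ x y, ‖fderiv ℝ (fderiv ℝ g) x - fderiv ℝ (fderiv ℝ g) y‖ ≤ K * ‖x - y‖
  zero : fderiv ℝ g 0 = 0

namespace HasLipschitzSecondDeriv

variable {K : ℝ} {g : E → E'}

theorem mono (hg : HasLipschitzSecondDeriv K g) {K' : ℝ} (h : K ≤ K') :
    HasLipschitzSecondDeriv K' g :=
  ⟨hg.nonneg.trans h, hg.diff, hg.diff', fun x => (hg.bound x).trans h,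
    fun x y => (hg.lip x y).trans (by gcongr), hg.zero⟩

theorem fderiv_sub_le (hg : HasLipschitzSecondDeriv K g) (x y : E) :
    ‖fderiv ℝ g x - fderiv ℝ g y‖ ≤ K * ‖x - y‖ :=
  convex_univ.norm_image_sub_le_of_norm_fderiv_le (fun x _ => hg.diff' x) (fun x _ => hg.bound x)
    (mem_univ y) (mem_univ x)

theorem fderiv_le (hg : HasLipschitzSecondDeriv K g) (x : E) : ‖fderiv ℝ g x‖ ≤ K * ‖x‖ := by
  simpa [hg.zero] using hg.fderiv_sub_le x 0

/-- Source of the smallness: as the derivative vanishes at the origin, the Lipschitz constant on a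
ball is proportional to its radius. -/
theorem sub_le (hg : HasLipschitzSecondDeriv K g) {r : ℝ} {x y : E} (hx : ‖x‖ ≤ r)
    (hy : ‖y‖ ≤ r) : ‖g x - g y‖ ≤ K * r * ‖x - y‖ := by
  refine (convex_closedBall (0 : E) r).norm_image_sub_le_of_norm_fderiv_le
    (fun x _ => hg.diff x) (fun z hz => ?_) (by simpa using hy) (by simpa using hx)
  have := hg.nonneg
  refine (hg.fderiv_le z).trans ?_
  gcongr
  simpa using hz

/-- Exchanging `h` for `k` costs `K * ‖h - k‖`. For a common shift `k`, the map `z ↦ Dg(z + k) -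
Dg(z)` has a derivative of norm at most `K * ‖k‖`, because the second derivative is Lipschitz. -/
theorem fderiv_second_difference (hg : HasLipschitzSecondDeriv K g) (x h y k : E) :
    ‖fderiv ℝ g (x + h) - fderiv ℝ g x - (fderiv ℝ g (y + k) - fderiv ℝ g y)‖
      ≤ K * ‖h - k‖ + K * ‖k‖ * ‖x - y‖ := by
  have h1 := hg.fderiv_sub_le (x + h) (x + k)
  rw [add_sub_add_left_eq_sub] at h1
  have h2 := convex_univ.norm_image_sub_le_of_norm_hasFDerivWithin_le (C := K * ‖k‖)
    (f := fun z => fderiv ℝ g (z + k) - fderiv ℝ g z)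
    (f' := fun z => fderiv ℝ (fderiv ℝ g) (z + k) - fderiv ℝ (fderiv ℝ g) z)
    (fun z _ => (((hasFDerivAt_comp_add_right k).2 (hg.diff' (z + k)).hasFDerivAt).sub
      (hg.diff' z).hasFDerivAt).hasFDerivWithinAt)
    (fun z _ => by simpa using hg.lip (z + k) z) (mem_univ y) (mem_univ x)
  refine le_trans (le_of_eq ?_) (norm_add_le_of_le h1 h2)
  congr 1
  abel

/-- With `x` fixed, exchange `h` for `k` by the mean value inequality for `g - Dg(x)`. Then, with
common displacement, apply it along the segment from `0` to `k`, where the derivative is a second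
difference of `Dg`. -/
theorem taylor_sub_le (hg : HasLipschitzSecondDeriv K g) {x h y k : E} {r : ℝ} (hh : ‖h‖ ≤ r)
    (hk : ‖k‖ ≤ r) :
    ‖(g (x + h) - g x - fderiv ℝ g x h) - (g (y + k) - g y - fderiv ℝ g y k)‖
      ≤ K * r * ‖h - k‖ + K * r ^ 2 * ‖x - y‖ := by
  have hK := hg.nonneg
  have hr : 0 ≤ r := (norm_nonneg _).trans hh
  have h1 := (convex_closedBall x r).norm_image_sub_le_of_norm_fderiv_le' (φ := fderiv ℝ g x)
    (C := K * r) (x := x + k) (y := x + h) (fun z _ => hg.diff z) (fun z hz => by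
      refine (hg.fderiv_sub_le z x).trans ?_
      gcongr
      simpa [dist_eq_norm] using hz) (by simpa using hk) (by simpa using hh)
  rw [add_sub_add_left_eq_sub] at h1
  have h2 := (convex_closedBall (0 : E) r).norm_image_sub_le_of_norm_hasFDerivWithin_le
    (C := K * r * ‖x - y‖) (x := 0) (y := k)
    (f := fun z => g (x + z) - fderiv ℝ g x z - (g (y + z) - fderiv ℝ g y z))
    (f' := fun z => fderiv ℝ g (x + z) - fderiv ℝ g x - (fderiv ℝ g (y + z) - fderiv ℝ g y))
    (fun z _ => ((((hasFDerivAt_comp_add_left x).2 (hg.diff (x + z)).hasFDerivAt).sub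
      (fderiv ℝ g x).hasFDerivAt).sub (((hasFDerivAt_comp_add_left y).2 (hg.diff (y + z)).hasFDerivAt).sub
      (fderiv ℝ g y).hasFDerivAt)).hasFDerivWithinAt)
    (fun z hz => by
      refine (hg.fderiv_second_difference x z y z).trans ?_
      rw [sub_self, norm_zero, mul_zero, zero_add]
      gcongr
      simpa using hz) (by simpa using hr) (by simpa using hk)
  have e : (g (x + h) - g x - fderiv ℝ g x h) - (g (y + k) - g y - fderiv ℝ g y k)
      = (g (x + h) - g (x + k) - fderiv ℝ g x (h - k))
        + (g (x + k) - fderiv ℝ g x k - (g (y + k) - fderiv ℝ g y k)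
          - (g (x + 0) - fderiv ℝ g x 0 - (g (y + 0) - fderiv ℝ g y 0))) := by
    simp only [map_sub, map_zero, add_zero, sub_zero]
    abel
  rw [e]
  refine (norm_add_le_of_le h1 h2).trans ?_
  rw [sub_zero]
  have : K * r * ‖x - y‖ * ‖k‖ ≤ K * r * ‖x - y‖ * r := by gcongr
  nlinarith

end HasLipschitzSecondDeriv

theorem differentiable_iteratedFDeriv_fderiv {g : E → E'} {n : ℕ}
    (h : Differentiable ℝ (iteratedFDeriv ℝ (n + 1) g)) :
    Differentiable ℝ (iteratedFDeriv ℝ n (fderiv ℝ g)) := by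
  have e : iteratedFDeriv ℝ (n + 1) g = (continuousMultilinearCurryRightEquiv' ℝ n E E').symm ∘
      iteratedFDeriv ℝ n (fderiv ℝ g) := funext fun x => iteratedFDeriv_succ_eq_comp_right
  rw [e] at h
  exact ((continuousMultilinearCurryRightEquiv' ℝ n E E').symm.comp_differentiable_iff).1 h

theorem differentiable_of_iteratedFDeriv_zero {g : E → E'}
    (h : Differentiable ℝ (iteratedFDeriv ℝ 0 g)) : Differentiable ℝ g := by
  rwa [iteratedFDeriv_zero_eq_comp, LinearIsometryEquiv.comp_differentiable_iff] at h

theorem exists_hasLipschitzSecondDeriv {g : E → E'}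
    (hd : ∀ k < 3, Differentiable ℝ (iteratedFDeriv ℝ k g))
    (hb : ∀ k ∈ Icc 1 3, ∃ C : ℝ, ∀ x, ‖iteratedFDeriv ℝ k g x‖ ≤ C)
    (h0 : iteratedFDeriv ℝ 1 g 0 = 0) : ∃ K, HasLipschitzSecondDeriv K g := by
  obtain ⟨C₂, h₂⟩ := hb 2 (by simp)
  obtain ⟨C₃, h₃⟩ := hb 3 (by simp)
  have d2 : Differentiable ℝ (fderiv ℝ (fderiv ℝ g)) := differentiable_of_iteratedFDeriv_zero
    (differentiable_iteratedFDeriv_fderiv (differentiable_iteratedFDeriv_fderiv (hd 2 (by simp))))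
  have b2 : ∀ x, ‖fderiv ℝ (fderiv ℝ g) x‖ ≤ max C₂ C₃ := fun x => by
    rw [← norm_iteratedFDeriv_one, norm_iteratedFDeriv_fderiv]
    exact (h₂ x).trans (le_max_left _ _)
  refine ⟨max C₂ C₃, (norm_nonneg (fderiv ℝ (fderiv ℝ g) 0)).trans (b2 0), differentiable_of_iteratedFDeriv_zero
    (hd 0 (by simp)), differentiable_of_iteratedFDeriv_zero
    (differentiable_iteratedFDeriv_fderiv (hd 1 (by simp))), b2, fun x y => ?_, ?_⟩
  · refine convex_univ.norm_image_sub_le_of_norm_fderiv_le (𝕜 := ℝ) (G := E →L[ℝ] E →L[ℝ] E')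
      (f := fderiv ℝ (fderiv ℝ g)) (fun x _ => d2 x) (fun x _ => ?_)
      (mem_univ y) (mem_univ x)
    rw [← norm_iteratedFDeriv_one, norm_iteratedFDeriv_fderiv, norm_iteratedFDeriv_fderiv]
    exact (h₃ x).trans (le_max_right _ _)
  · rw [← norm_eq_zero, ← norm_iteratedFDeriv_one, h0, norm_zero]

end Calculus

variable {B : ℝ → Type*} [∀ a, NormedAddCommGroup (B a)] [∀ a, NormedSpace ℝ (B a)]
  {𝓑 : InterpolationScale B} {γ : ℝ}

theorem IsDiffusion.exists_const {α σ : ℝ} {G : ∀ a : ℝ, B a → B (a - σ)}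
    (hG : IsDiffusion 𝓑 α γ σ G) :
    ∃ K, HasLipschitzSecondDeriv K (G α) ∧ HasLipschitzSecondDeriv K (G (α - γ)) ∧
      HasLipschitzSecondDeriv K (G (α - 2 * γ)) := by
  have key : ∀ a ∈ ({α, α - γ, α - 2 * γ} : Set ℝ), ∃ K, HasLipschitzSecondDeriv K (G a) :=
    fun a ha => exists_hasLipschitzSecondDeriv (hG.differentiable a ha) (hG.bounded a ha)
      (hG.deriv_zero a ha 1 (by simp))
  obtain ⟨K₀, h₀⟩ := key α (by simp)
  obtain ⟨K₁, h₁⟩ := key (α - γ) (by simp)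
  obtain ⟨K₂, h₂⟩ := key (α - 2 * γ) (by simp)
  exact ⟨max K₀ (max K₁ K₂), h₀.mono (le_max_left _ _),
    h₁.mono ((le_max_left _ _).trans (le_max_right _ _)),
    h₂.mono ((le_max_right _ _).trans (le_max_right _ _))⟩

/-- Differentiating the compatibility of `G` with the inclusions. It allows the Hölder estimates to
be carried out entirely on the level `α - 2γ`. -/
theorem IsDiffusion.ι_fderiv {α σ : ℝ} {G : ∀ a : ℝ, B a → B (a - σ)}
    (hG : IsDiffusion 𝓑 α γ σ G) {a b : ℝ} (ha : a ∈ ({α, α - γ, α - 2 * γ} : Set ℝ))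
    (hb : b ∈ ({α, α - γ, α - 2 * γ} : Set ℝ)) (hab : a ≤ b) (x v : B b) :
    𝓑.ι (b - σ) (a - σ) (fderiv ℝ (G b) x v) = fderiv ℝ (G a) (𝓑.ι b a x) (𝓑.ι b a v) := by
  have da := differentiable_of_iteratedFDeriv_zero (hG.differentiable a ha 0 (by simp))
  have db := differentiable_of_iteratedFDeriv_zero (hG.differentiable b hb 0 (by simp))
  have h1 := (𝓑.ι (b - σ) (a - σ)).hasFDerivAt.comp x (db x).hasFDerivAt
  have h2 := (da (𝓑.ι b a x)).hasFDerivAt.comp x (𝓑.ι b a).hasFDerivAt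
  have e : 𝓑.ι (b - σ) (a - σ) ∘ G b = G a ∘ 𝓑.ι b a :=
    funext fun x => hG.compat a ha b hb hab x
  rw [e] at h1
  exact DFunLike.congr_fun (h1.unique h2) v

/-- Local Lipschitz estimate for the composition of controlled paths with `G`. -/
theorem IsDiffusion.exists_composition {α σ M : ℝ} {G : ∀ a : ℝ, B a → B (a - σ)}
    (hG : IsDiffusion 𝓑 α γ σ G) (hγ : 0 < γ) (hM : 0 ≤ M) :
    ∃ C : ℝ, 0 ≤ C ∧ ∀ X : RoughPath γ, X.IsBounded M → ∀ (U V : I → B α) (U' V' : I → B (α - γ))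
      (r d : ℝ), r ≤ 1 → IsCRP 𝓑 X α (α - γ) (α - 2 * γ) U U' r →
      IsCRP 𝓑 X α (α - γ) (α - 2 * γ) V V' r →
      IsCRP 𝓑 X α (α - γ) (α - 2 * γ) (fun t => U t - V t) (fun t => U' t - V' t) d →
      IsCRP 𝓑 X (α - σ) (α - γ - σ) (α - 2 * γ - σ) (fun t => G α (U t) - G α (V t))
        (fun t => fderiv ℝ (G (α - γ)) (𝓑.ι α (α - γ) (U t)) (U' t)
          - fderiv ℝ (G (α - γ)) (𝓑.ι α (α - γ) (V t)) (V' t)) (C * (r * d)) := by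
  obtain ⟨K, hK₀, hK₁, hK₂⟩ := hG.exists_const
  have hK := hK₀.nonneg
  have m0 : α ∈ ({α, α - γ, α - 2 * γ} : Set ℝ) := by simp
  have m1 : α - γ ∈ ({α, α - γ, α - 2 * γ} : Set ℝ) := by simp
  have m2 : α - 2 * γ ∈ ({α, α - γ, α - 2 * γ} : Set ℝ) := by simp
  set b := α - γ with hb
  set c := α - 2 * γ with hc
  have lb : b ≤ α := by linarith
  have lcb : c ≤ b := by linarith
  have lc : c ≤ α := by linarith
  obtain ⟨J, hJ1, j₀, j₁, j₂⟩ : ∃ J : ℝ, 1 ≤ J ∧ (∀ x, ‖𝓑.ι α b x‖ ≤ J * ‖x‖) ∧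
      (∀ x, ‖𝓑.ι α c x‖ ≤ J * ‖x‖) ∧ ∀ x, ‖𝓑.ι b c x‖ ≤ J * ‖x‖ := by
    obtain ⟨J₀, h₀, k₀⟩ := 𝓑.norm_ι_le α b
    obtain ⟨J₁, h₁, k₁⟩ := 𝓑.norm_ι_le α c
    obtain ⟨J₂, h₂, k₂⟩ := 𝓑.norm_ι_le b c
    refine ⟨1 + J₀ + J₁ + J₂, by linarith, fun x => (k₀ x).trans ?_, fun x => (k₁ x).trans ?_,
      fun x => (k₂ x).trans ?_⟩ <;> gcongr <;> linarith
  have hJ : 0 ≤ J := by linarith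
  -- Bound for the `γ`-Hölder seminorm on the level `α - 2γ`, relative to the controlled size: `1`
  -- from the remainder, `M * J` from the term with `W`.
  set L := 1 + M * J with hL
  have hL0 : 0 ≤ L := by positivity
  set C₁ := K * (2 * J + 2 * (L * J) + L * J ^ 2) with hC₁
  set C₂ := K * (L ^ 2 + L ^ 2 * J + 2 * J) with hC₂
  have hC₁0 : 0 ≤ C₁ := by positivity
  have hC₂0 : 0 ≤ C₂ := by positivity
  refine ⟨K + 2 * K * J + C₁ + C₂, by positivity, fun X hX U V U' V' r d hr hU hV hd => ?_⟩
  have hr0 := hU.nonneg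
  have hd0 := hd.nonneg
  have hrd : 0 ≤ r * d := by positivity
  have incr : ∀ (P : I → B α) (P' : I → B b) (N : ℝ), IsCRP 𝓑 X α b c P P' N → ∀ s t : I,
      s ≤ t → ‖𝓑.ι α c (P t) - 𝓑.ι α c (P s)‖ ≤ L * N * ((t : ℝ) - s) ^ γ := by
    intro P P' N h s t hst
    have hh := sub_mem_Icc hst
    have hN := h.nonneg
    have hp : 0 ≤ ((t : ℝ) - s) ^ γ := Real.rpow_nonneg hh.1 _
    have n1 : ‖(X.W t - X.W s) • 𝓑.ι b c (P' s)‖ ≤ M * J * N * ((t : ℝ) - s) ^ γ := by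
      rw [norm_smul]
      calc _ ≤ (M * ((t : ℝ) - s) ^ γ) * (J * N) :=
            mul_le_mul (hX.W_le s t hst)
              ((j₂ _).trans (mul_le_mul_of_nonneg_left (h.bound' s) hJ)) (norm_nonneg _)
              (by positivity)
        _ = _ := by ring
    have n2 := h.rem s t hst
    have n3 := norm_add_le_of_le n2 n1
    rw [sub_add_cancel] at n3
    have := rpow_anti hh hγ.le (show γ ≤ 2 * γ by linarith)
    refine n3.trans ?_
    have : N * ((t : ℝ) - s) ^ (2 * γ) ≤ N * ((t : ℝ) - s) ^ γ := by gcongr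
    rw [hL]
    linarith
  have bd : ∀ (P : I → B α) (P' : I → B b) (N : ℝ), IsCRP 𝓑 X α b c P P' N → ∀ t,
      ‖𝓑.ι α c (P t)‖ ≤ J * N := fun P P' N h t =>
    (j₁ _).trans (mul_le_mul_of_nonneg_left (h.bound t) hJ)
  have bd' : ∀ (P : I → B α) (P' : I → B b) (N : ℝ), IsCRP 𝓑 X α b c P P' N → ∀ t,
      ‖𝓑.ι b c (P' t)‖ ≤ J * N := fun P P' N h t =>
    (j₂ _).trans (mul_le_mul_of_nonneg_left (h.bound' t) hJ)
  constructor
  · intro t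
    calc _ ≤ K * r * ‖U t - V t‖ := hK₀.sub_le (hU.bound t) (hV.bound t)
      _ ≤ K * r * d := by gcongr; exact hd.bound t
      _ = K * (r * d) := by ring
      _ ≤ _ := by
        refine mul_le_mul_of_nonneg_right ?_ hrd
        have : 0 ≤ 2 * K * J := by positivity
        linarith
  · intro t
    have e : fderiv ℝ (G b) (𝓑.ι α b (U t)) (U' t) - fderiv ℝ (G b) (𝓑.ι α b (V t)) (V' t)
        = fderiv ℝ (G b) (𝓑.ι α b (U t)) (U' t - V' t)
          + (fderiv ℝ (G b) (𝓑.ι α b (U t)) - fderiv ℝ (G b) (𝓑.ι α b (V t))) (V' t) := by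
      rw [map_sub, _root_.sub_apply]; abel
    rw [e]
    have n1 : ‖fderiv ℝ (G b) (𝓑.ι α b (U t))‖ ≤ K * (J * r) :=
      (hK₁.fderiv_le _).trans (mul_le_mul_of_nonneg_left
        ((j₀ _).trans (mul_le_mul_of_nonneg_left (hU.bound t) hJ)) hK)
    have n2 : ‖fderiv ℝ (G b) (𝓑.ι α b (U t)) - fderiv ℝ (G b) (𝓑.ι α b (V t))‖ ≤ K * (J * d) := by
      refine (hK₁.fderiv_sub_le _ _).trans (mul_le_mul_of_nonneg_left ?_ hK)
      rw [← map_sub]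
      exact (j₀ _).trans (mul_le_mul_of_nonneg_left (hd.bound t) hJ)
    calc _ ≤ K * (J * r) * d + K * (J * d) * r :=
          norm_add_le_of_le (ContinuousLinearMap.le_of_opNorm_le_of_le _ n1 (hd.bound' t))
            (ContinuousLinearMap.le_of_opNorm_le_of_le _ n2 (hV.bound' t))
      _ = 2 * K * J * (r * d) := by ring
      _ ≤ _ := mul_le_mul_of_nonneg_right (by linarith) hrd
  · intro s t hst
    have hp : 0 ≤ ((t : ℝ) - s) ^ γ := Real.rpow_nonneg (sub_mem_Icc hst).1 _
    have a1 := hd.incr s t hst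
    have a2 := hV.incr s t hst
    have a3 := incr _ _ _ hU s t hst
    have a4 := incr _ _ _ hV s t hst
    have a5 := incr _ _ _ hd s t hst
    have a6 := bd _ _ _ hU t
    have a7 := bd _ _ _ hd t
    have a8 := bd _ _ _ hd s
    have a9 := bd' _ _ _ hd s
    have a10 := bd' _ _ _ hV s
    simp only [map_sub, hG.ι_fderiv m2 m1 lcb, 𝓑.ι_comp lcb lb] at a1 a2 a3 a4 a5 a6 a7 a8 a9 a10 ⊢
    set q := ((t : ℝ) - s) ^ γ with hq
    generalize 𝓑.ι α c (U t) = ut at *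
    generalize 𝓑.ι α c (U s) = us at *
    generalize 𝓑.ι α c (V t) = vt at *
    generalize 𝓑.ι α c (V s) = vs at *
    generalize 𝓑.ι b c (U' t) = ut' at *
    generalize 𝓑.ι b c (U' s) = us' at *
    generalize 𝓑.ι b c (V' t) = vt' at *
    generalize 𝓑.ι b c (V' s) = vs' at *
    have n1 : ‖fderiv ℝ (G c) ut ((ut' - vt') - (us' - vs'))‖ ≤ K * (J * r) * (d * q) :=
      ContinuousLinearMap.le_of_opNorm_le_of_le _
        ((hK₂.fderiv_le _).trans (mul_le_mul_of_nonneg_left a6 hK)) a1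
    have n2 : ‖(fderiv ℝ (G c) ut - fderiv ℝ (G c) vt) (vt' - vs')‖ ≤ K * (J * d) * (r * q) :=
      ContinuousLinearMap.le_of_opNorm_le_of_le _
        ((hK₂.fderiv_sub_le _ _).trans (mul_le_mul_of_nonneg_left a7 hK)) a2
    have n3 : ‖(fderiv ℝ (G c) ut - fderiv ℝ (G c) us) (us' - vs')‖
        ≤ K * (L * r * q) * (J * d) :=
      ContinuousLinearMap.le_of_opNorm_le_of_le _
        ((hK₂.fderiv_sub_le _ _).trans (mul_le_mul_of_nonneg_left a3 hK)) a9
    have n4 : ‖(fderiv ℝ (G c) ut - fderiv ℝ (G c) us - (fderiv ℝ (G c) vt - fderiv ℝ (G c) vs))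
        vs'‖ ≤ (K * (L * d * q) + K * (L * r * q) * (J * d)) * (J * r) := by
      refine ContinuousLinearMap.le_of_opNorm_le_of_le _ ?_ a10
      have := hK₂.fderiv_second_difference us (ut - us) vs (vt - vs)
      rw [add_sub_cancel, add_sub_cancel] at this
      refine this.trans ?_
      rw [sub_sub_sub_comm]
      gcongr
    -- A product rule for the double difference, over times and over the two paths. Each term
    -- contains one factor of size `d` and at least one of size `r`; surplus powers of `r` are
    -- absorbed by `r ≤ 1`.
    have e : fderiv ℝ (G c) ut ut' - fderiv ℝ (G c) vt vt'
          - (fderiv ℝ (G c) us us' - fderiv ℝ (G c) vs vs')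
        = fderiv ℝ (G c) ut ((ut' - vt') - (us' - vs'))
          + (fderiv ℝ (G c) ut - fderiv ℝ (G c) vt) (vt' - vs')
          + (fderiv ℝ (G c) ut - fderiv ℝ (G c) us) (us' - vs')
          + (fderiv ℝ (G c) ut - fderiv ℝ (G c) us - (fderiv ℝ (G c) vt - fderiv ℝ (G c) vs))
            vs' := by
      simp only [map_sub, _root_.sub_apply]
      abel
    rw [e]
    have hrr : r * r ≤ r := mul_le_of_le_one_left hr0 hr
    calc _ ≤ K * (J * r) * (d * q) + K * (J * d) * (r * q) + K * (L * r * q) * (J * d)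
          + (K * (L * d * q) + K * (L * r * q) * (J * d)) * (J * r) :=
          norm_add_le_of_le (norm_add_le_of_le (norm_add_le_of_le n1 n2) n3) n4
      _ = K * (2 * J + 2 * (L * J)) * (r * d) * q + K * (L * J ^ 2) * ((r * r) * d) * q := by ring
      _ ≤ K * (2 * J + 2 * (L * J)) * (r * d) * q + K * (L * J ^ 2) * (r * d) * q := by gcongr
      _ = C₁ * (r * d) * q := by rw [hC₁]; ring
      _ ≤ _ := by
        refine mul_le_mul_of_nonneg_right (mul_le_mul_of_nonneg_right ?_ hrd) hp
        have : 0 ≤ K + 2 * K * J := by positivity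
        linarith
  · intro s t hst
    have hh := sub_mem_Icc hst
    have hp : 0 ≤ ((t : ℝ) - s) ^ γ := Real.rpow_nonneg hh.1 _
    have e2 : ((t : ℝ) - s) ^ (2 * γ) = ((t : ℝ) - s) ^ γ * ((t : ℝ) - s) ^ γ := by
      rw [← Real.rpow_add_of_nonneg hh.1 hγ.le hγ.le, two_mul]
    have a1 := hd.rem s t hst
    have a2 := hV.rem s t hst
    have a3 := incr _ _ _ hU s t hst
    have a4 := incr _ _ _ hV s t hst
    have a5 := incr _ _ _ hd s t hst
    have a6 := bd _ _ _ hU s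
    have a8 := bd _ _ _ hd s
    simp only [map_sub, hG.ι_fderiv m2 m1 lcb, 𝓑.ι_comp lcb lb, hG.compat c m2 α m0 lc, e2]
      at a1 a2 a3 a4 a5 a6 a8 ⊢
    set q := ((t : ℝ) - s) ^ γ with hq
    set w := X.W t - X.W s with hw
    generalize 𝓑.ι α c (U t) = ut at *
    generalize 𝓑.ι α c (U s) = us at *
    generalize 𝓑.ι α c (V t) = vt at *
    generalize 𝓑.ι α c (V s) = vs at *
    generalize 𝓑.ι b c (U' s) = us' at *
    generalize 𝓑.ι b c (V' s) = vs' at *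
    have n1 := hK₂.taylor_sub_le (x := us) (y := vs) a3 a4
    rw [add_sub_cancel, add_sub_cancel] at n1
    have n1' : ‖(G c ut - G c us - fderiv ℝ (G c) us (ut - us))
        - (G c vt - G c vs - fderiv ℝ (G c) vs (vt - vs))‖
        ≤ K * (L * r * q) * (L * d * q) + K * (L * r * q) ^ 2 * (J * d) := by
      refine n1.trans ?_
      rw [sub_sub_sub_comm]
      gcongr
    have n2 : ‖fderiv ℝ (G c) us (ut - vt - (us - vs) - w • (us' - vs'))‖
        ≤ K * (J * r) * (d * (q * q)) :=
      ContinuousLinearMap.le_of_opNorm_le_of_le _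
        ((hK₂.fderiv_le _).trans (mul_le_mul_of_nonneg_left a6 hK)) a1
    have n3 : ‖(fderiv ℝ (G c) us - fderiv ℝ (G c) vs) (vt - vs - w • vs')‖
        ≤ K * (J * d) * (r * (q * q)) :=
      ContinuousLinearMap.le_of_opNorm_le_of_le _
        ((hK₂.fderiv_sub_le _ _).trans (mul_le_mul_of_nonneg_left a8 hK)) a2
    -- Splits the remainder into the difference of the Taylor remainders, the linearisation applied
    -- to the remainder of `U - V`, and the change of the linearisation applied to the remainder of
    -- `V`.
    have e : G c ut - G c vt - (G c us - G c vs)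
          - w • (fderiv ℝ (G c) us us' - fderiv ℝ (G c) vs vs')
        = ((G c ut - G c us - fderiv ℝ (G c) us (ut - us))
            - (G c vt - G c vs - fderiv ℝ (G c) vs (vt - vs)))
          + fderiv ℝ (G c) us (ut - vt - (us - vs) - w • (us' - vs'))
          + (fderiv ℝ (G c) us - fderiv ℝ (G c) vs) (vt - vs - w • vs') := by
      simp only [map_sub, map_smul, _root_.sub_apply]
      module
    rw [e]
    have hrr : r * r ≤ r := mul_le_of_le_one_left hr0 hr
    calc _ ≤ K * (L * r * q) * (L * d * q) + K * (L * r * q) ^ 2 * (J * d)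
          + K * (J * r) * (d * (q * q)) + K * (J * d) * (r * (q * q)) :=
          norm_add_le_of_le (norm_add_le_of_le n1' n2) n3
      _ = K * (L ^ 2 + 2 * J) * (r * d) * (q * q)
          + K * (L ^ 2 * J) * ((r * r) * d) * (q * q) := by ring
      _ ≤ K * (L ^ 2 + 2 * J) * (r * d) * (q * q)
          + K * (L ^ 2 * J) * (r * d) * (q * q) := by gcongr
      _ = C₂ * (r * d) * (q * q) := by rw [hC₂]; ring
      _ ≤ _ := by
        refine mul_le_mul_of_nonneg_right (mul_le_mul_of_nonneg_right ?_ hrd) (by positivity)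
        have : 0 ≤ K + 2 * K * J := by positivity
        linarith

end

/-! ### A contraction principle for gauges. -/

section

/-- A contraction principle for an extended gauge `Q` (`Q N x` means that the gauge of `x` is at
most `N`) which dominates the norm and has closed sublevel sets. -/
theorem existsUnique_fixedPoint_of_gauge {E : Type*} [NormedAddCommGroup E] [CompleteSpace E]
    {Q : ℝ → E → Prop} (hnorm : ∀ N x, Q N x → ‖x‖ ≤ N) (hzero : Q 0 0)
    (hadd : ∀ N N' x y, Q N x → Q N' y → Q (N + N') (x + y)) (hneg : ∀ N x, Q N x → Q N (-x))
    (hmono : ∀ N N' x, N ≤ N' → Q N x → Q N' x) (hclosed : ∀ N, IsClosed {x | Q N x})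
    {Φ : E → E} (hΦ : ∀ p, (∃ N, Q N p) → ∃ N, Q N (Φ p))
    (hcontr : ∀ p q, (∃ N, Q N p) → (∃ N, Q N q) → ∀ N, Q N (p - q) → Q (N / 2) (Φ p - Φ q)) :
    ∃! p, (∃ N, Q N p) ∧ Φ p = p := by
  have hsub : ∀ N N' x y, Q N x → Q N' y → Q (N + N') (x - y) := fun N N' x y hx hy => by
    rw [sub_eq_add_neg]; exact hadd _ _ _ _ hx (hneg _ _ hy)
  let x : ℕ → E := fun n => Φ^[n] 0
  have hxs : ∀ n, x (n + 1) = Φ (x n) := fun n => Function.iterate_succ_apply' Φ n 0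
  have hxD : ∀ n, ∃ N, Q N (x n) := by
    intro n
    induction n with
    | zero => exact ⟨0, hzero⟩
    | succ n ih => rw [hxs]; exact hΦ _ ih
  obtain ⟨N, hN⟩ : ∃ N, Q N (x 1 - x 0) := by
    obtain ⟨N, hN⟩ := hxD 1
    obtain ⟨N', hN'⟩ := hxD 0
    exact ⟨_, hsub _ _ _ _ hN hN'⟩
  have hN0 : 0 ≤ N := (norm_nonneg _).trans (hnorm _ _ hN)
  have hstep : ∀ n, Q (N / 2 ^ n) (x (n + 1) - x n) := by
    intro n
    induction n with
    | zero => simpa using hN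
    | succ n ih =>
      have h := hcontr _ _ (hxD _) (hxD _) _ ih
      rwa [div_div, ← pow_succ, ← hxs, ← hxs] at h
  have hcauchy : CauchySeq x := cauchySeq_of_le_geometric_two (C := 2 * N) (fun n => by
    rw [dist_comm, dist_eq_norm, mul_div_cancel_left₀ _ two_ne_zero]
    exact hnorm _ _ (hstep n))
  obtain ⟨p, hp⟩ := cauchySeq_tendsto_of_complete hcauchy
  -- Keeping the partial geometric sum as a difference of tails lets the induction on `k` close
  -- exactly.
  have hfar : ∀ n k, Q (2 * N / 2 ^ n - 2 * N / 2 ^ (n + k)) (x (n + k) - x n) := by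
    intro n k
    induction k with
    | zero => simpa using hzero
    | succ k ih =>
      have h := hadd _ _ _ _ (hstep (n + k)) ih
      rw [sub_add_sub_cancel] at h
      rw [← add_assoc]
      convert h using 1
      rw [pow_succ]
      field_simp
      ring
  -- Convergence is known only in the ambient norm; closedness of the sublevel sets transfers the
  -- gauge bound to the limit.
  have hlim : ∀ n, Q (2 * N / 2 ^ n) (p - x n) := by
    intro n
    have h1 : Tendsto (fun k => x (n + k) - x n) atTop (𝓝 (p - x n)) := by
      have := (tendsto_add_atTop_iff_nat n).2 hp
      simp only [add_comm _ n] at this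
      exact this.sub_const _
    refine (hclosed _).mem_of_tendsto h1 (Eventually.of_forall fun k => ?_)
    refine hmono _ _ _ ?_ (hfar n k)
    have : 0 ≤ 2 * N / 2 ^ (n + k) := by positivity
    linarith
  have hpD : ∃ N, Q N p := by
    obtain ⟨N', hN'⟩ := hxD 0
    have := hadd _ _ _ _ (hlim 0) hN'
    rw [sub_add_cancel] at this
    exact ⟨_, this⟩
  have hgeo : ∀ a : ℝ, Tendsto (fun n : ℕ => a / 2 ^ n) atTop (𝓝 0) := fun a => by
    have := (tendsto_pow_atTop_nhds_zero_of_lt_one (by norm_num : (0 : ℝ) ≤ 1 / 2)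
      (by norm_num)).const_mul a
    rw [mul_zero] at this
    refine this.congr fun n => ?_
    rw [one_div, inv_pow, div_eq_mul_inv]
  have hΦp : Φ p = p := by
    have h1 : Tendsto (fun n => Φ p - x (n + 1)) atTop (𝓝 0) := by
      refine squeeze_zero_norm (fun n => ?_) (hgeo N)
      have h := hnorm _ _ (hcontr _ _ hpD (hxD n) _ (hlim n))
      rw [← hxs] at h
      refine h.trans (le_of_eq ?_)
      ring
    have h2 := (tendsto_const_nhds (x := Φ p)).sub ((tendsto_add_atTop_iff_nat 1).2 hp)
    exact sub_eq_zero.1 (tendsto_nhds_unique h2 h1)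
  refine ⟨p, ⟨hpD, hΦp⟩, ?_⟩
  rintro q ⟨⟨Nq, hNq⟩, hq⟩
  obtain ⟨Np, hNp⟩ := hpD
  have h : ∀ n : ℕ, Q ((Nq + Np) / 2 ^ n) (q - p) := by
    intro n
    induction n with
    | zero => simpa using hsub _ _ _ _ hNq hNp
    | succ n ih =>
      have := hcontr _ _ ⟨Nq, hNq⟩ ⟨Np, hNp⟩ _ ih
      rwa [hq, hΦp, div_div, ← pow_succ] at this
  have h3 := ge_of_tendsto (hgeo (Nq + Np)) (Eventually.of_forall fun n => hnorm _ _ (h n))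
  exact sub_eq_zero.1 (norm_le_zero_iff.1 h3)

/-! ### Algebra of controlled norms and the truncation. -/

variable {B : ℝ → Type*} [∀ a, NormedAddCommGroup (B a)] [∀ a, NormedSpace ℝ (B a)]
  {𝓑 : InterpolationScale B} {γ : ℝ} {X : RoughPath γ}

section CRP

variable {b₀ b₁ b₂ : ℝ} {U V : I → B b₀} {U' V' : I → B b₁} {N N' : ℝ}

theorem IsCRP.mono (h : IsCRP 𝓑 X b₀ b₁ b₂ U U' N) (hN : N ≤ N') :
    IsCRP 𝓑 X b₀ b₁ b₂ U U' N' := by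
  refine ⟨fun t => (h.bound t).trans hN, fun t => (h.bound' t).trans hN, fun s t hst => ?_,
    fun s t hst => ?_⟩
  · exact (h.incr s t hst).trans
      (mul_le_mul_of_nonneg_right hN (Real.rpow_nonneg (sub_mem_Icc hst).1 _))
  · exact (h.rem s t hst).trans
      (mul_le_mul_of_nonneg_right hN (Real.rpow_nonneg (sub_mem_Icc hst).1 _))

theorem IsCRP.add (h : IsCRP 𝓑 X b₀ b₁ b₂ U U' N) (h' : IsCRP 𝓑 X b₀ b₁ b₂ V V' N') :
    IsCRP 𝓑 X b₀ b₁ b₂ (fun t => U t + V t) (fun t => U' t + V' t) (N + N') := by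
  refine ⟨fun t => norm_add_le_of_le (h.bound t) (h'.bound t),
    fun t => norm_add_le_of_le (h.bound' t) (h'.bound' t), fun s t hst => ?_, fun s t hst => ?_⟩
  · rw [add_mul]
    refine le_trans (le_of_eq ?_) (norm_add_le_of_le (h.incr s t hst) (h'.incr s t hst))
    congr 1
    simp only [map_add]
    abel
  · rw [add_mul]
    refine le_trans (le_of_eq ?_) (norm_add_le_of_le (h.rem s t hst) (h'.rem s t hst))
    congr 1
    simp only [map_add]
    module

theorem IsCRP.smul (h : IsCRP 𝓑 X b₀ b₁ b₂ U U' N) (c : ℝ) :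
    IsCRP 𝓑 X b₀ b₁ b₂ (fun t => c • U t) (fun t => c • U' t) (|c| * N) := by
  have key : ∀ {F : Type _} [NormedAddCommGroup F] [NormedSpace ℝ F] {x : F} {K : ℝ},
      ‖x‖ ≤ K → ‖c • x‖ ≤ |c| * K := fun hx => by
    rw [norm_smul, Real.norm_eq_abs]; gcongr
  refine ⟨fun t => ?_, fun t => ?_, fun s t hst => ?_, fun s t hst => ?_⟩
  · rw [norm_smul, Real.norm_eq_abs]
    exact mul_le_mul_of_nonneg_left (h.bound t) (abs_nonneg c)
  · rw [norm_smul, Real.norm_eq_abs]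
    exact mul_le_mul_of_nonneg_left (h.bound' t) (abs_nonneg c)
  · rw [mul_assoc]
    refine le_trans (le_of_eq ?_) (key (h.incr s t hst))
    simp only [map_smul, smul_sub]
  · rw [mul_assoc]
    refine le_trans (le_of_eq ?_) (key (h.rem s t hst))
    congr 1
    simp only [map_smul]
    module

theorem IsCRP.zero (hN : 0 ≤ N) :
    IsCRP 𝓑 X b₀ b₁ b₂ (fun _ => 0) (fun _ => 0) N := by
  refine ⟨fun t => by simpa, fun t => by simpa, fun s t hst => ?_, fun s t hst => ?_⟩
  · have := Real.rpow_nonneg (sub_mem_Icc hst).1 γ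
    simp only [map_zero, sub_zero, norm_zero]
    positivity
  · have := Real.rpow_nonneg (sub_mem_Icc hst).1 (2 * γ)
    simp only [map_zero, sub_zero, norm_zero, smul_zero]
    positivity

end CRP

section Norm

variable {α : ℝ} {p q : PathPair B α γ}

theorem norm_le_holder_toReal {E : Type*} [NormedAddCommGroup E] {θ : ℝ} {Ξ : I → I → E}
    (h : holder θ Ξ < ∞) (hΞ : ∀ s, Ξ s s = 0) {s t : I} (hst : s ≤ t) :
    ‖Ξ s t‖ ≤ (holder θ Ξ).toReal * ((t : ℝ) - s) ^ θ := by
  rcases hst.eq_or_lt with rfl | hlt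
  · rw [hΞ, norm_zero]
    exact mul_nonneg ENNReal.toReal_nonneg (Real.rpow_nonneg (by rw [sub_self]) _)
  · exact norm_le_of_holder_lt_top h hlt

theorem holder_toReal_le {E : Type*} [NormedAddCommGroup E] {θ c : ℝ} {Ξ : I → I → E} (hc : 0 ≤ c)
    (h : ∀ s t : I, s < t → ‖Ξ s t‖ ≤ c * ((t : ℝ) - s) ^ θ) : (holder θ Ξ).toReal ≤ c :=
  ENNReal.toReal_le_of_le_ofReal hc (holder_le_of_norm_le h)

theorem derivIncrement_self (s : I) : derivIncrement 𝓑 α γ p s s = 0 := sub_self _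

theorem remainder_self (a : ℝ) (s : I) : remainder 𝓑 α X p a s s = 0 := by
  simp [remainder]

theorem gubNorm_nonneg : 0 ≤ gubNorm 𝓑 α X p := by
  unfold gubNorm; positivity

theorem isCRP_gubNorm (hp : p ∈ controlled 𝓑 α X) :
    IsCRP 𝓑 X α (α - γ) (α - 2 * γ) p.1 p.2 (gubNorm 𝓑 α X p) := by
  have h3 : 0 ≤ (holder γ (derivIncrement 𝓑 α γ p)).toReal := ENNReal.toReal_nonneg
  have h4 : 0 ≤ (holder (2 * γ) (remainder 𝓑 α X p (α - 2 * γ))).toReal := ENNReal.toReal_nonneg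
  have h1 := norm_nonneg p.1
  have h2 := norm_nonneg p.2
  refine ⟨fun t => (p.1.norm_coe_le_norm t).trans ?_, fun t => (p.2.norm_coe_le_norm t).trans ?_,
    fun s t hst => (norm_le_holder_toReal hp.1 derivIncrement_self hst).trans ?_,
    fun s t hst => (norm_le_holder_toReal hp.2.2 (remainder_self _) hst).trans ?_⟩
  · unfold gubNorm; linarith
  · unfold gubNorm; linarith
  · refine mul_le_mul_of_nonneg_right ?_ (Real.rpow_nonneg (sub_mem_Icc hst).1 _)
    unfold gubNorm; linarith
  · refine mul_le_mul_of_nonneg_right ?_ (Real.rpow_nonneg (sub_mem_Icc hst).1 _)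
    unfold gubNorm; linarith

/-- The predicate is of maximum type and the norm is a sum of four terms; the factor `4` reappears
in the choice of constants for the contraction. -/
theorem IsCRP.gubNorm_le {N : ℝ} (h : IsCRP 𝓑 X α (α - γ) (α - 2 * γ) p.1 p.2 N) :
    gubNorm 𝓑 α X p ≤ 4 * N := by
  have hN := h.nonneg
  have h1 : ‖p.1‖ ≤ N := (ContinuousMap.norm_le _ hN).2 h.bound
  have h2 : ‖p.2‖ ≤ N := (ContinuousMap.norm_le _ hN).2 h.bound'
  have h3 : (holder γ (derivIncrement 𝓑 α γ p)).toReal ≤ N :=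
    holder_toReal_le hN fun s t hst => h.incr s t hst.le
  have h4 : (holder (2 * γ) (remainder 𝓑 α X p (α - 2 * γ))).toReal ≤ N :=
    holder_toReal_le hN fun s t hst => h.rem s t hst.le
  unfold gubNorm
  linarith

/-- The `γ`-Hölder bound for the remainder on the level `α - γ`, which is not part of the norm, is
supplied by `exists_rem_intermediate`. -/
theorem IsCRP.mem_controlled [∀ a, CompleteSpace (B a)] (𝓢 : ParabolicSemigroup 𝓑) {N M : ℝ}
    (hγ0 : 0 < γ) (hγ1 : γ ≤ 1 / 2) (hX : X.IsBounded M)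
    (h : IsCRP 𝓑 X α (α - γ) (α - 2 * γ) p.1 p.2 N) : p ∈ controlled 𝓑 α X := by
  obtain ⟨C, hC, k⟩ := 𝓢.exists_rem_intermediate (γ := γ) (b₀ := α) (b₁ := α - γ)
    (b₂ := α - 2 * γ) (c := α - γ) hX.nonneg hγ0 (by linarith) (by linarith) le_rfl (by linarith)
    (by linarith) (by linarith) (by linarith) (by linarith)
  refine ⟨(holder_le_of_norm_le fun s t hst => h.incr s t hst.le).trans_lt ENNReal.ofReal_lt_top,
    (holder_le_of_norm_le (c := C * N) fun s t hst => ?_).trans_lt ENNReal.ofReal_lt_top,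
    (holder_le_of_norm_le fun s t hst => h.rem s t hst.le).trans_lt ENNReal.ofReal_lt_top⟩
  exact k X hX _ _ N h s t hst.le

theorem gubNorm_add_le (hp : p ∈ controlled 𝓑 α X) (hq : q ∈ controlled 𝓑 α X) :
    gubNorm 𝓑 α X (p + q) ≤ gubNorm 𝓑 α X p + gubNorm 𝓑 α X q := by
  have h1 : ‖(p + q).1‖ ≤ ‖p.1‖ + ‖q.1‖ := norm_add_le _ _
  have h2 : ‖(p + q).2‖ ≤ ‖p.2‖ + ‖q.2‖ := norm_add_le _ _
  have h3 : (holder γ (derivIncrement 𝓑 α γ (p + q))).toReal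
      ≤ (holder γ (derivIncrement 𝓑 α γ p)).toReal
        + (holder γ (derivIncrement 𝓑 α γ q)).toReal := by
    refine holder_toReal_le (by positivity) fun s t hst => ?_
    rw [add_mul]
    refine le_trans (le_of_eq ?_) (norm_add_le_of_le (norm_le_of_holder_lt_top hp.1 hst)
      (norm_le_of_holder_lt_top hq.1 hst))
    congr 1
    simp only [derivIncrement, Prod.snd_add, ContinuousMap.add_apply, map_add]
    abel
  have h4 : (holder (2 * γ) (remainder 𝓑 α X (p + q) (α - 2 * γ))).toReal
      ≤ (holder (2 * γ) (remainder 𝓑 α X p (α - 2 * γ))).toReal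
        + (holder (2 * γ) (remainder 𝓑 α X q (α - 2 * γ))).toReal := by
    refine holder_toReal_le (by positivity) fun s t hst => ?_
    rw [add_mul]
    refine le_trans (le_of_eq ?_) (norm_add_le_of_le (norm_le_of_holder_lt_top hp.2.2 hst)
      (norm_le_of_holder_lt_top hq.2.2 hst))
    congr 1
    simp only [remainder, Prod.fst_add, Prod.snd_add, ContinuousMap.add_apply, map_add]
    module
  unfold gubNorm
  linarith

theorem gubNorm_smul_le (hp : p ∈ controlled 𝓑 α X) (c : ℝ) :
    gubNorm 𝓑 α X (c • p) ≤ |c| * gubNorm 𝓑 α X p := by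
  have h1 : ‖(c • p).1‖ ≤ |c| * ‖p.1‖ := by
    rw [Prod.smul_fst, norm_smul, Real.norm_eq_abs]
  have h2 : ‖(c • p).2‖ ≤ |c| * ‖p.2‖ := by
    rw [Prod.smul_snd, norm_smul, Real.norm_eq_abs]
  have h3 : (holder γ (derivIncrement 𝓑 α γ (c • p))).toReal
      ≤ |c| * (holder γ (derivIncrement 𝓑 α γ p)).toReal := by
    refine holder_toReal_le (by positivity) fun s t hst => ?_
    rw [mul_assoc]
    refine le_trans (le_of_eq ?_)
      (mul_le_mul_of_nonneg_left (norm_le_of_holder_lt_top hp.1 hst) (abs_nonneg c))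
    rw [← Real.norm_eq_abs, ← norm_smul]
    congr 1
    simp only [derivIncrement, Prod.smul_snd, ContinuousMap.smul_apply, map_smul, smul_sub]
  have h4 : (holder (2 * γ) (remainder 𝓑 α X (c • p) (α - 2 * γ))).toReal
      ≤ |c| * (holder (2 * γ) (remainder 𝓑 α X p (α - 2 * γ))).toReal := by
    refine holder_toReal_le (by positivity) fun s t hst => ?_
    rw [mul_assoc]
    refine le_trans (le_of_eq ?_)
      (mul_le_mul_of_nonneg_left (norm_le_of_holder_lt_top hp.2.2 hst) (abs_nonneg c))
    rw [← Real.norm_eq_abs, ← norm_smul]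
    congr 1
    simp only [remainder, Prod.smul_fst, Prod.smul_snd, ContinuousMap.smul_apply, map_smul]
    module
  unfold gubNorm
  linarith

/-- The function is constant beyond `1`, so its Lipschitz constant on the compact interval `[0,1]`
is global. -/
theorem IsCutoff.exists_lipschitz {f : ℝ → ℝ} (hf : IsCutoff f) :
    ∃ L : ℝ, 0 ≤ L ∧ ∀ x y, 0 ≤ x → 0 ≤ y → |f x - f y| ≤ L * |x - y| := by
  obtain ⟨L, hL⟩ := (hf.smooth.mono Icc_subset_Ici_self).exists_lipschitzOnWith (s := Icc 0 1)
    (by norm_num) (convex_Icc 0 1) isCompact_Icc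
  refine ⟨L, L.2, fun x y hx hy => ?_⟩
  have e : ∀ x, f (min x 1) = f x := fun x => by
    rcases le_total x 1 with h | h
    · rw [min_eq_left h]
    · rw [min_eq_right h, hf.eq_zero x h, hf.eq_zero 1 le_rfl]
  have h := hL.dist_le_mul (min x 1) ⟨le_min hx zero_le_one, min_le_right _ _⟩ (min y 1)
    ⟨le_min hy zero_le_one, min_le_right _ _⟩
  rw [e, e, Real.dist_eq, Real.dist_eq] at h
  refine h.trans (mul_le_mul_of_nonneg_left ?_ L.2)
  have := abs_min_sub_min_le_max x 1 y 1
  rwa [sub_self, abs_zero, max_eq_left (abs_nonneg _)] at this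

variable {f : ℝ → ℝ} {R : ℝ}

theorem gubNorm_truncate_le (hf : IsCutoff f) (hR : 0 < R) (hp : p ∈ controlled 𝓑 α X) :
    gubNorm 𝓑 α X (truncate 𝓑 α X f R p) ≤ R := by
  have hn : 0 ≤ gubNorm 𝓑 α X p := gubNorm_nonneg
  have hf0 := hf.range (gubNorm 𝓑 α X p / R) (by positivity)
  refine (gubNorm_smul_le hp _).trans ?_
  rw [abs_of_nonneg hf0.1]
  rcases le_total (gubNorm 𝓑 α X p) R with h | h
  · exact (mul_le_of_le_one_left hn hf0.2).trans h
  · rw [hf.eq_zero _ ((one_le_div hR).2 h), zero_mul]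
    exact hR.le

variable [∀ a, CompleteSpace (B a)] {M : ℝ}

theorem sub_mem_controlled (𝓢 : ParabolicSemigroup 𝓑) (hγ0 : 0 < γ) (hγ1 : γ ≤ 1 / 2)
    (hX : X.IsBounded M) (hp : p ∈ controlled 𝓑 α X) (hq : q ∈ controlled 𝓑 α X) :
    p - q ∈ controlled 𝓑 α X := by
  have h := (isCRP_gubNorm hp).add ((isCRP_gubNorm hq).smul (-1))
  refine IsCRP.mem_controlled 𝓢 hγ0 hγ1 hX
    (N := gubNorm 𝓑 α X p + |(-1)| * gubNorm 𝓑 α X q) ?_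
  convert h using 2
  · simp [sub_eq_add_neg]
  · simp [sub_eq_add_neg]

theorem smul_mem_controlled (𝓢 : ParabolicSemigroup 𝓑) (hγ0 : 0 < γ) (hγ1 : γ ≤ 1 / 2)
    (hX : X.IsBounded M) (hp : p ∈ controlled 𝓑 α X) (c : ℝ) : c • p ∈ controlled 𝓑 α X :=
  IsCRP.mem_controlled 𝓢 hγ0 hγ1 hX ((isCRP_gubNorm hp).smul c)

theorem abs_gubNorm_sub_le (𝓢 : ParabolicSemigroup 𝓑) (hγ0 : 0 < γ) (hγ1 : γ ≤ 1 / 2)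
    (hX : X.IsBounded M) (hp : p ∈ controlled 𝓑 α X) (hq : q ∈ controlled 𝓑 α X) :
    |gubNorm 𝓑 α X p - gubNorm 𝓑 α X q| ≤ gubNorm 𝓑 α X (p - q) := by
  have hd := sub_mem_controlled 𝓢 hγ0 hγ1 hX hp hq
  have h1 := gubNorm_add_le hd hq
  have h2 := gubNorm_add_le (smul_mem_controlled 𝓢 hγ0 hγ1 hX hd (-1)) hp
  have h3 := gubNorm_smul_le hd (-1)
  rw [abs_neg, abs_one, one_mul] at h3
  rw [sub_add_cancel] at h1
  rw [neg_one_smul, neg_sub, sub_add_cancel] at h2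
  rw [neg_one_smul, neg_sub] at h3
  rw [abs_le]
  constructor <;> linarith

/-- The cut-off has slope of order `1 / R`, but its increment multiplies a path of size at most `R`,
so that `R` cancels. -/
theorem gubNorm_truncate_sub_le (𝓢 : ParabolicSemigroup 𝓑) (hγ0 : 0 < γ) (hγ1 : γ ≤ 1 / 2)
    (hX : X.IsBounded M) (hf : IsCutoff f) {L : ℝ}
    (hL : ∀ x y, 0 ≤ x → 0 ≤ y → |f x - f y| ≤ L * |x - y|) (hL0 : 0 ≤ L) (hR : 0 < R)
    (hp : p ∈ controlled 𝓑 α X) (hq : q ∈ controlled 𝓑 α X) :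
    gubNorm 𝓑 α X (truncate 𝓑 α X f R p - truncate 𝓑 α X f R q)
      ≤ (1 + L) * gubNorm 𝓑 α X (p - q) := by
  have hd := sub_mem_controlled 𝓢 hγ0 hγ1 hX hp hq
  have np : 0 ≤ gubNorm 𝓑 α X p := gubNorm_nonneg
  have nq : 0 ≤ gubNorm 𝓑 α X q := gubNorm_nonneg
  have nd : 0 ≤ gubNorm 𝓑 α X (p - q) := gubNorm_nonneg
  have habs := abs_gubNorm_sub_le 𝓢 hγ0 hγ1 hX hp hq
  have fa := hf.range (gubNorm 𝓑 α X p / R) (by positivity)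
  have fb := hf.range (gubNorm 𝓑 α X q / R) (by positivity)
  have hab := hL (gubNorm 𝓑 α X p / R) (gubNorm 𝓑 α X q / R) (by positivity) (by positivity)
  rw [← sub_div, abs_div, abs_of_pos hR] at hab
  have key : ∀ (a c : ℝ) (r : PathPair B α γ), r ∈ controlled 𝓑 α X → gubNorm 𝓑 α X r ≤ R →
      a ∈ Icc (0 : ℝ) 1 → |c| ≤ L * (|gubNorm 𝓑 α X p - gubNorm 𝓑 α X q| / R) →
      gubNorm 𝓑 α X (a • (p - q) + c • r) ≤ (1 + L) * gubNorm 𝓑 α X (p - q) := by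
    intro a c r hr hrR ha hc
    have h1 := gubNorm_add_le (smul_mem_controlled 𝓢 hγ0 hγ1 hX hd a)
      (smul_mem_controlled 𝓢 hγ0 hγ1 hX hr c)
    have h2 := gubNorm_smul_le hd a
    have h3 := gubNorm_smul_le hr c
    rw [abs_of_nonneg ha.1] at h2
    have h4 : a * gubNorm 𝓑 α X (p - q) ≤ gubNorm 𝓑 α X (p - q) := mul_le_of_le_one_left nd ha.2
    have h5 : |c| * gubNorm 𝓑 α X r ≤ L * gubNorm 𝓑 α X (p - q) := by
      calc _ ≤ L * (gubNorm 𝓑 α X (p - q) / R) * R := by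
            refine mul_le_mul (hc.trans ?_) hrR gubNorm_nonneg (by positivity)
            gcongr
        _ = _ := by field_simp
    linarith
  unfold truncate
  -- The increment of the cut-off is put in front of whichever of the two paths lies in the ball; if
  -- neither does, both truncations vanish.
  rcases le_or_gt (gubNorm 𝓑 α X q) R with h | h
  · have := key (f (gubNorm 𝓑 α X p / R)) (f (gubNorm 𝓑 α X p / R) - f (gubNorm 𝓑 α X q / R)) q
      hq h fa hab
    convert this using 2
    module
  rcases le_or_gt (gubNorm 𝓑 α X p) R with h' | h'
  · have := key (f (gubNorm 𝓑 α X q / R)) (f (gubNorm 𝓑 α X p / R) - f (gubNorm 𝓑 α X q / R)) p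
      hp h' fb hab
    convert this using 2
    module
  · rw [hf.eq_zero _ ((one_le_div hR).2 h.le), hf.eq_zero _ ((one_le_div hR).2 h'.le)]
    have := gubNorm_smul_le hp 0
    simp only [zero_smul, abs_zero, zero_mul, sub_zero] at this ⊢
    exact this.trans (by positivity)

end Norm

end

/-! ### The mild solution map and its contraction property. -/

section

variable {B : ℝ → Type*} [∀ a, NormedAddCommGroup (B a)] [∀ a, NormedSpace ℝ (B a)]
  {𝓑 : InterpolationScale B} {γ α σ δ : ℝ}

/-- `p'` is the image of `p` under the mild solution map of the truncated equation. -/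
structure IsMildImage (𝓢 : ParabolicSemigroup 𝓑) (X : RoughPath γ) (F : B α → B (α - δ))
    (G : ∀ a : ℝ, B a → B (a - σ)) (f : ℝ → ℝ) (R : ℝ) (ξ : B α) (p p' : PathPair B α γ) :
    Prop where
  deriv_eq : ∀ t : I, p'.2 t = 𝓑.ι (α - σ) (α - γ) (G α ((truncate 𝓑 α X f R p).1 t))
  mild : ∀ t : I, ∃ J K : B α,
    𝓑.ι α (α - δ) J = (∫ r in (0 : ℝ)..t, 𝓢.S (α - δ) ((t : ℝ) - r)
        (F ((truncate 𝓑 α X f R p).1 (projIcc 0 1 zero_le_one r)))) ∧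
    HasRoughIntegral 𝓢 X (α - 2 * γ - σ)
      (fun r => 𝓑.ι (α - σ) (α - 2 * γ - σ) (G α ((truncate 𝓑 α X f R p).1 r)))
      (fun r => 𝓑.ι (α - γ - σ) (α - 2 * γ - σ)
        (fderiv ℝ (G (α - γ)) (𝓑.ι α (α - γ) ((truncate 𝓑 α X f R p).1 r))
          ((truncate 𝓑 α X f R p).2 r)))
      0 t (𝓑.ι α (α - 2 * γ - σ) K) ∧
    p'.1 t = 𝓢.S α t ξ + J + K

theorem isTruncatedMildSolution_iff {𝓢 : ParabolicSemigroup 𝓑} {X : RoughPath γ}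
    {F : B α → B (α - δ)} {G : ∀ a : ℝ, B a → B (a - σ)} {f : ℝ → ℝ} {R : ℝ} {ξ : B α}
    {p : PathPair B α γ} :
    IsTruncatedMildSolution 𝓢 X F G f R ξ p ↔
      p ∈ controlled 𝓑 α X ∧ IsMildImage 𝓢 X F G f R ξ p p :=
  ⟨fun h => ⟨h.mem, h.deriv_eq, h.mild⟩, fun h => ⟨h.1, h.2.deriv_eq, h.2.mild⟩⟩

theorem isClosed_isCRP (X : RoughPath γ) (N : ℝ) :
    IsClosed {p : PathPair B α γ | IsCRP 𝓑 X α (α - γ) (α - 2 * γ) p.1 p.2 N} := by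
  have c1 : ∀ t : I, Continuous fun p : PathPair B α γ => p.1 t := fun t =>
    (ContinuousEvalConst.continuous_eval_const t).comp continuous_fst
  have c2 : ∀ t : I, Continuous fun p : PathPair B α γ => p.2 t := fun t =>
    (ContinuousEvalConst.continuous_eval_const t).comp continuous_snd
  have d1 : ∀ (a : ℝ) (t : I), Continuous fun p : PathPair B α γ => 𝓑.ι α a (p.1 t) := fun a t =>
    (𝓑.ι α a).continuous.comp (c1 t)
  have d2 : ∀ (a : ℝ) (t : I), Continuous fun p : PathPair B α γ => 𝓑.ι (α - γ) a (p.2 t) :=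
    fun a t => (𝓑.ι (α - γ) a).continuous.comp (c2 t)
  rw [show {p : PathPair B α γ | IsCRP 𝓑 X α (α - γ) (α - 2 * γ) p.1 p.2 N}
      = {p | (∀ t, ‖p.1 t‖ ≤ N) ∧ (∀ t, ‖p.2 t‖ ≤ N) ∧
        (∀ s t : I, s ≤ t → ‖𝓑.ι (α - γ) (α - 2 * γ) (p.2 t) - 𝓑.ι (α - γ) (α - 2 * γ) (p.2 s)‖
          ≤ N * ((t : ℝ) - s) ^ γ) ∧
        (∀ s t : I, s ≤ t → ‖𝓑.ι α (α - 2 * γ) (p.1 t) - 𝓑.ι α (α - 2 * γ) (p.1 s)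
          - (X.W t - X.W s) • 𝓑.ι (α - γ) (α - 2 * γ) (p.2 s)‖ ≤ N * ((t : ℝ) - s) ^ (2 * γ))} from
    Set.ext fun p => ⟨fun h => ⟨h.bound, h.bound', h.incr, h.rem⟩,
      fun h => ⟨h.1, h.2.1, h.2.2.1, h.2.2.2⟩⟩]
  simp only [ofPred_and, ofPred_forall]
  refine (isClosed_iInter fun t => isClosed_le (c1 t).norm continuous_const).inter
    ((isClosed_iInter fun t => isClosed_le (c2 t).norm continuous_const).inter
    ((isClosed_iInter fun s => isClosed_iInter fun t => isClosed_iInter fun _ =>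
      isClosed_le ((d2 _ t).sub (d2 _ s)).norm continuous_const).inter
    (isClosed_iInter fun s => isClosed_iInter fun t => isClosed_iInter fun _ =>
      isClosed_le (((d1 _ t).sub (d1 _ s)).sub ((d2 _ s).const_smul _)).norm continuous_const)))

variable [∀ a, CompleteSpace (B a)]

theorem exists_isMildImage (𝓢 : ParabolicSemigroup 𝓑) (hγ : γ ∈ Ioc (1 / 3 : ℝ) (1 / 2))
    (hσ : σ ∈ Ico 0 γ) (hδ : δ ∈ Ico (0 : ℝ) 1) {F : B α → B (α - δ)} (hF : IsDrift α δ F)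
    {G : ∀ a : ℝ, B a → B (a - σ)} (hG : IsDiffusion 𝓑 α γ σ G) {f : ℝ → ℝ} (hf : IsCutoff f)
    {X : RoughPath γ} {M : ℝ} (hX : X.IsBounded M) {R : ℝ} (hR : 0 < R) (hR1 : R ≤ 1) (ξ : B α)
    {p : PathPair B α γ} (hp : p ∈ controlled 𝓑 α X) :
    ∃ p' ∈ controlled 𝓑 α X, IsMildImage 𝓢 X F G f R ξ p p' := by
  have hγ0 : 0 < γ := by linarith [hγ.1]
  obtain ⟨Cg, hCg, kg⟩ := hG.exists_composition hγ0 hX.nonneg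
  obtain ⟨Ck, hCk, kk⟩ := 𝓢.exists_rough_convolution α hX.nonneg hγ hσ
  obtain ⟨Cj, hCj, kj⟩ := 𝓢.exists_drift_convolution (γ := γ) α hγ0 hγ.2 hδ
  obtain ⟨O, No, hO, hOc⟩ := 𝓢.exists_orbit α hγ0 hγ.2 X ξ
  obtain ⟨KF, hKF⟩ := hF.lipschitz
  obtain ⟨KG, hKG⟩ := hG.lipschitz α (by simp)
  set u := truncate 𝓑 α X f R p with hu
  have hmem : u ∈ controlled 𝓑 α X := smul_mem_controlled 𝓢 hγ0 hγ.2 hX hp _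
  have hcrp := (isCRP_gubNorm hmem).mono (gubNorm_truncate_le hf hR hp)
  -- Comparison with the zero path, where `G(0) = 0`, turns the difference estimate into a bound for
  -- `G(U)` itself.
  have hV := kg X hX u.1 (fun _ => 0) u.2 (fun _ => 0) R R hR1 hcrp (IsCRP.zero hR.le)
    (by simpa using hcrp)
  simp only [map_zero, sub_zero, hG.zero α (by simp)] at hV
  obtain ⟨K, hKI, hKc⟩ := kk X hX _ _ _ hV
  obtain ⟨J, hJI, hJc⟩ := kj X (fun r => F (u.1 (projIcc 0 1 zero_le_one r))) (KF * R)
    (hKF.continuous.comp (u.1.continuous.comp continuous_projIcc)) (fun r => by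
      have h := hKF.dist_le_mul (u.1 (projIcc 0 1 zero_le_one r)) 0
      rw [hF.zero, dist_zero_right, dist_zero_right] at h
      exact h.trans (mul_le_mul_of_nonneg_left (hcrp.bound _) KF.2))
  let D : C(I, B (α - γ)) := ⟨fun t => 𝓑.ι (α - σ) (α - γ) (G α (u.1 t)),
    (𝓑.ι _ _).continuous.comp (hKG.continuous.comp u.1.continuous)⟩
  refine ⟨(O + J + K, D), ?_, fun t => rfl, fun t => ⟨J t, K t, hJI t, hKI t, ?_⟩⟩
  · refine IsCRP.mem_controlled 𝓢 hγ0 hγ.2 hX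
      (N := No + Cj * (KF * R) + Ck * (Cg * (R * R))) ?_
    convert (hOc.add hJc).add hKc using 1
    · rfl
    · funext t
      simp only [zero_add]
      rfl
  · simp only [ContinuousMap.add_apply, hO]

/-- Being stated for arbitrary images `p'` and `q'`, it also shows, for `p = q` and `N = 0`, that
the image is unique. -/
theorem exists_isMildImage_contraction (𝓢 : ParabolicSemigroup 𝓑)
    (hγ : γ ∈ Ioc (1 / 3 : ℝ) (1 / 2)) (hσ : σ ∈ Ico 0 γ) (hδ : δ ∈ Ico (0 : ℝ) 1)
    {F : B α → B (α - δ)} (hF : IsDrift α δ F) {G : ∀ a : ℝ, B a → B (a - σ)}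
    (hG : IsDiffusion 𝓑 α γ σ G) {f : ℝ → ℝ} (hf : IsCutoff f) {M : ℝ} (hM : 0 ≤ M) :
    ∃ R₀ : ℝ, 0 < R₀ ∧ R₀ ≤ 1 ∧ ∀ X : RoughPath γ, X.IsBounded M → ∀ R : ℝ, 0 < R → R ≤ R₀ →
      ∀ (ξ : B α) (p q p' q' : PathPair B α γ), p ∈ controlled 𝓑 α X → q ∈ controlled 𝓑 α X →
      IsMildImage 𝓢 X F G f R ξ p p' → IsMildImage 𝓢 X F G f R ξ q q' → ∀ N : ℝ,
      IsCRP 𝓑 X α (α - γ) (α - 2 * γ) (p - q).1 (p - q).2 N →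
      IsCRP 𝓑 X α (α - γ) (α - 2 * γ) (p' - q').1 (p' - q').2 (N / 2) := by
  have hγ0 : 0 < γ := by linarith [hγ.1]
  obtain ⟨Cg, hCg, kg⟩ := hG.exists_composition hγ0 hM
  obtain ⟨Ck, hCk, kk⟩ := 𝓢.exists_rough_convolution α hM hγ hσ
  obtain ⟨Cj, hCj, kj⟩ := 𝓢.exists_drift_convolution (γ := γ) α hγ0 hγ.2 hδ
  obtain ⟨KF, hKF⟩ := hF.lipschitz
  obtain ⟨L, hL, hfL⟩ := hf.exists_lipschitz
  -- Truncated paths differ by at most `(1 + L) * (4 * N)`. Together with the aim `N / 4` for each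
  -- of the two integrals this gives `16 * (1 + L)`.
  let ε : ℝ≥0 := ⟨1 / (16 * (Cj + 1) * (1 + L)), by positivity⟩
  have hε : (ε : ℝ) = 1 / (16 * (Cj + 1) * (1 + L)) := rfl
  obtain ⟨S, hS, hFS⟩ := hF.deriv_zero.exists_lipschitzOnWith_of_nnnorm_lt ε (by
    rw [nnnorm_zero, ← NNReal.coe_lt_coe, hε, NNReal.coe_zero]
    positivity)
  obtain ⟨r, hr, hrS⟩ := Metric.mem_nhds_iff.1 hS
  -- The three bounds serve the composition estimate, the ball on which `F` is `ε`-Lipschitz, and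
  -- the smallness of the rough integral.
  refine ⟨min 1 (min (r / 2) (1 / (16 * (Ck * Cg + 1) * (1 + L)))), by positivity,
    min_le_left _ _, fun X hX R hR hRR ξ p q p' q' hp hq hpi hqi N hN => ?_⟩
  have hR1 : R ≤ 1 := hRR.trans (min_le_left _ _)
  have hRr : R < r := by
    have := hRR.trans ((min_le_right _ _).trans (min_le_left _ _))
    linarith
  have hRG : R ≤ 1 / (16 * (Ck * Cg + 1) * (1 + L)) :=
    hRR.trans ((min_le_right _ _).trans (min_le_right _ _))
  have hN0 := hN.nonneg
  set u := truncate 𝓑 α X f R p with hu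
  set v := truncate 𝓑 α X f R q with hv
  have hum : u ∈ controlled 𝓑 α X := smul_mem_controlled 𝓢 hγ0 hγ.2 hX hp _
  have hvm : v ∈ controlled 𝓑 α X := smul_mem_controlled 𝓢 hγ0 hγ.2 hX hq _
  have hucrp := (isCRP_gubNorm hum).mono (gubNorm_truncate_le hf hR hp)
  have hvcrp := (isCRP_gubNorm hvm).mono (gubNorm_truncate_le hf hR hq)
  set d := (1 + L) * (4 * N) with hd
  have hd0 : 0 ≤ d := by positivity
  have hdcrp : IsCRP 𝓑 X α (α - γ) (α - 2 * γ) (fun t => u.1 t - v.1 t)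
      (fun t => u.2 t - v.2 t) d := by
    refine (isCRP_gubNorm (sub_mem_controlled 𝓢 hγ0 hγ.2 hX hum hvm)).mono ?_
    refine (gubNorm_truncate_sub_le 𝓢 hγ0 hγ.2 hX hf hfL hL hR hp hq).trans ?_
    exact mul_le_mul_of_nonneg_left hN.gubNorm_le (by positivity)
  have hV := kg X hX u.1 v.1 u.2 v.2 R d hR1 hucrp hvcrp hdcrp
  obtain ⟨K, hKI, hKc⟩ := kk X hX _ _ _ hV
  have hcont : ∀ w : PathPair B α γ,
      Continuous fun r : ℝ => F (w.1 (projIcc 0 1 zero_le_one r)) := fun w =>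
    hKF.continuous.comp (w.1.continuous.comp continuous_projIcc)
  have hball : ∀ w : PathPair B α γ, (∀ t, ‖w.1 t‖ ≤ R) → ∀ t, w.1 t ∈ S := fun w hw t =>
    hrS (mem_ball_zero_iff.2 ((hw t).trans_lt hRr))
  obtain ⟨J, hJI, hJc⟩ := kj X (fun r => F (u.1 (projIcc 0 1 zero_le_one r))
    - F (v.1 (projIcc 0 1 zero_le_one r))) (ε * d) ((hcont u).sub (hcont v)) (fun r => by
      have h := hFS.dist_le_mul _ (hball u hucrp.bound (projIcc 0 1 zero_le_one r)) _
        (hball v hvcrp.bound (projIcc 0 1 zero_le_one r))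
      rw [dist_eq_norm, dist_eq_norm] at h
      exact h.trans (mul_le_mul_of_nonneg_left (hdcrp.bound _) ε.2))
  have hsum := (hJc.add hKc).mono (N' := N / 2) (by
    have h1 : Cj * (ε * d) ≤ N / 4 := by
      rw [hε, hd, show Cj * (1 / (16 * (Cj + 1) * (1 + L)) * ((1 + L) * (4 * N)))
        = Cj / (Cj + 1) * (N / 4) by field_simp; ring]
      exact mul_le_of_le_one_left (by positivity) ((div_le_one (by positivity)).2 (by linarith))
    have h2 : Ck * (Cg * (R * d)) ≤ N / 4 := by
      calc Ck * (Cg * (R * d)) ≤ Ck * (Cg * (1 / (16 * (Ck * Cg + 1) * (1 + L)) * d)) := by gcongr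
        _ = Ck * Cg / (Ck * Cg + 1) * (N / 4) := by rw [hd]; field_simp; ring
        _ ≤ _ := mul_le_of_le_one_left (by positivity)
          ((div_le_one (by positivity)).2 (by linarith))
    linarith)
  convert hsum using 1
  · funext t
    obtain ⟨J₁, K₁, hJ₁, hK₁, e₁⟩ := hpi.mild t
    obtain ⟨J₂, K₂, hJ₂, hK₂, e₂⟩ := hqi.mild t
    -- The convolution built from `G(u) - G(v)` is the difference of the given integrals, since
    -- limits of Riemann sums are unique and inclusions are injective. The controlled bounds thus
    -- pass to `p' - q'`.
    have eK : K t = K₁ - K₂ := by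
      refine 𝓑.ι_injective (a := α - 2 * γ - σ) (by linarith [hσ.1]) ?_
      have h := hKI t
      simp only [map_sub] at h
      rw [map_sub]
      exact h.unique (hK₁.sub hK₂)
    have eJ : J t = J₁ - J₂ := by
      refine 𝓑.ι_injective (a := α - δ) (by linarith [hδ.1]) ?_
      rw [hJI, map_sub, hJ₁, hJ₂, ← intervalIntegral.integral_sub]
      · simp only [map_sub]
        rfl
      · exact 𝓢.intervalIntegrable_convolution _ (hcont u) (s := 0) t.2.1 le_rfl
      · exact 𝓢.intervalIntegrable_convolution _ (hcont v) (s := 0) t.2.1 le_rfl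
    rw [eK, eJ]
    change p'.1 t - q'.1 t = _
    rw [e₁, e₂]
    abel
  · funext t
    change p'.2 t - q'.2 t = _
    rw [hpi.deriv_eq, hqi.deriv_eq, map_sub, zero_add]

end

end RoughPDE

end


/-! ### Conclusion: the fixed point is the solution. -/

theorem theorem4p3 {B : ℝ → Type*} [∀ a, NormedAddCommGroup (B a)] [∀ a, NormedSpace ℝ (B a)]
    [∀ a, CompleteSpace (B a)] [∀ a, TopologicalSpace.SeparableSpace (B a)]
    (𝓑 : RoughPDE.InterpolationScale B) (𝓢 : RoughPDE.ParabolicSemigroup 𝓑)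
    (α γ σ δ : ℝ) (hγ : γ ∈ Set.Ioc (1 / 3 : ℝ) (1 / 2)) (hσ : σ ∈ Set.Ico 0 γ)
    (hδ : δ ∈ Set.Ico (0 : ℝ) 1)
    (F : B α → B (α - δ)) (hF : RoughPDE.IsDrift α δ F)
    (G : ∀ a : ℝ, B a → B (a - σ)) (hG : RoughPDE.IsDiffusion 𝓑 α γ σ G)
    (f : ℝ → ℝ) (hf : RoughPDE.IsCutoff f) (M : ℝ≥0) :
    ∃ R₀ : ℝ, 0 < R₀ ∧ ∀ X : RoughPDE.RoughPath γ, X.rho ≤ (M : ℝ≥0∞) →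
      ∀ R : ℝ, 0 < R → R ≤ R₀ → ∀ ξ : B α,
        ∃! p : RoughPDE.PathPair B α γ, RoughPDE.IsTruncatedMildSolution 𝓢 X F G f R ξ p := by
  obtain ⟨R₀, hR₀, hR₁, hcontr⟩ :=
    RoughPDE.exists_isMildImage_contraction 𝓢 hγ hσ hδ hF hG hf M.2
  refine ⟨R₀, hR₀, fun X hXM R hR hRR ξ => ?_⟩
  have hX := X.isBounded hXM
  have hγ0 : 0 < γ := by linarith [hγ.1]
  -- The solution map must be total for the fixed point principle; outside the controlled paths its
  -- value is irrelevant and set to `0`.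
  have hex : ∀ p : RoughPDE.PathPair B α γ, ∃ p' : RoughPDE.PathPair B α γ,
      p ∈ RoughPDE.controlled 𝓑 α X → p' ∈ RoughPDE.controlled 𝓑 α X ∧
        RoughPDE.IsMildImage 𝓢 X F G f R ξ p p' := by
    intro p
    by_cases hp : p ∈ RoughPDE.controlled 𝓑 α X
    · obtain ⟨p', h1, h2⟩ :=
        RoughPDE.exists_isMildImage 𝓢 hγ hσ hδ hF hG hf hX hR (hRR.trans hR₁) ξ hp
      exact ⟨p', fun _ => ⟨h1, h2⟩⟩
    · exact ⟨0, fun h => absurd h hp⟩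
  choose Φ hΦ using hex
  let Q : ℝ → RoughPDE.PathPair B α γ → Prop := fun N p =>
    RoughPDE.IsCRP 𝓑 X α (α - γ) (α - 2 * γ) p.1 p.2 N
  have hQ : ∀ p, (∃ N, Q N p) ↔ p ∈ RoughPDE.controlled 𝓑 α X := fun p =>
    ⟨fun ⟨_, h⟩ => RoughPDE.IsCRP.mem_controlled 𝓢 hγ0 hγ.2 hX h,
      fun h => ⟨_, RoughPDE.isCRP_gubNorm h⟩⟩
  obtain ⟨p, ⟨hp, hfix⟩, huniq⟩ := RoughPDE.existsUnique_fixedPoint_of_gauge (Q := Q) (Φ := Φ)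
    (fun N p h => norm_prod_le_iff.2 ⟨(ContinuousMap.norm_le _ h.nonneg).2 h.bound,
      (ContinuousMap.norm_le _ h.nonneg).2 h.bound'⟩)
    (RoughPDE.IsCRP.zero le_rfl) (fun _ _ _ _ h h' => h.add h')
    (fun N p h => by
      have := h.smul (-1)
      simp only [neg_smul, one_smul, abs_neg, abs_one, one_mul] at this
      exact this) (fun _ _ _ h h' => h'.mono h)
    (fun N => RoughPDE.isClosed_isCRP X N)
    (fun p h => (hQ _).2 (hΦ p ((hQ p).1 h)).1)
    (fun p q hp hq N h => hcontr X hX R hR hRR ξ p q _ _ ((hQ p).1 hp) ((hQ q).1 hq)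
      (hΦ p ((hQ p).1 hp)).2 (hΦ q ((hQ q).1 hq)).2 N h)
  have hpc := (hQ p).1 hp
  refine ⟨p, RoughPDE.isTruncatedMildSolution_iff.2 ⟨hpc, ?_⟩, fun q hq => ?_⟩
  · have := (hΦ p hpc).2
    rwa [hfix] at this
  · obtain ⟨hqc, hqi⟩ := RoughPDE.isTruncatedMildSolution_iff.1 hq
    refine huniq q ⟨(hQ q).2 hqc, ?_⟩
    -- A solution `q` and the chosen `Φ q` are both images of `q`, so the contraction estimate with
    -- `N = 0` identifies them.
    have h := hcontr X hX R hR hRR ξ q q _ _ hqc hqc (hΦ q hqc).2 hqi 0 (by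
      rw [sub_self]
      exact RoughPDE.IsCRP.zero le_rfl)
    rw [zero_div] at h
    have h1 : ‖(Φ q - q).1‖ ≤ 0 := (ContinuousMap.norm_le _ le_rfl).2 h.bound
    have h2 : ‖(Φ q - q).2‖ ≤ 0 := (ContinuousMap.norm_le _ le_rfl).2 h.bound'
    exact sub_eq_zero.1 (Prod.ext (norm_le_zero_iff.1 h1) (norm_le_zero_iff.1 h2))
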